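/- **Setting.** Let $d\ge 1$ and let $\Omega\subset\mathbb R^d$ be a bounded domain (open and connected) with $\operatorname{int}\overline\Omega=\Omega$, whose boundary $\Gamma=\partial\Omega$ is the disjoint union of two sets $\Gamma_c$ and $\Gamma_t$ of positive $(d-1)$-dimensional measure. Let $\mathcal T_h$ be a finite partition of $\overline\Omega$ into closed, possibly non-convex, polytopal elements with pairwise disjoint interiors, and let $\mathcal E_h$ be the finite set of their edges/faces: each $e\in\mathcal E_h$ is a $(d-1)$-dimensional polytope contained in a hyperplane, the boundary of each $T\in\mathcal T_h$ is the union of the $e\in\mathcal E_h$ contained in it (the faces of $T$), every $e\in\mathcal E_h$ is a face of some element, and the relative interior of a face meets no other face. (Elements and faces have connected (relative) interior and are the closure of it.) Assume that different faces of one element lie in different hyperplanes. Let $\mu>0$ and $\lambda$ be Lamé parameters with $2\mu+d\lambda>0$ (in particular any $\lambda\ge 0$ is allowed), and let $K$ be a symmetric positive definite $d\times d$ conductivity tensor on $\Omega$ with integrable entries (for instance constant). Let $k\ge 1$. **Spaces.** $P_r(S)$ is the space of polynomials of total degree at most $r$ restricted to $S$. $W_h$ is the space of pairs $q=\{q_0,q_b\}$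 with $q_0|_T\in P_k(T)$ for each $T\in\mathcal T_h$ and $q_b|_e\in P_k(e)$ for each $e\in\mathcal E_h$ ($q_b$ is single-valued on $e$), and $V_h$ is the space of pairs $\mathbf v=\{\mathbf v_0,\mathbf v_b\}$ with $\mathbf v_0|_T\in[P_k(T)]^d$ and $\mathbf v_b|_e\in[P_k(e)]^d$. Put $$V_h^c=\{\mathbf v\in V_h:\ \mathbf v_b=0\text{ on }\Gamma_c\},\qquad W_h^t=\{q\in W_h:\ q_b=0\text{ on }\Gamma_t\},$$ where vanishing is understood almost everywhere for the surface measure. **Discrete weak operators.** For $T\in\mathcal T_h$ with $N$ faces and unit outward normal $\mathbf n$, let $r=k-1+N$ if $T$ is convex and $r=k-1+2N$ otherwise. On $T$, let $\nabla_w q\in[P_r(T)]^d$, $\nabla_w\mathbf v\in[P_r(T)]^{d\times d}$ and $\nabla_w\cdot\mathbf v\in P_r(T)$ be the unique polynomials with $$(\nabla_w q,\mathbf w)_T=-(q_0,\nabla\cdot\mathbf w)_T+\langle q_b,\mathbf w\cdot\mathbf n\rangle_{\partial T}\quad\forall\,\mathbf w\in[P_r(T)]^d,$$ $$(\nabla_w\mathbf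 v,\boldsymbol\varphi)_T=-(\mathbf v_0,\nabla\cdot\boldsymbol\varphi)_T+\langle\mathbf v_b,\boldsymbol\varphi\,\mathbf n\rangle_{\partial T}\quad\forall\,\boldsymbol\varphi\in[P_r(T)]^{d\times d},$$ $$(\nabla_w\cdot\mathbf v,w)_T=-(\mathbf v_0,\nabla w)_T+\langle\mathbf v_b\cdot\mathbf n,w\rangle_{\partial T}\quad\forall\,w\in P_r(T),$$ and let $\epsilon_w\mathbf v=\tfrac12(\nabla_w\mathbf v+(\nabla_w\mathbf v)^T)$. Define $$|||\mathbf v|||_{V_h}=\Big(\sum_{T\in\mathcal T_h}2\mu\|\epsilon_w\mathbf v\|_T^2+\lambda\|\nabla_w\cdot\mathbf v\|_T^2\Big)^{1/2},\qquad |||q|||_{W_h}=\Big(\sum_{T\in\mathcal T_h}(K\nabla_w q,\nabla_w q)_T\Big)^{1/2}.$$ **Lemma.** $|||\cdot|||_{V_h}$ is a norm on $V_h^c$, and $|||\cdot|||_{W_h}$ is a norm on $W_h^t$. -/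

import Mathlib

open MeasureTheory Topology

noncomputable section

namespace WG

/-- `ℝ^d` with its Euclidean norm. -/
abbrev Space (d : ℕ) : Type := EuclideanSpace ℝ (Fin d)

/-- The real polynomials in `d` variables. -/
abbrev Poly (d : ℕ) : Type := MvPolynomial (Fin d) ℝ

/-- The value of a polynomial at a point of `ℝ^d`. -/
def ev {d : ℕ} (p : Poly d) (x : Space d) : ℝ := MvPolynomial.eval (fun i => x i) p

/-- The polynomials of total degree at most `r`. On an element `T`, which has interior points,
this is `P_r(T)`: a polynomial is determined by its values on `T`. -/
abbrev polyLE (d r : ℕ) : Submodule ℝ (Poly d) := MvPolynomial.restrictTotalDegree (Fin d) ℝ r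

/-- Restriction of a polynomial to a subset of `ℝ^d`, as a function on that subset. -/
def restrictTo {d : ℕ} (S : Set (Space d)) : Poly d →ₗ[ℝ] (S → ℝ) :=
  LinearMap.pi fun x => (MvPolynomial.aeval (fun i => x.1 i)).toLinearMap

/-- `P_k(e)`: the functions on `e` that are restrictions of polynomials of degree at most `k`. -/
def facePoly {d : ℕ} (e : Set (Space d)) (k : ℕ) : Submodule ℝ (e → ℝ) :=
  (polyLE d k).map (restrictTo e)

/-- A finite union of convex polytopes (of any dimension). -/
def IsPolytopal {d : ℕ} (S : Set (Space d)) : Prop :=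
  ∃ C : Finset (Finset (Space d)), S = ⋃ s ∈ C, convexHull ℝ (s : Set (Space d))

/-- A closed, possibly non-convex, `d`-dimensional polytope. -/
structure IsElement {d : ℕ} (T : Set (Space d)) : Prop where
  polytopal : IsPolytopal T
  closure_interior : closure (interior T) = T
  connected : IsConnected (interior T)

/-- A closed, possibly non-convex, `(d-1)`-dimensional polytope lying in a hyperplane of `ℝ^d`. -/
structure IsFace {d : ℕ} (e : Set (Space d)) : Prop where
  polytopal : IsPolytopal e
  finrank_add_one : Module.finrank ℝ (vectorSpan ℝ e) + 1 = d
  closure_interior : closure (intrinsicInterior ℝ e) = e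
  connected : IsConnected (intrinsicInterior ℝ e)

/-- A finite partition of (the closure of) `Ω` into polytopal elements, together with the set of
all edges/faces of its elements. -/
structure PolytopalMesh (d : ℕ) (Ω : Set (Space d)) where
  /-- the (closed) elements -/
  elems : Finset (Set (Space d))
  /-- the (closed) edges/faces -/
  faces : Finset (Set (Space d))
  isElement : ∀ T ∈ elems, IsElement T
  isFace : ∀ e ∈ faces, IsFace e
  iUnion_elems : ⋃ T ∈ elems, T = closure Ω
  disjoint_interiors : ∀ T ∈ elems, ∀ T' ∈ elems, T ≠ T' → Disjoint (interior T) (interior T')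
  disjoint_faces : ∀ e ∈ faces, ∀ e' ∈ faces, e ≠ e' → Disjoint (intrinsicInterior ℝ e) e'
  frontier_elem : ∀ T ∈ elems, frontier T = ⋃ e ∈ faces, ⋃ _ : e ⊆ frontier T, e
  face_of_elem : ∀ e ∈ faces, ∃ T ∈ elems, e ⊆ frontier T

/-- `n` is the unit normal to the face `e` of `T` that points out of `T`. -/
def IsOutwardNormal {d : ℕ} (T e : Set (Space d)) (n : Space d) : Prop :=
  ‖n‖ = 1 ∧ (∀ x ∈ e, ∀ y ∈ e, inner ℝ n (x - y) = 0) ∧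
    ∀ x ∈ intrinsicInterior ℝ e, ∀ᶠ t : ℝ in 𝓝[>] 0, x + t • n ∉ T ∧ x - t • n ∈ T

/-- The unit outward normal of `T` on its face `e`. -/
def outwardNormal {d : ℕ} (T e : Set (Space d)) : Space d :=
  Classical.epsilon (IsOutwardNormal T e)

/-- Integral over a face with respect to the `(d-1)`-dimensional surface measure. -/
def faceIntegral {d : ℕ} (e : Set (Space d)) (f : e → ℝ) : ℝ :=
  ∫ x : e, f x ∂((μHE[d - 1] : Measure (Space d)).comap Subtype.val)

namespace PolytopalMesh

variable {d : ℕ} {Ω : Set (Space d)}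

open Classical in
/-- The faces of an element. -/
def facesOf (M : PolytopalMesh d Ω) (T : M.elems) : Finset M.faces :=
  Finset.univ.filter fun e => (e : Set (Space d)) ⊆ frontier (T : Set (Space d))

/-- Different faces of one element lie in different hyperplanes. -/
def NoCoplanarFaces (M : PolytopalMesh d Ω) : Prop :=
  ∀ T : M.elems, ∀ e ∈ M.facesOf T, ∀ e' ∈ M.facesOf T,
    affineSpan ℝ (e : Set (Space d)) = affineSpan ℝ (e' : Set (Space d)) → e = e'

/-- Piecewise polynomial scalar weak functions `{q₀, q_b}`: `q.1 T` is `q₀` on the element `T`,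
and `q.2 e` is the (single-valued) function `q_b` on the face `e`. -/
abbrev ScalarWeak (M : PolytopalMesh d Ω) : Type :=
  (M.elems → Poly d) × ((e : M.faces) → (e.1 → ℝ))

/-- Piecewise polynomial vector weak functions `{v₀, v_b}`: `v.1 T i` is the `i`-th component of
`v₀` on `T`, and `v.2 e i` the `i`-th component of `v_b` on the face `e`. -/
abbrev VectorWeak (M : PolytopalMesh d Ω) : Type :=
  (M.elems → Fin d → Poly d) × ((e : M.faces) → Fin d → (e.1 → ℝ))

/-- The space `W_h`. -/
def Wh (M : PolytopalMesh d Ω) (k : ℕ) : Submodule ℝ M.ScalarWeak :=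
  (Submodule.pi Set.univ fun _ => polyLE d k).prod
    (Submodule.pi Set.univ fun e => facePoly (e : Set (Space d)) k)

/-- The space `V_h`. -/
def Vh (M : PolytopalMesh d Ω) (k : ℕ) : Submodule ℝ M.VectorWeak :=
  (Submodule.pi Set.univ fun _ => Submodule.pi Set.univ fun _ => polyLE d k).prod
    (Submodule.pi Set.univ fun e => Submodule.pi Set.univ fun _ => facePoly (e : Set (Space d)) k)

/-- `W_h^t`: the functions in `W_h` with `q_b = 0` almost everywhere on the boundary part `Γ`. -/
def WhZero (M : PolytopalMesh d Ω) (k : ℕ) (Γ : Set (Space d)) : Submodule ℝ M.ScalarWeak where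
  carrier := {q | q ∈ M.Wh k ∧ ∀ e : M.faces,
    ∀ᵐ x : (e : Set (Space d)) ∂((μHE[d - 1] : Measure (Space d)).comap Subtype.val),
      (x : Space d) ∈ Γ → q.2 e x = 0}
  add_mem' := by
    rintro a b ⟨ha, ha'⟩ ⟨hb, hb'⟩
    refine ⟨add_mem ha hb, fun e => ?_⟩
    filter_upwards [ha' e, hb' e] with x hx hx' hΓ
    simp [hx hΓ, hx' hΓ]
  zero_mem' := ⟨zero_mem _, fun e => by simp⟩
  smul_mem' := by
    rintro c a ⟨ha, ha'⟩
    refine ⟨Submodule.smul_mem _ c ha, fun e => ?_⟩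
    filter_upwards [ha' e] with x hx hΓ
    simp [hx hΓ]

/-- `V_h^c`: the functions in `V_h` with `v_b = 0` almost everywhere on the boundary part `Γ`. -/
def VhZero (M : PolytopalMesh d Ω) (k : ℕ) (Γ : Set (Space d)) : Submodule ℝ M.VectorWeak where
  carrier := {v | v ∈ M.Vh k ∧ ∀ e : M.faces,
    ∀ᵐ x : (e : Set (Space d)) ∂((μHE[d - 1] : Measure (Space d)).comap Subtype.val),
      (x : Space d) ∈ Γ → ∀ i, v.2 e i x = 0}
  add_mem' := by
    rintro a b ⟨ha, ha'⟩ ⟨hb, hb'⟩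
    refine ⟨add_mem ha hb, fun e => ?_⟩
    filter_upwards [ha' e, hb' e] with x hx hx' hΓ i
    simp [hx hΓ i, hx' hΓ i]
  zero_mem' := ⟨zero_mem _, fun e => by simp⟩
  smul_mem' := by
    rintro c a ⟨ha, ha'⟩
    refine ⟨Submodule.smul_mem _ c ha, fun e => ?_⟩
    filter_upwards [ha' e] with x hx hΓ i
    simp [hx hΓ i]

open Classical in
/-- The degree used for the discrete weak operators on `T`, with `N` the number of faces of `T`:
`k - 1 + N` if `T` is convex and `k - 1 + 2 N` otherwise (here `k ≥ 1`). -/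
def weakDegree (M : PolytopalMesh d Ω) (k : ℕ) (T : M.elems) : ℕ :=
  if Convex ℝ (T : Set (Space d)) then k - 1 + (M.facesOf T).card
  else k - 1 + 2 * (M.facesOf T).card

/-- `g ∈ [P_r(T)]^d` and `(g, w)_T = -(q₀, ∇·w)_T + ⟨q_b, w·n⟩_{∂T}` for all `w ∈ [P_r(T)]^d`. -/
def IsWeakGrad (M : PolytopalMesh d Ω) (r : ℕ) (T : M.elems) (q : M.ScalarWeak)
    (g : Fin d → Poly d) : Prop :=
  (∀ i, g i ∈ polyLE d r) ∧ ∀ w : Fin d → Poly d, (∀ i, w i ∈ polyLE d r) →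
    ∫ x in (T : Set (Space d)), ∑ i, ev (g i) x * ev (w i) x =
      -(∫ x in (T : Set (Space d)), ev (q.1 T) x * ev (∑ i, MvPolynomial.pderiv i (w i)) x) +
        ∑ e ∈ M.facesOf T, faceIntegral (e : Set (Space d)) fun x =>
          q.2 e x * ∑ i, ev (w i) x * outwardNormal (T : Set (Space d)) e i

/-- The discrete weak gradient `∇_{w,r,T} q`, the unique `g` with the property above. -/
def weakGrad (M : PolytopalMesh d Ω) (r : ℕ) (T : M.elems) (q : M.ScalarWeak) : Fin d → Poly d :=
  Classical.epsilon (M.IsWeakGrad r T q)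

/-- `G ∈ [P_r(T)]^{d×d}` and `(G, φ)_T = -(v₀, ∇·φ)_T + ⟨v_b, φ n⟩_{∂T}` for all
`φ ∈ [P_r(T)]^{d×d}`; the divergence is taken row by row, so that `G i j` stands for `∂_j v_i`. -/
def IsWeakGradVec (M : PolytopalMesh d Ω) (r : ℕ) (T : M.elems) (v : M.VectorWeak)
    (G : Fin d → Fin d → Poly d) : Prop :=
  (∀ i j, G i j ∈ polyLE d r) ∧ ∀ φ : Fin d → Fin d → Poly d, (∀ i j, φ i j ∈ polyLE d r) →
    ∫ x in (T : Set (Space d)), ∑ i, ∑ j, ev (G i j) x * ev (φ i j) x =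
      -(∫ x in (T : Set (Space d)),
          ∑ i, ev (v.1 T i) x * ev (∑ j, MvPolynomial.pderiv j (φ i j)) x) +
        ∑ e ∈ M.facesOf T, faceIntegral (e : Set (Space d)) fun x =>
          ∑ i, v.2 e i x * ∑ j, ev (φ i j) x * outwardNormal (T : Set (Space d)) e j

/-- The discrete weak gradient `∇_{w,r,T} v`. -/
def weakGradVec (M : PolytopalMesh d Ω) (r : ℕ) (T : M.elems) (v : M.VectorWeak) :
    Fin d → Fin d → Poly d :=
  Classical.epsilon (M.IsWeakGradVec r T v)

/-- The discrete weak strain tensor `ε_{w,r,T}(v) = (∇_{w,r,T} v + (∇_{w,r,T} v)ᵀ) / 2`. -/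
def weakStrain (M : PolytopalMesh d Ω) (r : ℕ) (T : M.elems) (v : M.VectorWeak)
    (i j : Fin d) : Poly d :=
  (1 / 2 : ℝ) • (M.weakGradVec r T v i j + M.weakGradVec r T v j i)

/-- `g ∈ P_r(T)` and `(g, w)_T = -(v₀, ∇w)_T + ⟨v_b·n, w⟩_{∂T}` for all `w ∈ P_r(T)`. -/
def IsWeakDiv (M : PolytopalMesh d Ω) (r : ℕ) (T : M.elems) (v : M.VectorWeak)
    (g : Poly d) : Prop :=
  g ∈ polyLE d r ∧ ∀ w ∈ polyLE d r,
    ∫ x in (T : Set (Space d)), ev g x * ev w x =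
      -(∫ x in (T : Set (Space d)), ∑ i, ev (v.1 T i) x * ev (MvPolynomial.pderiv i w) x) +
        ∑ e ∈ M.facesOf T, faceIntegral (e : Set (Space d)) fun x =>
          (∑ i, v.2 e i x * outwardNormal (T : Set (Space d)) e i) * ev w x

/-- The discrete weak divergence `∇_{w,r,T} · v`. -/
def weakDiv (M : PolytopalMesh d Ω) (r : ℕ) (T : M.elems) (v : M.VectorWeak) : Poly d :=
  Classical.epsilon (M.IsWeakDiv r T v)

/-- `|||v|||_{V_h} = (∑_T 2μ ‖ε_w v‖_T² + λ ‖∇_w · v‖_T²)^{1/2}`. -/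
def normVh (M : PolytopalMesh d Ω) (k : ℕ) (mu lam : ℝ) (v : M.VectorWeak) : ℝ :=
  Real.sqrt (∑ T : M.elems,
    (2 * mu * (∫ x in (T : Set (Space d)),
        ∑ i, ∑ j, ev (M.weakStrain (M.weakDegree k T) T v i j) x ^ 2) +
      lam * ∫ x in (T : Set (Space d)), ev (M.weakDiv (M.weakDegree k T) T v) x ^ 2))

/-- `|||q|||_{W_h} = (∑_T (K ∇_w q, ∇_w q)_T)^{1/2}`. -/
def normWh (M : PolytopalMesh d Ω) (k : ℕ) (K : Space d → Matrix (Fin d) (Fin d) ℝ)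
    (q : M.ScalarWeak) : ℝ :=
  Real.sqrt (∑ T : M.elems, ∫ x in (T : Set (Space d)),
    ∑ i, ∑ j, K x i j * ev (M.weakGrad (M.weakDegree k T) T q j) x *
      ev (M.weakGrad (M.weakDegree k T) T q i) x)

end PolytopalMesh

/-- The function `f` is a norm on the real vector space `E`. -/
def IsNorm {E : Type*} [AddCommGroup E] [Module ℝ E] (f : E → ℝ) : Prop :=
  letI : Norm E := ⟨f⟩
  NormedSpace.Core ℝ E

end WG

end

namespace WG

/-! ### Polynomials: derivatives, degrees and rigid motions -/

section Polynomials

variable {d : ℕ}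

@[simp] theorem ev_zero (x : Space d) : ev (0 : Poly d) x = 0 := by simp [ev]
@[simp] theorem ev_one (x : Space d) : ev (1 : Poly d) x = 1 := by simp [ev]
@[simp] theorem ev_add (p q : Poly d) (x : Space d) : ev (p + q) x = ev p x + ev q x := by
  simp [ev]
@[simp] theorem ev_sub (p q : Poly d) (x : Space d) : ev (p - q) x = ev p x - ev q x := by
  simp [ev]
@[simp] theorem ev_neg (p : Poly d) (x : Space d) : ev (-p) x = -ev p x := by simp [ev]
@[simp] theorem ev_mul (p q : Poly d) (x : Space d) : ev (p * q) x = ev p x * ev q x := by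
  simp [ev]
@[simp] theorem ev_pow (p : Poly d) (m : ℕ) (x : Space d) : ev (p ^ m) x = ev p x ^ m := by
  simp [ev]
@[simp] theorem ev_smul (c : ℝ) (p : Poly d) (x : Space d) : ev (c • p) x = c * ev p x := by
  simp [ev, MvPolynomial.smul_eval]
@[simp] theorem ev_C (c : ℝ) (x : Space d) : ev (MvPolynomial.C c : Poly d) x = c := by simp [ev]
@[simp] theorem ev_X (i : Fin d) (x : Space d) : ev (MvPolynomial.X i : Poly d) x = x i := by
  simp [ev]
@[simp] theorem ev_sum {ι : Type*} (s : Finset ι) (p : ι → Poly d) (x : Space d) :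
    ev (∑ i ∈ s, p i) x = ∑ i ∈ s, ev (p i) x := by simp [ev]
@[simp] theorem ev_prod {ι : Type*} (s : Finset ι) (p : ι → Poly d) (x : Space d) :
    ev (∏ i ∈ s, p i) x = ∏ i ∈ s, ev (p i) x := by simp [ev]

theorem continuous_ev (p : Poly d) : Continuous (ev p) := by
  have h : Continuous fun x : Space d => fun i => x i := by fun_prop
  exact p.continuous_eval.comp h

/-- A polynomial that vanishes on a set with interior points is zero. -/
theorem eq_zero_of_ev_eq_zero_on {p : Poly d} {U : Set (Space d)} (hU : (interior U).Nonempty)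
    (h : ∀ x ∈ U, ev p x = 0) : p = 0 := by
  obtain ⟨a, ha⟩ := hU
  have hnhds : {y : Fin d → ℝ | WithLp.toLp 2 y ∈ interior U} ∈ 𝓝 (fun i => a i) := by
    refine (isOpen_interior.preimage ?_).mem_nhds ?_
    · exact PiLp.continuous_toLp 2 _
    · exact ha
  obtain ⟨ε, hε, hb⟩ := Metric.mem_nhds_iff.1 hnhds
  refine MvPolynomial.funext_set (fun i => Metric.ball (a i) ε) (fun i => ?_) fun y hy => ?_
  · rw [Real.ball_eq_Ioo]
    exact Set.Ioo_infinite (by linarith)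
  · have : y ∈ Metric.ball (fun i => a i) ε := by
      rw [Metric.mem_ball, dist_pi_lt_iff hε]
      exact fun i => hy i trivial
    have := h _ (interior_subset (hb this))
    simpa [ev] using this

theorem eq_of_ev_eq {p q : Poly d} (h : ∀ x, ev p x = ev q x) : p = q := by
  rw [← sub_eq_zero]
  exact eq_zero_of_ev_eq_zero_on (U := Set.univ) (by simp) fun x _ => by simp [h x]

/-- The only link between formal and analytic derivatives: every later argument differentiates along
a line. -/
theorem hasDerivAt_ev_line (p : Poly d) (y v : Space d) (t : ℝ) :
    HasDerivAt (fun s : ℝ => ev p (y + s • v))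
      (∑ j, v j * ev (MvPolynomial.pderiv j p) (y + t • v)) t := by
  induction p using MvPolynomial.induction_on with
  | C a => simpa using hasDerivAt_const t a
  | add p q hp hq =>
    convert! hp.add hq using 1
    · funext s; simp
    · simp [mul_add, Finset.sum_add_distrib]
  | mul_X p i hp =>
    have hX : HasDerivAt (fun s : ℝ => ev (MvPolynomial.X i : Poly d) (y + s • v)) (v i) t := by
      have h1 : HasDerivAt (fun s : ℝ => y i + s * v i) (v i) t := by
        simpa using ((hasDerivAt_id t).mul_const (v i)).const_add (y i)
      simpa using h1
    have := hp.mul hX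
    convert! this using 1
    · funext s; simp
    · simp only [MvPolynomial.pderiv_mul, ev_add, ev_mul, MvPolynomial.pderiv_X, mul_add,
        Finset.sum_add_distrib, Finset.sum_mul, mul_assoc]
      congr 1
      rw [Finset.sum_eq_single i]
      · simp [mul_comm]
      · intro j _ hj
        simp [hj.symm]
      · simp

/-- A polynomial whose gradient vanishes is constant. -/
theorem eq_C_of_pderiv_eq_zero {p : Poly d} (h : ∀ i, MvPolynomial.pderiv i p = 0) :
    p = MvPolynomial.C (ev p 0) := by
  refine eq_of_ev_eq fun x => ?_
  have hd : ∀ t : ℝ, HasDerivAt (fun s : ℝ => ev p (0 + s • x)) 0 t := fun t => by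
    simpa [h] using hasDerivAt_ev_line p 0 x t
  have := is_const_of_deriv_eq_zero (fun t => (hd t).differentiableAt) (fun t => (hd t).deriv) 1 0
  simpa using this

theorem pderiv_comm (i j : Fin d) (p : Poly d) :
    MvPolynomial.pderiv i (MvPolynomial.pderiv j p) =
      MvPolynomial.pderiv j (MvPolynomial.pderiv i p) := by
  by_cases hij : i = j
  · rw [hij]
  ext m
  simp only [MvPolynomial.coeff_pderiv]
  rw [add_right_comm]
  simp [hij, Ne.symm hij]
  ring

theorem pderiv_mem_polyLE {k : ℕ} {p : Poly d} (hp : p ∈ polyLE d k) (i : Fin d) :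
    MvPolynomial.pderiv i p ∈ polyLE d (k - 1) := by
  rw [MvPolynomial.mem_restrictTotalDegree] at hp ⊢
  refine Finset.sup_le fun m hm => ?_
  rw [MvPolynomial.mem_support_iff, MvPolynomial.coeff_pderiv] at hm
  have h1 : m + Finsupp.single i 1 ∈ p.support := by
    rw [MvPolynomial.mem_support_iff]
    exact left_ne_zero_of_mul hm
  have h2 := (MvPolynomial.le_totalDegree h1).trans hp
  have h3 : ((m + Finsupp.single i 1).sum fun _ e => e) = (m.sum fun _ e => e) + 1 := by
    rw [Finsupp.sum_add_index' (by simp) (by simp)]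
    simp
  omega

theorem mul_mem_polyLE {a b c : ℕ} {p q : Poly d} (hp : p ∈ polyLE d a) (hq : q ∈ polyLE d b)
    (h : a + b ≤ c) : p * q ∈ polyLE d c := by
  rw [MvPolynomial.mem_restrictTotalDegree] at *
  exact (MvPolynomial.totalDegree_mul p q).trans (by omega)

theorem C_mem_polyLE (c : ℝ) (r : ℕ) : (MvPolynomial.C c : Poly d) ∈ polyLE d r := by
  simp [MvPolynomial.mem_restrictTotalDegree]

/-- A sum of squares of polynomials vanishes only if all of them vanish. -/
theorem eq_zero_of_sum_sq_eq_zero {ι : Type*} {s : Finset ι} {p : ι → Poly d}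
    (h : ∑ i ∈ s, p i ^ 2 = 0) : ∀ i ∈ s, p i = 0 := by
  intro i hi
  refine eq_of_ev_eq fun x => ?_
  have hx : ∑ i ∈ s, ev (p i) x ^ 2 = 0 := by
    have := congrArg (fun q => ev q x) h
    simpa using this
  have := (Finset.sum_eq_zero_iff_of_nonneg fun i _ => sq_nonneg (ev (p i) x)).1 hx i hi
  simpa using this

/-- A polynomial vector field with vanishing strain is an infinitesimal rigid motion. -/
theorem exists_skew_of_strain_eq_zero {w : Fin d → Poly d}
    (h : ∀ i j, MvPolynomial.pderiv j (w i) + MvPolynomial.pderiv i (w j) = 0) :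
    ∃ (A : Fin d → Fin d → ℝ) (b : Fin d → ℝ), (∀ i j, A i j = -A j i) ∧
      ∀ i x, ev (w i) x = b i + ∑ j, A i j * x j := by
  have hskew : ∀ i j, MvPolynomial.pderiv j (w i) = -MvPolynomial.pderiv i (w j) := fun i j =>
    eq_neg_of_add_eq_zero_left (h i j)
  -- Skewness and commutation of derivatives, used alternately three times each, cycle the indices
  -- back to the start with the opposite sign; so all second derivatives vanish.
  have hsecond : ∀ i j l, MvPolynomial.pderiv l (MvPolynomial.pderiv j (w i)) = 0 := by
    intro i j l
    have e1 : MvPolynomial.pderiv l (MvPolynomial.pderiv j (w i)) =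
        -MvPolynomial.pderiv l (MvPolynomial.pderiv j (w i)) := by
      calc MvPolynomial.pderiv l (MvPolynomial.pderiv j (w i))
          = -MvPolynomial.pderiv l (MvPolynomial.pderiv i (w j)) := by rw [hskew i j, map_neg]
        _ = -MvPolynomial.pderiv i (MvPolynomial.pderiv l (w j)) := by rw [pderiv_comm]
        _ = MvPolynomial.pderiv i (MvPolynomial.pderiv j (w l)) := by
            rw [hskew j l, map_neg, neg_neg]
        _ = MvPolynomial.pderiv j (MvPolynomial.pderiv i (w l)) := by rw [pderiv_comm]
        _ = -MvPolynomial.pderiv j (MvPolynomial.pderiv l (w i)) := by rw [hskew l i, map_neg]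
        _ = -MvPolynomial.pderiv l (MvPolynomial.pderiv j (w i)) := by rw [pderiv_comm]
    exact self_eq_neg.1 e1
  have hA : ∀ i j, MvPolynomial.pderiv j (w i) =
      MvPolynomial.C (ev (MvPolynomial.pderiv j (w i)) 0) := fun i j =>
    eq_C_of_pderiv_eq_zero fun l => hsecond i j l
  refine ⟨fun i j => ev (MvPolynomial.pderiv j (w i)) 0, fun i => ev (w i) 0, fun i j => ?_,
    fun i x => ?_⟩
  · change ev _ 0 = -ev _ 0
    rw [hskew i j, ev_neg]
  · set A := fun i j => ev (MvPolynomial.pderiv j (w i)) 0 with hAdef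
    have := eq_C_of_pderiv_eq_zero (p := w i - ∑ j, MvPolynomial.C (A i j) * MvPolynomial.X j)
      fun l => by
        rw [map_sub, map_sum, hA i l]
        simp only [MvPolynomial.pderiv_C_mul, MvPolynomial.pderiv_X]
        rw [Finset.sum_eq_single l]
        · simp [hAdef]
        · intro j _ hj
          simp [hj]
        · simp
    have := congrArg (fun q => ev q x) this
    simp only [ev_sub, ev_sum, ev_mul, ev_C, ev_X] at this
    simp at this
    linarith

theorem exists_of_mem_facePoly {e : Set (Space d)} {k : ℕ} {f : e → ℝ} (hf : f ∈ facePoly e k) :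
    ∃ p ∈ polyLE d k, ∀ x : e, f x = ev p x := by
  obtain ⟨p, hp, rfl⟩ := hf
  exact ⟨p, hp, fun _ => rfl⟩

end Polynomials

/-! ### The fundamental theorem of calculus on compact subsets of the line with finite frontier -/

section OneDimensional

/-- Off the frontier the indicator coincides locally with `h` or with zero. With finitely many
exceptional points, the fundamental theorem then asks only for continuity there. -/
theorem hasDerivAt_indicator {S : Set ℝ} {h h' : ℝ → ℝ} (hd : ∀ t, HasDerivAt h (h' t) t)
    {t : ℝ} (ht : t ∉ frontier S) : HasDerivAt (S.indicator h) (S.indicator h' t) t := by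
  by_cases hS : t ∈ S
  · have hint : S ∈ 𝓝 t := by
      rw [mem_interior_iff_mem_nhds.symm]
      by_contra hn
      exact ht ⟨subset_closure hS, hn⟩
    rw [Set.indicator_of_mem hS]
    refine (hd t).congr_of_eventuallyEq ?_
    filter_upwards [hint] with s hs
    rw [Set.indicator_of_mem hs]
  · have hcl : t ∉ closure S := fun hc => ht ⟨hc, fun hi => hS (interior_subset hi)⟩
    rw [Set.indicator_of_notMem hS]
    refine (hasDerivAt_const t (0 : ℝ)).congr_of_eventuallyEq ?_
    filter_upwards [isClosed_closure.isOpen_compl.mem_nhds hcl] with s hs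
    rw [Set.indicator_of_notMem fun h => hs (subset_closure h)]

theorem setIntegral_eq_intervalIntegral_indicator {S : Set ℝ} (hS : IsCompact S) {h : ℝ → ℝ}
    {a b : ℝ} (hab : a ≤ b) (hsub : S ⊆ Set.Ioc a b) :
    ∫ t in S, h t = ∫ t in a..b, S.indicator h t := by
  rw [intervalIntegral.integral_of_le hab, setIntegral_indicator hS.measurableSet,
    Set.inter_eq_self_of_subset_right hsub]

theorem intervalIntegrable_indicator {S : Set ℝ} (hS : IsCompact S) {h : ℝ → ℝ}
    (hc : Continuous h) (a b : ℝ) : IntervalIntegrable (S.indicator h) volume a b :=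
  ((hc.continuousOn.integrableOn_compact hS).integrable_indicator hS.measurableSet)
    |>.intervalIntegrable

theorem exists_subset_Ioo {S : Set ℝ} (hS : IsCompact S) (t : ℝ) :
    ∃ a b, a < t ∧ t < b ∧ S ⊆ Set.Ioo a b := by
  obtain ⟨R, hR⟩ := (hS.insert t).isBounded.subset_ball 0
  rw [Real.ball_eq_Ioo] at hR
  have ht := hR (Set.mem_insert t S)
  exact ⟨0 - R, 0 + R, ht.1, ht.2, (Set.subset_insert t S).trans hR⟩

/-- The fundamental theorem of calculus on a finite union of intervals at whose end points the
primitive vanishes. -/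
theorem setIntegral_deriv_eq_zero {S : Set ℝ} (hS : IsCompact S) (hfin : (frontier S).Finite)
    {h h' : ℝ → ℝ} (hd : ∀ t, HasDerivAt h (h' t) t) (hc : Continuous h')
    (h0 : ∀ t ∈ frontier S, h t = 0) : ∫ t in S, h' t = 0 := by
  obtain ⟨a, b, ha, hb, hsub⟩ := exists_subset_Ioo hS 0
  have hab : a ≤ b := (ha.trans hb).le
  rw [setIntegral_eq_intervalIntegral_indicator hS hab (hsub.trans Set.Ioo_subset_Ioc_self),
    integral_eq_of_hasDerivAt_off_countable_of_le (S.indicator h) _ hab hfin.countable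
      (Continuous.indicator h0 (continuous_iff_continuousAt.2 fun t => (hd t).continuousAt)
        |>.continuousOn) (fun t ht => hasDerivAt_indicator hd ht.2)
      (intervalIntegrable_indicator hS hc a b)]
  rw [Set.indicator_of_notMem fun hm => lt_irrefl _ (hsub hm).2,
    Set.indicator_of_notMem fun hm => lt_irrefl _ (hsub hm).1, sub_zero]

/-- The fundamental theorem of calculus on a finite union of intervals, when the primitive vanishes
at all end points except one right end point. -/
theorem setIntegral_deriv_eq {S : Set ℝ} (hS : IsCompact S) (hfin : (frontier S).Finite)
    {h h' : ℝ → ℝ} (hd : ∀ t, HasDerivAt h (h' t) t) (hc : Continuous h') {c : ℝ}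
    (h0 : ∀ t ∈ frontier S, t ≠ c → h t = 0) (hcS : c ∈ S)
    (hright : ∀ᶠ t in 𝓝[>] c, t ∉ S) (hleft : ∀ᶠ t in 𝓝[<] c, t ∈ S) :
    ∫ t in S, h' t = h c := by
  have hcont : Continuous h := continuous_iff_continuousAt.2 fun t => (hd t).continuousAt
  obtain ⟨a, b, ha, hb, hsub⟩ := exists_subset_Ioo hS c
  have hcontAt : ∀ t, t ≠ c → ContinuousAt (S.indicator h) t := by
    intro t htc
    by_cases ht : t ∈ frontier S
    · have h1 : Filter.Tendsto h (𝓝 t) (𝓝 0) := by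
        have := hcont.tendsto t
        rwa [h0 t ht htc] at this
      have h2 : S.indicator h t = 0 := by
        by_cases hm : t ∈ S
        · rw [Set.indicator_of_mem hm, h0 t ht htc]
        · rw [Set.indicator_of_notMem hm]
      rw [ContinuousAt, h2]
      refine squeeze_zero_norm (fun s => ?_) (tendsto_zero_iff_norm_tendsto_zero.1 h1)
      exact norm_indicator_le_norm_self h s
    · exact (hasDerivAt_indicator hd ht).continuousAt
  rw [setIntegral_eq_intervalIntegral_indicator hS (ha.trans hb).le
    (hsub.trans Set.Ioo_subset_Ioc_self),
    ← intervalIntegral.integral_add_adjacent_intervals (b := c)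
      (intervalIntegrable_indicator hS hc a c) (intervalIntegrable_indicator hS hc c b)]
  -- The indicator of `h` may jump at `c`, so the interval is cut there. On the left piece `hleft`
  -- gives one-sided continuity.
  have hL : ∫ t in a..c, S.indicator h' t = h c := by
    rw [integral_eq_of_hasDerivAt_off_countable_of_le (S.indicator h) _ ha.le hfin.countable ?_
      (fun t ht => hasDerivAt_indicator hd ht.2) (intervalIntegrable_indicator hS hc a c)]
    · rw [Set.indicator_of_mem hcS, Set.indicator_of_notMem fun hm => lt_irrefl _ (hsub hm).1,
        sub_zero]
    · intro t ht
      rcases eq_or_ne t c with rfl | htc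
      · have : ContinuousWithinAt (S.indicator h) (Set.Iio t) t := by
          refine (hcont.continuousWithinAt).congr_of_eventuallyEq ?_
            (Set.indicator_of_mem hcS h)
          filter_upwards [hleft] with s hs using Set.indicator_of_mem hs h
        refine (continuousWithinAt_Iio_iff_Iic.1 this).mono fun s hs => hs.2
      · exact (hcontAt t htc).continuousWithinAt
  -- By `hright` the right limit at `c` is `0`; changing the primitive at this single point makes it
  -- continuous on the right piece.
  have hR : ∫ t in c..b, S.indicator h' t = 0 := by
    rw [integral_eq_of_hasDerivAt_off_countable_of_le
      (Function.update (S.indicator h) c 0) _ hb.le hfin.countable ?_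
      (fun t ht => ?_) (intervalIntegrable_indicator hS hc c b)]
    · rw [Function.update_self, Function.update_of_ne hb.ne',
        Set.indicator_of_notMem fun hm => lt_irrefl _ (hsub hm).2, sub_zero]
    · intro t ht
      rcases eq_or_ne t c with rfl | htc
      · have : ContinuousWithinAt (Function.update (S.indicator h) t 0) (Set.Ioi t) t := by
          refine (continuousWithinAt_const (b := (0 : ℝ))).congr_of_eventuallyEq ?_
            (Function.update_self ..)
          filter_upwards [hright, self_mem_nhdsWithin] with s hs hst
          rw [Function.update_of_ne (ne_of_gt hst), Set.indicator_of_notMem hs]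
        refine (continuousWithinAt_Ioi_iff_Ici.1 this).mono fun s hs => hs.1
      · refine ((hcontAt t htc).congr ?_).continuousWithinAt
        filter_upwards [isOpen_ne.mem_nhds htc] with s hs
        rw [Function.update_of_ne hs]
    · refine (hasDerivAt_indicator hd ht.2).congr_of_eventuallyEq ?_
      filter_upwards [isOpen_ne.mem_nhds ht.1.1.ne'] with s hs
      rw [Function.update_of_ne hs]
  rw [hL, hR, add_zero]

end OneDimensional

/-! ### Fubini along lines in a given direction -/

section Slicing

variable {d : ℕ}

/-- In a Euclidean space hyperplanes are null sets. -/
theorem volume_hyperplane {V : Type*} [NormedAddCommGroup V] [InnerProductSpace ℝ V]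
    [FiniteDimensional ℝ V] [MeasurableSpace V] [BorelSpace V] {m : V} (hm : m ≠ 0) (c : ℝ) :
    volume {x : V | inner ℝ m x = c} = 0 := by
  have key : ∀ A : AffineSubspace ℝ V, A ≠ ⊤ → volume (A : Set V) = 0 := fun A hA =>
    Measure.addHaar_affineSubspace volume A hA
  let A : AffineSubspace ℝ V := (AffineSubspace.mk' (c : ℝ) (⊥ : Submodule ℝ ℝ)).comap
    (innerₛₗ ℝ m).toAffineMap
  have hA : (A : Set V) = {x : V | inner ℝ m x = c} := by
    ext x
    simp [A, sub_eq_zero]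
  rw [← hA]
  refine key A fun htop => ?_
  have h1 : ∀ x, inner ℝ m x = c := fun x => by
    have : x ∈ (A : Set V) := by rw [htop]; trivial
    rwa [hA] at this
  have h2 := h1 0
  have h3 := h1 m
  rw [inner_zero_right] at h2
  rw [← h2, inner_self_eq_zero] at h3
  exact hm h3

/-- The hyperplane through the origin orthogonal to `n`. -/
noncomputable abbrev Perp (n : Space d) : Submodule ℝ (Space d) := (ℝ ∙ n)ᗮ

theorem finrank_perp {n : Space d} (hn : ‖n‖ = 1) : Module.finrank ℝ (Perp n) + 1 = d := by
  have h := (ℝ ∙ n).finrank_add_finrank_orthogonal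
  rw [finrank_span_singleton (by rintro rfl; simp at hn), finrank_euclideanSpace_fin] at h
  rw [add_comm]
  exact h

theorem inner_perp (n : Space d) (y : Perp n) : inner ℝ n (y : Space d) = 0 :=
  Submodule.mem_orthogonal_singleton_iff_inner_right.1 y.2

theorem inner_perp_add_smul {n : Space d} (hn : ‖n‖ = 1) (y : Perp n) (t : ℝ) :
    inner ℝ n ((y : Space d) + t • n) = t := by
  rw [inner_add_right, inner_perp, inner_smul_right, real_inner_self_eq_norm_sq, hn]
  simp

/-- Coordinates in the direction of `n` and orthogonal to it. -/
theorem measurePreserving_add_smul {n : Space d} (hn : ‖n‖ = 1) :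
    MeasurePreserving (fun z : Perp n × ℝ => (z.1 : Space d) + z.2 • n)
      (volume.prod volume) volume := by
  have hn0 : n ≠ 0 := by rintro rfl; simp at hn
  have h1 := ((ℝ ∙ n).measurePreserving_measurableEquivProd (0 : Space d)).symm
  rw [InnerProductSpace.euclideanHausdorffMeasure_eq_volume] at h1
  let L : ℝ ≃ₗᵢ[ℝ] (ℝ ∙ n) := LinearIsometryEquiv.toSpanUnitSingleton n hn
  have h2 : MeasurePreserving (fun z : Perp n × ℝ => (L z.2, z.1)) (volume.prod volume)
      (volume.prod volume) := by
    have := (L.measurePreserving.prod (MeasurePreserving.id (volume : Measure (Perp n)))).comp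
      (Measure.measurePreserving_swap (μ := (volume : Measure (Perp n))) (ν := (volume : Measure ℝ)))
    exact this
  have h3 := h1.comp h2
  convert! h3 using 1
  funext z
  simp [L, add_comm]

theorem measurableEmbedding_add_smul {n : Space d} (hn : ‖n‖ = 1) :
    MeasurableEmbedding (fun z : Perp n × ℝ => (z.1 : Space d) + z.2 • n) := by
  refine Continuous.measurableEmbedding (by fun_prop) ?_
  rintro ⟨y, t⟩ ⟨y', t'⟩ h
  have ht : t = t' := by
    have := congrArg (fun x => inner ℝ n x) h
    simpa only [inner_perp_add_smul hn] using this
  subst ht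
  simpa using h

/-- Integration over a compact set along lines in the direction of `n`. -/
theorem setIntegral_eq_slices {n : Space d} (hn : ‖n‖ = 1) {T : Set (Space d)} (hT : IsCompact T)
    {F : Space d → ℝ} (hF : Continuous F) :
    ∫ x in T, F x =
      ∫ y : Perp n, ∫ t in {t : ℝ | (y : Space d) + t • n ∈ T}, F ((y : Space d) + t • n) := by
  have hm : Measurable fun z : Perp n × ℝ => (z.1 : Space d) + z.2 • n := by fun_prop
  rw [← integral_indicator hT.measurableSet,
    ← (measurePreserving_add_smul hn).integral_comp (measurableEmbedding_add_smul hn),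
    integral_prod]
  · refine integral_congr_ae (Filter.Eventually.of_forall fun y => ?_)
    change _ = ∫ t in {t : ℝ | (y : Space d) + t • n ∈ T}, F ((y : Space d) + t • n)
    rw [← integral_indicator]
    · rfl
    · exact hT.measurableSet.preimage (f := fun t : ℝ => (y : Space d) + t • n) (by fun_prop)
  · exact ((measurePreserving_add_smul hn).integrable_comp_emb (measurableEmbedding_add_smul hn)).2
      ((hF.continuousOn.integrableOn_compact hT).integrable_indicator hT.measurableSet)

theorem isCompact_slice {n : Space d} (hn : ‖n‖ = 1) {T : Set (Space d)} (hT : IsCompact T)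
    (y : Space d) : IsCompact {t : ℝ | y + t • n ∈ T} := by
  refine Metric.isCompact_of_isClosed_isBounded
    (hT.isClosed.preimage (f := fun t : ℝ => y + t • n) (by fun_prop)) ?_
  obtain ⟨R, hR⟩ := hT.isBounded.subset_ball y
  refine (Metric.isBounded_ball (x := (0 : ℝ)) (r := R)).subset fun t ht => ?_
  have := hR ht
  simpa [norm_smul, hn] using this

theorem frontier_slice_subset (n : Space d) (T : Set (Space d)) (y : Space d) :
    frontier {t : ℝ | y + t • n ∈ T} ⊆ {t | y + t • n ∈ frontier T} :=
  Continuous.frontier_preimage_subset (f := fun t : ℝ => y + t • n) (by fun_prop) T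

end Slicing

/-! ### Boundaries of polytopes and finitely many hyperplanes -/

section Polytopes

variable {V : Type*} [NormedAddCommGroup V] [InnerProductSpace ℝ V]

/-- A convex set has a supporting hyperplane at each of its points that is not interior. -/
theorem exists_supporting_hyperplane [FiniteDimensional ℝ V] {C : Set V} (hC : Convex ℝ C) {x : V} (hx : x ∈ C)
    (hxi : x ∉ interior C) : ∃ m : V, m ≠ 0 ∧ ∀ y ∈ C, inner ℝ m y ≤ inner ℝ m x := by
  by_cases hne : (interior C).Nonempty
  · obtain ⟨f, hf⟩ := geometric_hahn_banach_open_point hC.interior isOpen_interior hxi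
    have hin : ∀ y, inner ℝ ((InnerProductSpace.toDual ℝ V).symm f) y = f y := fun y => by simp
    refine ⟨(InnerProductSpace.toDual ℝ V).symm f, ?_, fun y hy => ?_⟩
    · intro h0
      obtain ⟨a, ha⟩ := hne
      have := hf a ha
      rw [← hin, ← hin, h0] at this
      simp at this
    · rw [hin, hin]
      have hcl : closure (interior C) ⊆ {z | f z ≤ f x} :=
        closure_minimal (fun a ha => (hf a ha).le) (isClosed_le f.continuous continuous_const)
      rw [hC.closure_interior_eq_closure_of_nonempty_interior hne] at hcl
      exact hcl (subset_closure hy)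
  -- A convex set without interior spans a proper affine subspace, and a functional normal to that
  -- subspace is constant on the set.
  · have htop : affineSpan ℝ C ≠ ⊤ := fun h =>
      hne (hC.interior_nonempty_iff_affineSpan_eq_top.2 h)
    have hdir : (vectorSpan ℝ C)ᗮ ≠ ⊥ := by
      rw [Ne, Submodule.orthogonal_eq_bot_iff]
      intro h
      refine htop ((AffineSubspace.direction_eq_top_iff_of_nonempty ?_).1 ?_)
      · exact ⟨x, subset_affineSpan ℝ C hx⟩
      · rw [direction_affineSpan, h]
    obtain ⟨m, hm, hm0⟩ := (Submodule.ne_bot_iff _).1 hdir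
    refine ⟨m, hm0, fun y hy => ?_⟩
    have := (Submodule.mem_orthogonal' _ _).1 hm _ (vsub_mem_vectorSpan ℝ hy hx)
    rw [vsub_eq_sub, inner_sub_right] at this
    linarith

/-- In a convex combination at which the functional of `m` reaches its maximum, only maximizing
vertices carry weight. A functional constant on these vertices takes the same value at `x`. -/
theorem inner_eq_of_mem_convexHull {s : Finset V} {x m : V} {a : ℝ} {m' : V}
    (hx : x ∈ convexHull ℝ (s : Set V)) (hle : ∀ y ∈ s, inner ℝ m y ≤ inner ℝ m x)
    (ha : ∀ y ∈ s, inner ℝ m y = inner ℝ m x → inner ℝ m' y = a) : inner ℝ m' x = a := by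
  obtain ⟨w, hw0, hw1, rfl⟩ := Finset.mem_convexHull'.1 hx
  set x := ∑ y ∈ s, w y • y
  have h1 : ∑ y ∈ s, w y * (inner ℝ m x - inner ℝ m y) = 0 := by
    have : inner ℝ m x = ∑ y ∈ s, w y * inner ℝ m y := by
      simp [x, inner_sum, inner_smul_right]
    simp only [mul_sub, Finset.sum_sub_distrib, ← Finset.sum_mul, hw1, one_mul, ← this, sub_self]
  have h2 := (Finset.sum_eq_zero_iff_of_nonneg fun y hy =>
    mul_nonneg (hw0 y hy) (sub_nonneg.2 (hle y hy))).1 h1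
  have h3 : inner ℝ m' x = ∑ y ∈ s, w y * inner ℝ m' y := by
    simp [x, inner_sum, inner_smul_right]
  rw [h3, ← one_mul a, ← hw1, Finset.sum_mul]
  refine Finset.sum_congr rfl fun y hy => ?_
  rcases mul_eq_zero.1 (h2 y hy) with h | h
  · rw [h, zero_mul, zero_mul]
  · rw [ha y hy (sub_eq_zero.1 h).symm]

open Classical in
/-- The topological boundary of a finite union of convex polytopes is covered by finitely many
hyperplanes. -/
theorem exists_hyperplanes_cover_boundary [FiniteDimensional ℝ V] (C : Finset (Finset V)) :
    ∃ H : Finset (V × ℝ), (∀ p ∈ H, p.1 ≠ 0) ∧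
      ∀ x ∈ ⋃ s ∈ C, convexHull ℝ (s : Set V),
        x ∉ interior (⋃ s ∈ C, convexHull ℝ (s : Set V)) → ∃ p ∈ H, inner ℝ p.1 x = p.2 := by
  -- Finiteness comes from fixing one hyperplane for each subset `t` of a vertex set. A boundary
  -- point lies in the hull of the vertices on its supporting hyperplane, hence also in the
  -- hyperplane fixed for that subset.
  let P : Finset V → V × ℝ → Prop := fun t p => p.1 ≠ 0 ∧ ∀ y ∈ t, inner ℝ p.1 y = p.2
  let g : Finset V → V × ℝ := fun t => Classical.epsilon (P t)
  refine ⟨((C.biUnion Finset.powerset).image g).filter fun p => p.1 ≠ 0,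
    fun p hp => (Finset.mem_filter.1 hp).2, fun x hx hxi => ?_⟩
  obtain ⟨s, hs, hxs⟩ := Set.mem_iUnion₂.1 hx
  have hxi' : x ∉ interior (convexHull ℝ (s : Set V)) := fun h =>
    hxi (interior_mono (Set.subset_iUnion₂ (s := fun s (_ : s ∈ C) => convexHull ℝ (s : Set V))
      s hs) h)
  obtain ⟨m, hm0, hm⟩ := exists_supporting_hyperplane (convex_convexHull ℝ _) hxs hxi'
  let t := s.filter fun y => inner ℝ m y = inner ℝ m x
  have hPt : P t (g t) := Classical.epsilon_spec (p := P t)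
    ⟨(m, inner ℝ m x), hm0, fun y hy => (Finset.mem_filter.1 hy).2⟩
  refine ⟨g t, ?_, ?_⟩
  · refine Finset.mem_filter.2 ⟨Finset.mem_image_of_mem _ (Finset.mem_biUnion.2 ⟨s, hs, ?_⟩),
      hPt.1⟩
    exact Finset.mem_powerset.2 (Finset.filter_subset _ _)
  · exact inner_eq_of_mem_convexHull hxs (fun y hy => hm y (subset_convexHull ℝ _ hy))
      fun y hy hyx => hPt.2 y (Finset.mem_filter.2 ⟨hy, hyx⟩)

theorem IsPolytopal.isCompact {d : ℕ} {S : Set (Space d)} (hS : IsPolytopal S) : IsCompact S := by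
  obtain ⟨C, rfl⟩ := hS
  exact C.finite_toSet.isCompact_biUnion fun s _ => s.finite_toSet.isCompact_convexHull ℝ

end Polytopes

/-! ### Faces in their hyperplanes: charts, relative interiors and surface measure -/

section Faces

variable {d : ℕ} {e : Set (Space d)} {n : Space d} {c : ℝ}

/-- The face `e` lies in the hyperplane `{x | ⟪n, x⟫ = c}` with unit normal `n`. -/
structure IsFaceIn (e : Set (Space d)) (n : Space d) (c : ℝ) : Prop where
  isFace : IsFace e
  norm_eq : ‖n‖ = 1
  inner_eq : ∀ x ∈ e, inner ℝ n x = c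

theorem IsFace.intrinsicInterior_nonempty (he : IsFace e) : (intrinsicInterior ℝ e).Nonempty :=
  he.connected.nonempty

theorem IsFace.nonempty (he : IsFace e) : e.Nonempty :=
  he.intrinsicInterior_nonempty.mono intrinsicInterior_subset

theorem IsFace.isFaceIn (he : IsFace e) (hn : ‖n‖ = 1)
    (hperp : ∀ x ∈ e, ∀ y ∈ e, inner ℝ n (x - y) = 0) : ∃ c, IsFaceIn e n c := by
  obtain ⟨x₀, hx₀⟩ := he.nonempty
  refine ⟨inner ℝ n x₀, he, hn, fun x hx => ?_⟩
  have := hperp x hx x₀ hx₀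
  rwa [inner_sub_right, sub_eq_zero] at this

theorem IsFace.exists_isFaceIn (he : IsFace e) : ∃ n c, IsFaceIn e n c := by
  have h1 := (vectorSpan ℝ e).finrank_add_finrank_orthogonal
  rw [finrank_euclideanSpace_fin] at h1
  have h2 := he.finrank_add_one
  have h3 : (vectorSpan ℝ e)ᗮ ≠ ⊥ := by
    intro h
    rw [h, finrank_bot] at h1
    omega
  obtain ⟨m, hm, hm0⟩ := (Submodule.ne_bot_iff _).1 h3
  refine ⟨‖m‖⁻¹ • m, he.isFaceIn (norm_smul_inv_norm (𝕜 := ℝ) hm0) fun x hx y hy => ?_⟩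
  have h0 : inner ℝ m (x - y) = 0 :=
    (Submodule.mem_orthogonal' _ _).1 hm _ (vsub_mem_vectorSpan ℝ hx hy)
  rw [inner_smul_left, h0, mul_zero]

theorem isometry_chart (n : Space d) (c : ℝ) :
    Isometry fun y : Perp n => (y : Space d) + c • n :=
  Isometry.of_dist_eq fun y z => by simp [Subtype.dist_eq]

theorem measurableEmbedding_chart (n : Space d) (c : ℝ) :
    MeasurableEmbedding fun y : Perp n => (y : Space d) + c • n :=
  (isometry_chart n c).isClosedEmbedding.measurableEmbedding

namespace IsFaceIn

theorem neg (h : IsFaceIn e n c) : IsFaceIn e (-n) (-c) :=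
  ⟨h.isFace, by rw [norm_neg, h.norm_eq], fun x hx => by rw [inner_neg_left, h.inner_eq x hx]⟩

theorem vectorSpan_eq (h : IsFaceIn e n c) : vectorSpan ℝ e = Perp n := by
  refine Submodule.eq_of_le_of_finrank_eq ?_ ?_
  · rw [vectorSpan, Submodule.span_le]
    rintro _ ⟨x, hx, y, hy, rfl⟩
    change x - y ∈ Perp n
    rw [Submodule.mem_orthogonal_singleton_iff_inner_right, inner_sub_right, h.inner_eq x hx,
      h.inner_eq y hy, sub_self]
  · have h1 := h.isFace.finrank_add_one
    have h2 := finrank_perp h.norm_eq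
    omega

theorem mem_affineSpan_iff (h : IsFaceIn e n c) {x : Space d} : x ∈ affineSpan ℝ e ↔ inner ℝ n x = c := by
  obtain ⟨x₀, hx₀⟩ := h.isFace.nonempty
  rw [← AffineSubspace.vsub_right_mem_direction_iff_mem (subset_affineSpan ℝ e hx₀),
    direction_affineSpan, h.vectorSpan_eq, Submodule.mem_orthogonal_singleton_iff_inner_right,
    vsub_eq_sub, inner_sub_right, h.inner_eq x₀ hx₀, sub_eq_zero]

/-- By the dimension condition the affine span of a face is the whole hyperplane, so the relative
interior is the interior within it. -/
theorem mem_intrinsicInterior_iff (h : IsFaceIn e n c) {x : Space d} : x ∈ intrinsicInterior ℝ e ↔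
    inner ℝ n x = c ∧ ∃ ε > 0, ∀ z, inner ℝ n z = c → dist z x < ε → z ∈ e := by
  rw [mem_intrinsicInterior]
  constructor
  · rintro ⟨y, hy, rfl⟩
    obtain ⟨ε, hε, hb⟩ := Metric.mem_nhds_iff.1 (mem_interior_iff_mem_nhds.1 hy)
    refine ⟨h.mem_affineSpan_iff.1 y.2, ε, hε, fun z hz hd => ?_⟩
    have hz' : (⟨z, h.mem_affineSpan_iff.2 hz⟩ : affineSpan ℝ e) ∈ Metric.ball y ε := hd
    exact hb hz'
  · rintro ⟨hx, ε, hε, hb⟩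
    refine ⟨⟨x, h.mem_affineSpan_iff.2 hx⟩, ?_, rfl⟩
    rw [mem_interior_iff_mem_nhds, Metric.mem_nhds_iff]
    exact ⟨ε, hε, fun z hz => hb z (h.mem_affineSpan_iff.1 z.2) hz⟩

theorem inner_chart (h : IsFaceIn e n c) (y : Perp n) : inner ℝ n ((y : Space d) + c • n) = c :=
  inner_perp_add_smul h.norm_eq y c

theorem chart_mem_intrinsicInterior_iff (h : IsFaceIn e n c) {y : Perp n} :
    (y : Space d) + c • n ∈ intrinsicInterior ℝ e ↔
      y ∈ interior {y : Perp n | (y : Space d) + c • n ∈ e} := by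
  rw [h.mem_intrinsicInterior_iff, mem_interior_iff_mem_nhds, Metric.mem_nhds_iff]
  constructor
  · rintro ⟨-, ε, hε, hb⟩
    exact ⟨ε, hε, fun z hz => hb _ (h.inner_chart z) (by simpa [Subtype.dist_eq] using hz)⟩
  · rintro ⟨ε, hε, hb⟩
    refine ⟨h.inner_chart y, ε, hε, fun z hz hd => ?_⟩
    have hmem : z - c • n ∈ Perp n := by
      rw [Submodule.mem_orthogonal_singleton_iff_inner_right, inner_sub_right, hz,
        inner_smul_right, real_inner_self_eq_norm_sq, h.norm_eq]
      simp
    have : (⟨z - c • n, hmem⟩ : Perp n) ∈ Metric.ball y ε := by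
      rw [Metric.mem_ball, Subtype.dist_eq, ← dist_add_right _ _ (c • n)]
      simpa using hd
    simpa using hb this

theorem exists_chart_eq (h : IsFaceIn e n c) {x : Space d} (hx : inner ℝ n x = c) :
    ∃ y : Perp n, (y : Space d) + c • n = x := by
  refine ⟨⟨x - c • n, ?_⟩, by simp⟩
  rw [Submodule.mem_orthogonal_singleton_iff_inner_right, inner_sub_right, hx,
    inner_smul_right, real_inner_self_eq_norm_sq, h.norm_eq]
  simp

open Classical in
/-- The relative boundary of a face is covered by finitely many affine subspaces of
codimension two. -/
theorem exists_cover_relative_boundary (h : IsFaceIn e n c) : ∃ H : Finset (Space d × ℝ),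
    (∀ p ∈ H, p.1 ≠ 0 ∧ inner ℝ n p.1 = 0) ∧
      ∀ x ∈ e, x ∉ intrinsicInterior ℝ e → ∃ p ∈ H, inner ℝ p.1 x = p.2 := by
  obtain ⟨C, hC⟩ := h.isFace.polytopal
  -- The projection inverts the chart on the hyperplane of `e`, so in the chart `e` is again a union
  -- of polytopes and its relative boundary becomes a topological one. A hyperplane of `Perp n` has
  -- codimension two in the full space.
  let P : Space d →ₗ[ℝ] Perp n := (Perp n).orthogonalProjectionOnto.toLinearMap
  have hPn : P n = 0 := by
    refine Submodule.orthogonalProjectionOnto_eq_zero_iff.2 ?_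
    rw [Submodule.orthogonal_orthogonal]
    exact Submodule.mem_span_singleton_self n
  have hP : ∀ y : Perp n, P ((y : Space d) + c • n) = y := fun y => by
    rw [map_add, map_smul, hPn, smul_zero, add_zero]
    exact Submodule.orthogonalProjectionOnto_mem_subspace_eq_self y
  have hchart : {y : Perp n | (y : Space d) + c • n ∈ e} =
      ⋃ s ∈ C.image (fun s => s.image P), convexHull ℝ (s : Set (Perp n)) := by
    have h1 : {y : Perp n | (y : Space d) + c • n ∈ e} = P '' e := by
      ext y
      constructor
      · exact fun hy => ⟨_, hy, hP y⟩
      · rintro ⟨x, hx, rfl⟩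
        obtain ⟨y, rfl⟩ := h.exists_chart_eq (h.inner_eq x hx)
        rwa [Set.mem_ofPred_eq, hP]
    rw [h1, hC, Set.image_iUnion₂, Finset.set_biUnion_finset_image]
    simp only [P.image_convexHull, Finset.coe_image]
  obtain ⟨H, hH, hcov⟩ := exists_hyperplanes_cover_boundary (C.image fun s => s.image P)
  refine ⟨H.image fun p => ((p.1 : Space d), p.2), ?_, fun x hx hxi => ?_⟩
  · intro p hp
    obtain ⟨p, hp', rfl⟩ := Finset.mem_image.1 hp
    exact ⟨fun h0 => hH p hp' (by simpa using h0), inner_perp n p.1⟩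
  · obtain ⟨y, rfl⟩ := h.exists_chart_eq (h.inner_eq x hx)
    rw [h.chart_mem_intrinsicInterior_iff, hchart] at hxi
    obtain ⟨p, hp, hpy⟩ := hcov y (by rw [← hchart]; exact hx) hxi
    refine ⟨_, Finset.mem_image_of_mem _ hp, ?_⟩
    rw [inner_add_right, inner_smul_right, real_inner_comm n, inner_perp n p.1, mul_zero, add_zero]
    exact hpy

theorem euclideanHausdorffMeasure_perp (h : IsFaceIn e n c) :
    (μHE[d - 1] : Measure (Perp n)) = volume := by
  have h1 := finrank_perp h.norm_eq
  have h2 : d - 1 = Module.finrank ℝ (Perp n) := by omega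
  rw [h2, InnerProductSpace.euclideanHausdorffMeasure_eq_volume]

theorem subset_range_chart (h : IsFaceIn e n c) : e ⊆ Set.range fun y : Perp n => (y : Space d) + c • n :=
  fun x hx => h.exists_chart_eq (h.inner_eq x hx)

/-- The surface measure of a subset of a face, computed in the chart. -/
theorem measure_eq_volume_chart (h : IsFaceIn e n c) {Z : Set (Space d)} (hZ : Z ⊆ e) :
    (μHE[d - 1] : Measure (Space d)) Z = volume {y : Perp n | (y : Space d) + c • n ∈ Z} := by
  have := (isometry_chart n c).euclideanHausdorffMeasure_preimage (d := d - 1) Z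
  rw [h.euclideanHausdorffMeasure_perp,
    Set.inter_eq_self_of_subset_left (hZ.trans h.subset_range_chart)] at this
  exact this.symm

theorem isCompact (h : IsFaceIn e n c) : IsCompact e := h.isFace.polytopal.isCompact

theorem isCompact_chart (h : IsFaceIn e n c) : IsCompact {y : Perp n | (y : Space d) + c • n ∈ e} :=
  (isometry_chart n c).isClosedEmbedding.isCompact_preimage h.isCompact

/-- The surface measure on a face, computed in the chart. -/
theorem restrict_eq_map_chart (h : IsFaceIn e n c) : (μHE[d - 1] : Measure (Space d)).restrict e =
    (volume.restrict {y : Perp n | (y : Space d) + c • n ∈ e}).map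
      fun y : Perp n => (y : Space d) + c • n := by
  have h1 := (isometry_chart n c).map_euclideanHausdorffMeasure (d := d - 1)
  rw [h.euclideanHausdorffMeasure_perp] at h1
  have h2 := Measure.restrict_map (measurableEmbedding_chart n c).measurable h.isCompact.measurableSet
    (μ := volume)
  rw [h1, Measure.restrict_restrict h.isCompact.measurableSet,
    Set.inter_eq_self_of_subset_left h.subset_range_chart] at h2
  exact h2

theorem setIntegral_eq_chart (h : IsFaceIn e n c) (F : Space d → ℝ) :
    ∫ x in e, F x ∂(μHE[d - 1] : Measure (Space d)) =
      ∫ y in {y : Perp n | (y : Space d) + c • n ∈ e}, F ((y : Space d) + c • n) := by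
  rw [h.restrict_eq_map_chart, (measurableEmbedding_chart n c).integral_map]

theorem faceIntegral_eq (h : IsFaceIn e n c) (F : Space d → ℝ) : faceIntegral e (fun x => F x) =
    ∫ x in e, F x ∂(μHE[d - 1] : Measure (Space d)) :=
  integral_subtype_comap h.isCompact.measurableSet F

theorem integrableOn (h : IsFaceIn e n c) {F : Space d → ℝ} (hF : Continuous F) :
    IntegrableOn F e (μHE[d - 1] : Measure (Space d)) := by
  rw [IntegrableOn, h.restrict_eq_map_chart, (measurableEmbedding_chart n c).integrable_map_iff]
  have : Continuous fun y : Perp n => F ((y : Space d) + c • n) := by fun_prop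
  exact this.continuousOn.integrableOn_compact h.isCompact_chart

theorem measure_pos (h : IsFaceIn e n c) : 0 < (μHE[d - 1] : Measure (Space d)) e := by
  rw [h.measure_eq_volume_chart subset_rfl]
  obtain ⟨x, hx⟩ := h.isFace.intrinsicInterior_nonempty
  obtain ⟨y, rfl⟩ := h.exists_chart_eq (h.inner_eq x (intrinsicInterior_subset hx))
  exact Measure.measure_pos_of_nonempty_interior _ ⟨y, h.chart_mem_intrinsicInterior_iff.1 hx⟩

/-- A hyperplane that is not parallel to a face meets it in a null set. -/
theorem measure_inter_hyperplane (h : IsFaceIn e n c) {m : Space d} (hm : ∀ a : ℝ, m ≠ a • n)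
    (b : ℝ) : (μHE[d - 1] : Measure (Space d)) {x | x ∈ e ∧ inner ℝ m x = b} = 0 := by
  rw [h.measure_eq_volume_chart fun x hx => hx.1]
  -- The component of `m` tangential to the face, nonzero because `m` is not a multiple of `n`: in
  -- the chart the intersection lies in a hyperplane.
  let m' : Perp n := ⟨m - inner ℝ n m • n, by
    rw [Submodule.mem_orthogonal_singleton_iff_inner_right, inner_sub_right,
      inner_smul_right, real_inner_self_eq_norm_sq, h.norm_eq]
    simp⟩
  have hm' : m' ≠ 0 := fun h0 => hm (inner ℝ n m) (sub_eq_zero.1 (congrArg Subtype.val h0))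
  refine measure_mono_null (fun y hy => ?_) (volume_hyperplane hm' (b - c * inner ℝ m n))
  have h1 : inner ℝ m ((y : Space d) + c • n) = b := hy.2
  have h2 : inner ℝ m' y = inner ℝ m (y : Space d) := by
    change inner ℝ (m - inner ℝ n m • n) (y : Space d) = _
    rw [inner_sub_left, inner_smul_left, inner_perp, mul_zero, sub_zero]
  rw [inner_add_right, inner_smul_right] at h1
  change inner ℝ m' y = _
  rw [h2]
  linarith

end IsFaceIn

end Faces

/-! ### Geometry of the mesh: outward normals and chains of elements -/

namespace PolytopalMesh

variable {d : ℕ} {Ω : Set (Space d)} {M : PolytopalMesh d Ω} {T : M.elems} {e : M.faces}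
  {n : Space d} {c : ℝ} {x : Space d}

theorem mem_facesOf : e ∈ M.facesOf T ↔ (e : Set (Space d)) ⊆ frontier (T : Set (Space d)) := by
  simp [facesOf]

theorem isCompact_elem (T : M.elems) : IsCompact (T : Set (Space d)) :=
  (M.isElement T T.2).polytopal.isCompact

theorem isClosed_elem (T : M.elems) : IsClosed (T : Set (Space d)) := (isCompact_elem T).isClosed

theorem interior_elem_nonempty (T : M.elems) : (interior (T : Set (Space d))).Nonempty :=
  (M.isElement T T.2).connected.nonempty

theorem isClosed_face (e : M.faces) : IsClosed (e : Set (Space d)) :=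
  (M.isFace e e.2).polytopal.isCompact.isClosed

theorem exists_face_of_mem_frontier (hx : x ∈ frontier (T : Set (Space d))) :
    ∃ e ∈ M.facesOf T, x ∈ (e : Set (Space d)) := by
  rw [M.frontier_elem T T.2] at hx
  simp only [Set.mem_iUnion] at hx
  obtain ⟨e, he, hsub, hxe⟩ := hx
  exact ⟨⟨e, he⟩, mem_facesOf.2 hsub, hxe⟩

theorem face_subset_elem (he : e ∈ M.facesOf T) :
    (e : Set (Space d)) ⊆ (T : Set (Space d)) :=
  (mem_facesOf.1 he).trans (isClosed_elem T).frontier_subset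

theorem notMem_of_mem_intrinsicInterior (hx : x ∈ intrinsicInterior ℝ (e : Set (Space d)))
    {e' : M.faces} (hne : e' ≠ e) : x ∉ (e' : Set (Space d)) := fun hx' =>
  Set.disjoint_left.1 (M.disjoint_faces e e.2 e' e'.2 fun h => hne (Subtype.ext h.symm)) hx hx'

/-- Since `T` is the closure of its interior, such a point would make the two interiors meet. -/
theorem notMem_interior_of_ne {T' : M.elems} (hne : T ≠ T') (hx : x ∈ (T : Set (Space d))) :
    x ∉ interior (T' : Set (Space d)) := fun hx' => by
  rw [← (M.isElement T T.2).closure_interior] at hx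
  obtain ⟨z, hz, hz'⟩ := mem_closure_iff.1 hx _ isOpen_interior hx'
  exact Set.disjoint_left.1
    (M.disjoint_interiors T T.2 T' T'.2 fun h => hne (Subtype.ext h)) hz' hz

/-- Near a relative interior point of a face, the boundary of an element is a hyperplane. -/
theorem exists_ball_frontier_eq_hyperplane (he : e ∈ M.facesOf T) (h : IsFaceIn e n c)
    (hx : x ∈ intrinsicInterior ℝ (e : Set (Space d))) :
    ∃ ε > 0, ∀ z ∈ Metric.ball x ε,
      (z ∈ frontier (T : Set (Space d)) ↔ inner ℝ n z = c) := by
  have hopen : IsOpen (⋂ e' ∈ {e' : M.faces | e' ≠ e}, (e' : Set (Space d))ᶜ) :=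
    (Set.toFinite _).isOpen_biInter fun e' _ => (isClosed_face e').isOpen_compl
  obtain ⟨ε₁, hε₁, hb₁⟩ := Metric.isOpen_iff.1 hopen x (Set.mem_iInter₂.2 fun e' hne =>
    notMem_of_mem_intrinsicInterior hx hne)
  obtain ⟨-, ε₂, hε₂, hb₂⟩ := h.mem_intrinsicInterior_iff.1 hx
  refine ⟨min ε₁ ε₂, lt_min hε₁ hε₂, fun z hz => ⟨fun hzT => ?_, fun hzn => ?_⟩⟩
  · obtain ⟨e', -, hze'⟩ := exists_face_of_mem_frontier hzT
    by_cases hee : e' = e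
    · subst hee
      exact h.inner_eq z hze'
    · have := Set.mem_iInter₂.1 (hb₁ (Metric.ball_subset_ball (min_le_left _ _) hz)) e' hee
      exact absurd hze' this
  · exact mem_facesOf.1 he (hb₂ z hzn (lt_of_lt_of_le hz (min_le_right _ _)))

/-- Near `x`, the side of the hyperplane `⟪n, ·⟫ = c` into which `n` points lies outside `T`, and
the other side inside. -/
def IsOutwardAt (T : Set (Space d)) (n : Space d) (c : ℝ) (x : Space d) : Prop :=
  ∃ ε > 0, ∀ z ∈ Metric.ball x ε, (c < inner ℝ n z → z ∉ T) ∧ (inner ℝ n z < c → z ∈ T)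

theorem isOpen_isOutwardAt (T : Set (Space d)) (n : Space d) (c : ℝ) :
    IsOpen {x | IsOutwardAt T n c x} := by
  rw [Metric.isOpen_iff]
  rintro x ⟨ε, hε, hb⟩
  refine ⟨ε, hε, fun y hy => ?_⟩
  obtain ⟨δ, hδ, hsub⟩ := Metric.isOpen_iff.1 Metric.isOpen_ball y hy
  exact ⟨δ, hδ, fun z hz => hb z (hsub hz)⟩

/-- Near `x` the boundary of `T` is the hyperplane, so each open half ball, being connected and free
of boundary points, lies inside or outside `T`. Both inside would make `x` interior; both outside
would contradict that `T` is the closure of its interior. -/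
theorem isOutwardAt_or (he : e ∈ M.facesOf T) (h : IsFaceIn e n c)
    (hx : x ∈ intrinsicInterior ℝ (e : Set (Space d))) :
    IsOutwardAt (T : Set (Space d)) n c x ∨ IsOutwardAt (T : Set (Space d)) (-n) (-c) x := by
  obtain ⟨ε, hε, hb⟩ := exists_ball_frontier_eq_hyperplane he h hx
  have hcont : Continuous fun z : Space d => inner ℝ n z := by fun_prop
  have hside : ∀ U : Set (Space d), Convex ℝ U → U ⊆ Metric.ball x ε →
      (∀ z ∈ U, inner ℝ n z ≠ c) →
      U ⊆ interior (T : Set (Space d)) ∨ U ⊆ (T : Set (Space d))ᶜ := by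
    intro U hU hsub hne
    refine hU.isPreconnected.subset_or_subset isOpen_interior (isClosed_elem T).isOpen_compl
      (Set.disjoint_left.2 fun z hz hz' => hz' (interior_subset hz)) fun z hz => ?_
    by_contra hn
    rw [Set.mem_union, not_or, Set.mem_compl_iff, not_not] at hn
    exact hne z hz ((hb z (hsub hz)).1 ⟨subset_closure hn.2, hn.1⟩)
  have hlin : IsLinearMap ℝ fun z : Space d => (inner ℝ n z : ℝ) :=
    ⟨fun a b => inner_add_right n a b, fun r a => inner_smul_right n a r⟩
  have hP := hside (Metric.ball x ε ∩ {z | c < inner ℝ n z})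
    ((convex_ball x ε).inter (convex_halfSpace_gt hlin c)) Set.inter_subset_left
    fun z hz => ne_of_gt hz.2
  have hN := hside (Metric.ball x ε ∩ {z | inner ℝ n z < c})
    ((convex_ball x ε).inter (convex_halfSpace_lt hlin c)) Set.inter_subset_left
    fun z hz => ne_of_lt hz.2
  rcases hP with hP | hP <;> rcases hN with hN | hN
  · exfalso
    have hxf : x ∈ frontier (T : Set (Space d)) := mem_facesOf.1 he (intrinsicInterior_subset hx)
    refine hxf.2 (mem_interior_iff_mem_nhds.2 (Metric.mem_nhds_iff.2 ⟨ε, hε, fun z hz => ?_⟩))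
    rcases lt_trichotomy (inner ℝ n z) c with hlt | heq | hgt
    · exact interior_subset (hN ⟨hz, hlt⟩)
    · exact (isClosed_elem T).frontier_subset ((hb z hz).2 heq)
    · exact interior_subset (hP ⟨hz, hgt⟩)
  · right
    refine ⟨ε, hε, fun z hz => ⟨fun hlt => ?_, fun hlt => ?_⟩⟩
    · rw [inner_neg_left, neg_lt_neg_iff] at hlt
      exact hN ⟨hz, hlt⟩
    · rw [inner_neg_left, neg_lt_neg_iff] at hlt
      exact interior_subset (hP ⟨hz, hlt⟩)
  · left
    exact ⟨ε, hε, fun z hz => ⟨fun hlt => hP ⟨hz, hlt⟩, fun hlt => interior_subset (hN ⟨hz, hlt⟩)⟩⟩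
  · exfalso
    have hxT : x ∈ closure (interior (T : Set (Space d))) := by
      rw [(M.isElement T T.2).closure_interior]
      exact face_subset_elem he (intrinsicInterior_subset hx)
    obtain ⟨z, hz, hzi⟩ := mem_closure_iff.1 hxT _ Metric.isOpen_ball (Metric.mem_ball_self hε)
    rcases lt_trichotomy (inner ℝ n z) c with hlt | heq | hgt
    · exact hN ⟨hz, hlt⟩ (interior_subset hzi)
    · exact ((hb z hz).2 heq).2 hzi
    · exact hP ⟨hz, hgt⟩ (interior_subset hzi)

theorem IsOutwardAt.not_neg {T : Set (Space d)} (hn : ‖n‖ = 1) (hx : inner ℝ n x = c)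
    (h₁ : IsOutwardAt T n c x) (h₂ : IsOutwardAt T (-n) (-c) x) : False := by
  obtain ⟨ε₁, hε₁, h₁⟩ := h₁
  obtain ⟨ε₂, hε₂, h₂⟩ := h₂
  have hε : 0 < min ε₁ ε₂ := lt_min hε₁ hε₂
  set t := min ε₁ ε₂ / 2 with ht
  have ht0 : 0 < t := by positivity
  have hd : dist (x + t • n) x < min ε₁ ε₂ := by
    rw [dist_self_add_left, norm_smul, hn, mul_one, Real.norm_of_nonneg ht0.le]
    linarith
  have hin : inner ℝ n (x + t • n) = c + t := by
    rw [inner_add_right, inner_smul_right, real_inner_self_eq_norm_sq, hn, hx]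
    ring
  refine (h₁ _ (lt_of_lt_of_le hd (min_le_left _ _))).1 (by linarith)
    ((h₂ _ (lt_of_lt_of_le hd (min_le_right _ _))).2 ?_)
  rw [inner_neg_left]
  linarith

theorem isOutwardNormal_of_isOutwardAt (h : IsFaceIn e n c)
    (hout : ∀ x ∈ intrinsicInterior ℝ (e : Set (Space d)), IsOutwardAt (T : Set (Space d)) n c x) :
    IsOutwardNormal (T : Set (Space d)) e n := by
  refine ⟨h.norm_eq, fun x hx y hy => by
    rw [inner_sub_right, h.inner_eq x hx, h.inner_eq y hy, sub_self], fun x hx => ?_⟩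
  obtain ⟨ε, hε, hb⟩ := hout x hx
  have hxc := h.inner_eq x (intrinsicInterior_subset hx)
  filter_upwards [Ioo_mem_nhdsGT hε] with t ht
  have hnorm : ‖t • n‖ < ε := by
    rw [norm_smul, h.norm_eq, mul_one, Real.norm_of_nonneg ht.1.le]
    exact ht.2
  have hin : inner ℝ n (t • n) = t := by
    rw [inner_smul_right, real_inner_self_eq_norm_sq, h.norm_eq]
    ring
  refine ⟨(hb _ ?_).1 ?_, (hb _ ?_).2 ?_⟩
  · rwa [Metric.mem_ball, dist_self_add_left]
  · rw [inner_add_right, hxc, hin]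
    linarith [ht.1]
  · rwa [Metric.mem_ball, dist_self_sub_left]
  · rw [inner_sub_right, hxc, hin]
    linarith [ht.1]

/-- The two local orientations hold on open sets that cover the relative interior of `e` and are
disjoint on it. As it is connected, one sign of the normal serves the whole face. -/
theorem exists_isOutwardNormal (he : e ∈ M.facesOf T) :
    ∃ n, IsOutwardNormal (T : Set (Space d)) e n := by
  obtain ⟨n, c, h⟩ := (M.isFace e e.2).exists_isFaceIn
  have hconn := (M.isFace e e.2).connected.isPreconnected
  have hor : intrinsicInterior ℝ (e : Set (Space d)) ⊆
      {x | IsOutwardAt (T : Set (Space d)) n c x} ∪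
        {x | IsOutwardAt (T : Set (Space d)) (-n) (-c) x} := fun x hx => isOutwardAt_or he h hx
  rcases isPreconnected_iff_subset_of_disjoint.1 hconn _ _ (isOpen_isOutwardAt _ n c)
    (isOpen_isOutwardAt _ (-n) (-c)) hor (by
      rw [Set.eq_empty_iff_forall_notMem]
      rintro x ⟨hx, h₁, h₂⟩
      exact IsOutwardAt.not_neg h.norm_eq (h.inner_eq x (intrinsicInterior_subset hx)) h₁ h₂)
    with hsub | hsub
  · exact ⟨n, isOutwardNormal_of_isOutwardAt h hsub⟩
  · exact ⟨-n, isOutwardNormal_of_isOutwardAt h.neg hsub⟩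

theorem isOutwardNormal_outwardNormal (he : e ∈ M.facesOf T) :
    IsOutwardNormal (T : Set (Space d)) e (outwardNormal (T : Set (Space d)) e) :=
  Classical.epsilon_spec (exists_isOutwardNormal he)

theorem exists_isFaceIn_outwardNormal (he : e ∈ M.facesOf T) :
    ∃ c, IsFaceIn e (outwardNormal (T : Set (Space d)) e) c :=
  (M.isFace e e.2).isFaceIn (isOutwardNormal_outwardNormal he).1
    (isOutwardNormal_outwardNormal he).2.1

/-- A convex element lies on the inner side of each of its faces. -/
theorem inner_outwardNormal_le (hT : Convex ℝ (T : Set (Space d))) (he : e ∈ M.facesOf T)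
    (h : IsFaceIn e (outwardNormal (T : Set (Space d)) e) c) {y : Space d}
    (hy : y ∈ (T : Set (Space d))) : inner ℝ (outwardNormal (T : Set (Space d)) e) y ≤ c := by
  by_contra! hlt
  set n := outwardNormal (T : Set (Space d)) e
  obtain ⟨x, hx⟩ := h.isFace.intrinsicInterior_nonempty
  obtain ⟨hxc, ε, hε, hb⟩ := h.mem_intrinsicInterior_iff.1 hx
  set δ := inner ℝ n y - c with hδ
  have hδ0 : 0 < δ := by linarith
  -- Chosen so that `x + t n = (1 - t/δ) f(t) + (t/δ) y` with `f(t)` in the hyperplane of `e`. For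
  -- small `t` the point `f(t)` is near `x`, hence in `e`, and convexity puts `x + t n` into `T`,
  -- against the outward normal.
  let f : ℝ → Space d := fun t => (1 - t / δ)⁻¹ • (x + t • n - (t / δ) • y)
  have hf0 : f 0 = x := by simp [f]
  have hfc : ContinuousAt f 0 := by
    have h1 : ContinuousAt (fun t : ℝ => (1 - t / δ)⁻¹) 0 :=
      ContinuousAt.inv₀ (by fun_prop) (by simp)
    have h2 : ContinuousAt (fun t : ℝ => x + t • n - (t / δ) • y) 0 := by fun_prop
    exact h1.smul h2
  have hev : ∀ᶠ t in 𝓝[>] (0 : ℝ), f t ∈ Metric.ball x ε := by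
    refine (hfc.tendsto.mono_left nhdsWithin_le_nhds).eventually ?_
    rw [hf0]
    exact Metric.ball_mem_nhds x hε
  obtain ⟨t, ⟨hft, hout, -⟩, ht⟩ := ((hev.and ((isOutwardNormal_outwardNormal he).2.2 x hx)).and
    (Ioo_mem_nhdsGT hδ0)).exists
  have hs0 : 0 ≤ t / δ := div_nonneg ht.1.le hδ0.le
  have hs1 : t / δ < 1 := (div_lt_one hδ0).2 ht.2
  have hs2 : 1 - t / δ ≠ 0 := by linarith
  have hin : inner ℝ n (f t) = c := by
    have hy' : inner ℝ n y = c + δ := by rw [hδ]; ring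
    have htd : t / δ * δ = t := div_mul_cancel₀ t hδ0.ne'
    rw [inner_smul_right, inner_sub_right, inner_add_right, inner_smul_right, inner_smul_right,
      real_inner_self_eq_norm_sq, h.norm_eq, hxc, hy']
    rw [inv_mul_eq_iff_eq_mul₀ hs2]
    linear_combination -htd
  have hfe : f t ∈ (T : Set (Space d)) := face_subset_elem he (hb _ hin hft)
  refine hout ?_
  have hcomb := hT hfe hy (sub_nonneg.2 hs1.le) hs0 (by ring)
  rwa [smul_smul, mul_inv_cancel₀ hs2, one_smul, sub_add_cancel] at hcomb

theorem interior_elem_subset (hΩ : interior (closure Ω) = Ω) (T : M.elems) :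
    interior (T : Set (Space d)) ⊆ Ω := by
  have hsub : (T : Set (Space d)) ⊆ closure Ω := by
    rw [← M.iUnion_elems]
    exact Set.subset_iUnion₂ (s := fun (T : Set (Space d)) (_ : T ∈ M.elems) => T) T.1 T.2
  exact (interior_mono hsub).trans hΩ.subset

theorem exists_elem_of_face (e : M.faces) : ∃ T : M.elems, e ∈ M.facesOf T := by
  obtain ⟨T, hT, hsub⟩ := M.face_of_elem e e.2
  exact ⟨⟨T, hT⟩, mem_facesOf.2 hsub⟩

/-- A boundary point of `Ω` lies in some element, but not in its interior, which is contained in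
`Ω`. -/
theorem exists_face_of_mem_frontier_domain (hopen : IsOpen Ω) (hΩ : interior (closure Ω) = Ω)
    (hx : x ∈ frontier Ω) : ∃ e : M.faces, x ∈ (e : Set (Space d)) := by
  have hcl : x ∈ ⋃ T ∈ M.elems, T := by
    rw [M.iUnion_elems]
    exact hx.1
  obtain ⟨T, hT, hxT⟩ := Set.mem_iUnion₂.1 hcl
  have hxi : x ∉ interior T := fun h => hx.2 (by
    rw [hopen.interior_eq]
    exact interior_elem_subset hΩ ⟨T, hT⟩ h)
  obtain ⟨e, -, he⟩ := exists_face_of_mem_frontier (T := ⟨T, hT⟩) ⟨subset_closure hxT, hxi⟩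
  exact ⟨e, he⟩

/-- A face meets the part `Γ` of the boundary in a set of positive surface measure. -/
theorem exists_face_measure_inter_pos (hopen : IsOpen Ω) (hΩ : interior (closure Ω) = Ω)
    {Γ : Set (Space d)} (hΓ : Γ ⊆ frontier Ω) (hpos : 0 < (μHE[d - 1] : Measure (Space d)) Γ) :
    ∃ e : M.faces, 0 < (μHE[d - 1] : Measure (Space d)) ((e : Set (Space d)) ∩ Γ) := by
  by_contra! hzero
  refine hpos.ne' (measure_mono_null (fun x hx => ?_)
    (measure_iUnion_null fun e : M.faces => nonpos_iff_eq_zero.1 (hzero e)))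
  obtain ⟨e, he⟩ := exists_face_of_mem_frontier_domain (M := M) hopen hΩ (hΓ hx)
  exact Set.mem_iUnion.2 ⟨e, he, hx⟩

/-- The set where two different elements meet away from a common face is covered by finitely many
affine subspaces of codimension two. -/
theorem exists_cover_skeleton (M : PolytopalMesh d Ω) :
    ∃ H : Set ((Space d × ℝ) × (Space d × ℝ)), H.Finite ∧
      (∀ p ∈ H, ‖p.1.1‖ = 1 ∧ p.2.1 ≠ 0 ∧ inner ℝ p.1.1 p.2.1 = 0) ∧
      ∀ e : M.faces, ∀ x ∈ (e : Set (Space d)), x ∉ intrinsicInterior ℝ (e : Set (Space d)) →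
        ∃ p ∈ H, inner ℝ p.1.1 x = p.1.2 ∧ inner ℝ p.2.1 x = p.2.2 := by
  choose n c h using fun e : M.faces => (M.isFace e e.2).exists_isFaceIn
  choose H hH hcov using fun e : M.faces => (h e).exists_cover_relative_boundary
  refine ⟨⋃ e : M.faces, (fun p => ((n e, c e), p)) '' (H e : Set (Space d × ℝ)),
    Set.finite_iUnion fun e => (H e).finite_toSet.image _, ?_, fun e x hx hxi => ?_⟩
  · intro p hp
    obtain ⟨e, q, hq, rfl⟩ := Set.mem_iUnion.1 hp
    exact ⟨(h e).norm_eq, (hH e q hq).1, (hH e q hq).2⟩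
  · obtain ⟨q, hq, hqx⟩ := hcov e x hx hxi
    exact ⟨((n e, c e), q), Set.mem_iUnion.2 ⟨e, q, hq, rfl⟩, (h e).inner_eq x hx, hqx⟩

/-- An affine subspace of codimension two and a point lie in a common hyperplane. -/
theorem exists_hyperplane_through {n m : Space d} (hn : ‖n‖ = 1) (hm : m ≠ 0)
    (hnm : inner ℝ n m = 0) (c a : ℝ) (b : Space d) :
    ∃ l : Space d, l ≠ 0 ∧ ∀ x, inner ℝ n x = c → inner ℝ m x = a → inner ℝ l x = inner ℝ l b := by
  by_cases hb : inner ℝ n b = c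
  · exact ⟨n, by rintro rfl; simp at hn, fun x hx _ => by rw [hx, hb]⟩
  -- The member of the pencil of hyperplanes through the codimension-two subspace that contains `b`.
  · refine ⟨(inner ℝ n b - c) • m - (inner ℝ m b - a) • n, fun h0 => ?_, fun x hx hx' => ?_⟩
    · have h1 := congrArg (fun z => inner ℝ m z) h0
      simp only [inner_sub_right, inner_smul_right, inner_zero_right, real_inner_comm n m, hnm,
        mul_zero, sub_zero] at h1
      rcases mul_eq_zero.1 h1 with h2 | h2
      · exact hb (sub_eq_zero.1 h2)
      · exact hm (inner_self_eq_zero.1 h2)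
    · simp only [inner_sub_left, inner_smul_left, hx, hx']
      simp
      ring

/-- Any two elements are connected by a chain of elements in which neighbours share a face. -/
theorem forall_elem_of_face_chain (hopen : IsOpen Ω) (hconn : IsConnected Ω)
    (hΩ : interior (closure Ω) = Ω) {p : M.elems → Prop} (hp : ∃ T, p T)
    (hchain : ∀ T T' : M.elems, ∀ e ∈ M.facesOf T, e ∈ M.facesOf T' → p T → p T') :
    ∀ T, p T := by
  by_contra! hnot
  obtain ⟨T₀, hT₀⟩ := hp
  obtain ⟨T₁, hT₁⟩ := hnot
  let A : Set (Space d) := ⋃ T ∈ {T : M.elems | p T}, (T : Set (Space d))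
  let B : Set (Space d) := ⋃ T ∈ {T : M.elems | ¬p T}, (T : Set (Space d))
  have hA : IsClosed A := (Set.toFinite _).isClosed_biUnion fun T _ => isClosed_elem T
  have hB : IsClosed B := (Set.toFinite _).isClosed_biUnion fun T _ => isClosed_elem T
  have hcover : Ω ⊆ A ∪ B := fun x hx => by
    have hcl : x ∈ ⋃ T ∈ M.elems, T := by
      rw [M.iUnion_elems]
      exact subset_closure hx
    obtain ⟨T, hT, hxT⟩ := Set.mem_iUnion₂.1 hcl
    by_cases hpT : p ⟨T, hT⟩
    · exact Or.inl (Set.mem_iUnion₂.2 ⟨⟨T, hT⟩, hpT, hxT⟩)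
    · exact Or.inr (Set.mem_iUnion₂.2 ⟨⟨T, hT⟩, hpT, hxT⟩)
  have hmeets : ∀ T : M.elems, (Ω ∩ (T : Set (Space d))).Nonempty := fun T => by
    obtain ⟨x, hx⟩ := interior_elem_nonempty T
    exact ⟨x, interior_elem_subset hΩ T hx, interior_subset hx⟩
  -- Connectedness of `Ω` forces the two closed unions to meet. Near a common point `x` an element
  -- of each kind has interior points, to be joined by a segment inside `Ω`.
  obtain ⟨x, hxΩ, hxA, hxB⟩ := isPreconnected_closed_iff.1 hconn.isPreconnected A B hA hB hcover
    ((hmeets T₀).mono fun z hz => ⟨hz.1, Set.mem_iUnion₂.2 ⟨T₀, hT₀, hz.2⟩⟩)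
    ((hmeets T₁).mono fun z hz => ⟨hz.1, Set.mem_iUnion₂.2 ⟨T₁, hT₁, hz.2⟩⟩)
  obtain ⟨TA, hpA, hxTA⟩ := Set.mem_iUnion₂.1 hxA
  obtain ⟨TB, hpB, hxTB⟩ := Set.mem_iUnion₂.1 hxB
  obtain ⟨ε, hε, hball⟩ := Metric.isOpen_iff.1 hopen x hxΩ
  obtain ⟨b, hb, hbB⟩ := mem_closure_iff.1
    (by rwa [(M.isElement TB TB.2).closure_interior] : x ∈ closure (interior (TB : Set (Space d))))
    _ Metric.isOpen_ball (Metric.mem_ball_self hε)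
  obtain ⟨a₀, ha₀, ha₀A⟩ := mem_closure_iff.1
    (by rwa [(M.isElement TA TA.2).closure_interior] : x ∈ closure (interior (TA : Set (Space d))))
    _ Metric.isOpen_ball (Metric.mem_ball_self hε)
  obtain ⟨H, hfin, hH, hcov⟩ := exists_cover_skeleton M
  choose! l hl0 hl using fun (p : (Space d × ℝ) × (Space d × ℝ)) (hp : p ∈ H) =>
    exists_hyperplane_through (hH p hp).1 (hH p hp).2.1 (hH p hp).2.2 p.1.2 p.2.2 b
  have hnull : volume (⋃ p ∈ H, {z : Space d | inner ℝ (l p) z = inner ℝ (l p) b}) = 0 :=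
    (measure_biUnion_null_iff hfin.countable).2 fun p hp => volume_hyperplane (hl0 p hp) _
  have hUopen : IsOpen (Metric.ball x ε ∩ interior (TA : Set (Space d))) :=
    Metric.isOpen_ball.inter isOpen_interior
  -- Generic choice: `a` avoids the finitely many hyperplanes through `b` and a piece of the
  -- skeleton, so the segment will miss the skeleton except possibly at `b`.
  obtain ⟨a, ⟨ha, haA⟩, hagen⟩ : ∃ a ∈ Metric.ball x ε ∩ interior (TA : Set (Space d)),
      a ∉ ⋃ p ∈ H, {z : Space d | inner ℝ (l p) z = inner ℝ (l p) b} := by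
    by_contra! hsub
    exact (hUopen.measure_pos volume ⟨a₀, ha₀, ha₀A⟩).ne' (measure_mono_null hsub hnull)
  have hseg : segment ℝ a b ⊆ Ω := ((convex_ball x ε).segment_subset ha hb).trans hball
  obtain ⟨z, hz, hzA, hzB⟩ := isPreconnected_closed_iff.1
    (convex_segment a b).isPreconnected A B hA hB (hseg.trans hcover)
    ⟨a, left_mem_segment ℝ a b, Set.mem_iUnion₂.2 ⟨TA, hpA, interior_subset haA⟩⟩
    ⟨b, right_mem_segment ℝ a b, Set.mem_iUnion₂.2 ⟨TB, hpB, interior_subset hbB⟩⟩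
  obtain ⟨T, hpT, hzT⟩ := Set.mem_iUnion₂.1 hzA
  obtain ⟨T', hpT', hzT'⟩ := Set.mem_iUnion₂.1 hzB
  have hne : ∀ S S' : M.elems, p S → ¬p S' → S ≠ S' := fun S S' h h' hSS => h' (hSS ▸ h)
  obtain ⟨e, he, hze⟩ := exists_face_of_mem_frontier (T := T)
    ⟨subset_closure hzT, notMem_interior_of_ne (hne T T' hpT hpT').symm hzT'⟩
  obtain ⟨e', he', hze'⟩ := exists_face_of_mem_frontier (T := T')
    ⟨subset_closure hzT', notMem_interior_of_ne (hne T T' hpT hpT') hzT⟩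
  -- A common face at `z` would pass the property on from `T` to `T'`. So `z` lies on two different
  -- faces, hence on the relative boundary of one, that is, on the skeleton.
  have hee : e' ≠ e := fun h => hpT' (hchain T T' e he (h ▸ he') hpT)
  obtain ⟨q, hq, hq1, hq2⟩ := hcov e z hze fun hi => notMem_of_mem_intrinsicInterior hi hee hze'
  have hzl := hl q hq z hq1 hq2
  obtain ⟨s, t, hs, ht, hst, rfl⟩ := hz
  -- If `s = 0`, then `z = b` is interior to `TB` and cannot belong to the different element `T`.
  -- With `s ≠ 0`, the hyperplane through `b` and `z` contains `a` as well.
  have hs0 : s ≠ 0 := by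
    rintro rfl
    have ht1 : t = 1 := by linarith
    subst ht1
    rw [zero_smul, zero_add, one_smul] at hzT
    exact notMem_interior_of_ne (hne T TB hpT hpB) hzT hbB
  refine hagen (Set.mem_iUnion₂.2 ⟨q, hq, ?_⟩)
  rw [inner_add_right, inner_smul_right, inner_smul_right] at hzl
  change inner ℝ (l q) a = inner ℝ (l q) b
  have : s * inner ℝ (l q) a = s * inner ℝ (l q) b := by
    linear_combination hzl - (inner ℝ (l q) b) * hst
  exact mul_left_cancel₀ hs0 this

end PolytopalMesh

/-! ### The divergence theorem on an element for polynomials vanishing on all faces but one -/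

namespace PolytopalMesh

variable {d : ℕ} {Ω : Set (Space d)} {M : PolytopalMesh d Ω} {T : M.elems} {e : M.faces}
  {n : Space d} {c : ℝ}

/-- Almost every line in a given direction misses the faces parallel to that direction. -/
theorem ae_line_notMem_parallel_faces (T : M.elems) (v : Space d) :
    ∀ᵐ y : Perp v, ∀ e ∈ M.facesOf T, inner ℝ (outwardNormal (T : Set (Space d)) e) v = 0 →
      ∀ t : ℝ, (y : Space d) + t • v ∉ (e : Set (Space d)) := by
  rw [ae_all_iff]
  intro e
  by_cases he : e ∈ M.facesOf T
  swap
  · exact Filter.Eventually.of_forall fun y h => absurd h he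
  by_cases hpar : inner ℝ (outwardNormal (T : Set (Space d)) e) v = 0
  swap
  · exact Filter.Eventually.of_forall fun y _ h => absurd h hpar
  obtain ⟨c, h⟩ := exists_isFaceIn_outwardNormal he
  set n := outwardNormal (T : Set (Space d)) e
  -- The functional of `n` is constant along lines in direction `v`, so the base points of lines
  -- hitting `e` lie in one hyperplane of `Perp v`.
  have hn : n ∈ Perp v := by
    rw [Submodule.mem_orthogonal_singleton_iff_inner_right, real_inner_comm]
    exact hpar
  have hn0 : (⟨n, hn⟩ : Perp v) ≠ 0 := fun h0 => by
    have h1 : n = 0 := congrArg Subtype.val h0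
    have h2 := h.norm_eq
    rw [h1, norm_zero] at h2
    exact zero_ne_one h2
  refine measure_mono_null (fun y hy => ?_) (volume_hyperplane hn0 c)
  rw [Set.mem_compl_iff, Set.mem_ofPred_eq] at hy
  push Not at hy
  obtain ⟨-, -, t, ht⟩ := hy
  have h1 := h.inner_eq _ ht
  rw [inner_add_right, inner_smul_right, hpar, mul_zero, add_zero] at h1
  exact h1

/-- The line misses the faces parallel to it and crosses the hyperplane of each other face at most
once. -/
theorem finite_line_inter_frontier {v y : Space d}
    (hy : ∀ e ∈ M.facesOf T, inner ℝ (outwardNormal (T : Set (Space d)) e) v = 0 →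
      ∀ t : ℝ, y + t • v ∉ (e : Set (Space d))) :
    {t : ℝ | y + t • v ∈ frontier (T : Set (Space d))}.Finite := by
  have hsub : {t : ℝ | y + t • v ∈ frontier (T : Set (Space d))} ⊆
      ⋃ e ∈ {e | e ∈ M.facesOf T}, {t : ℝ | y + t • v ∈ (e : Set (Space d))} := fun t ht => by
    obtain ⟨e, he, hte⟩ := exists_face_of_mem_frontier ht
    exact Set.mem_iUnion₂.2 ⟨e, he, hte⟩
  refine Set.Finite.subset ((Set.toFinite _).biUnion fun e he => Set.Subsingleton.finite ?_) hsub
  intro t ht s hs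
  obtain ⟨c, h⟩ := exists_isFaceIn_outwardNormal he
  have hne : inner ℝ (outwardNormal (T : Set (Space d)) e) v ≠ 0 := fun h0 => hy e he h0 t ht
  have h1 := h.inner_eq _ ht
  have h2 := h.inner_eq _ hs
  rw [inner_add_right, inner_smul_right] at h1 h2
  exact mul_right_cancel₀ hne (by linarith)

theorem continuous_sum_pderiv (g : Poly d) (v : Space d) :
    Continuous fun x => ∑ j, v j * ev (MvPolynomial.pderiv j g) x :=
  continuous_finsetSum _ fun _ _ => continuous_const.mul (continuous_ev _)

/-- The derivative of `g` in the direction `v` has mean zero if `g` vanishes on all faces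
transversal to `v`. -/
theorem setIntegral_directional_deriv_eq_zero {v : Space d} (hv : ‖v‖ = 1) {g : Poly d}
    (hg : ∀ e ∈ M.facesOf T, inner ℝ (outwardNormal (T : Set (Space d)) e) v ≠ 0 →
      ∀ x ∈ (e : Set (Space d)), ev g x = 0) :
    ∫ x in (T : Set (Space d)), ∑ j, v j * ev (MvPolynomial.pderiv j g) x = 0 := by
  rw [setIntegral_eq_slices hv (isCompact_elem T) (continuous_sum_pderiv g v)]
  refine integral_eq_zero_of_ae ?_
  filter_upwards [ae_line_notMem_parallel_faces T v] with y hy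
  have hfr := frontier_slice_subset v (T : Set (Space d)) (y : Space d)
  refine setIntegral_deriv_eq_zero (isCompact_slice hv (isCompact_elem T) _)
    ((finite_line_inter_frontier hy).subset hfr) (hasDerivAt_ev_line g y v)
    ((continuous_sum_pderiv g v).comp (by fun_prop)) fun t ht => ?_
  obtain ⟨e, he, hte⟩ := exists_face_of_mem_frontier (hfr ht)
  exact hg e he (fun h0 => hy e he h0 t hte) _ hte

/-- Almost every line orthogonal to a face that meets the face meets its relative interior. -/
theorem _root_.WG.IsFaceIn.ae_mem_intrinsicInterior {e : Set (Space d)} (h : IsFaceIn e n c) :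
    ∀ᵐ y : Perp n, (y : Space d) + c • n ∈ e → (y : Space d) + c • n ∈ intrinsicInterior ℝ e := by
  obtain ⟨H, hH, hcov⟩ := h.exists_cover_relative_boundary
  have hnull : volume (⋃ p ∈ H, {y : Perp n | inner ℝ p.1 (y : Space d) = p.2}) = 0 := by
    refine (measure_biUnion_null_iff H.countable_toSet).2 fun p hp => ?_
    have hp' : p.1 ∈ Perp n := by
      rw [Submodule.mem_orthogonal_singleton_iff_inner_right]
      exact (hH p hp).2
    exact volume_hyperplane (m := (⟨p.1, hp'⟩ : Perp n))
      (fun h0 => (hH p hp).1 (congrArg Subtype.val h0)) p.2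
  refine measure_mono_null (fun y hy => ?_) hnull
  rw [Set.mem_compl_iff, Set.mem_ofPred_eq] at hy
  push Not at hy
  obtain ⟨p, hp, hpy⟩ := hcov _ hy.1 hy.2
  rw [inner_add_right, inner_smul_right, real_inner_comm n, (hH p hp).2, mul_zero, add_zero] at hpy
  exact Set.mem_iUnion₂.2 ⟨p, hp, hpy⟩

/-- The divergence theorem for the normal derivative of a polynomial that vanishes on all faces
but one. -/
theorem setIntegral_normal_deriv (he : e ∈ M.facesOf T)
    (h : IsFaceIn e (outwardNormal (T : Set (Space d)) e) c) {g : Poly d}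
    (hg : ∀ e' ∈ M.facesOf T, e' ≠ e → ∀ x ∈ (e' : Set (Space d)), ev g x = 0) :
    ∫ x in (T : Set (Space d)), ∑ j,
        outwardNormal (T : Set (Space d)) e j * ev (MvPolynomial.pderiv j g) x =
      ∫ x in (e : Set (Space d)), ev g x ∂(μHE[d - 1] : Measure (Space d)) := by
  have hout := (isOutwardNormal_outwardNormal he).2.2
  set n := outwardNormal (T : Set (Space d)) e with hn
  rw [setIntegral_eq_slices h.norm_eq (isCompact_elem T) (continuous_sum_pderiv g n),
    h.setIntegral_eq_chart, ← integral_indicator h.isCompact_chart.measurableSet]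
  refine integral_congr_ae ?_
  filter_upwards [ae_line_notMem_parallel_faces T n, h.ae_mem_intrinsicInterior]
    with y hy hyi
  have hfr := frontier_slice_subset n (T : Set (Space d)) (y : Space d)
  have hfin := (finite_line_inter_frontier hy).subset hfr
  have hcomp := isCompact_slice h.norm_eq (isCompact_elem T) (y : Space d)
  -- Each end point of the slice lies on a face. Only on `e` may `g` be nonzero, and `e` is reached
  -- only at the parameter `c`.
  have hzero : ∀ t ∈ frontier {t : ℝ | (y : Space d) + t • n ∈ (T : Set (Space d))},
      (t = c → (y : Space d) + c • n ∉ (e : Set (Space d))) → ev g ((y : Space d) + t • n) = 0 := by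
    intro t ht htc
    obtain ⟨e', he', hte'⟩ := exists_face_of_mem_frontier (hfr ht)
    refine hg e' he' (fun hee => ?_) _ hte'
    subst hee
    have htc' : t = c := by
      rw [← h.inner_eq _ hte', inner_perp_add_smul h.norm_eq]
    exact htc htc' (htc' ▸ hte')
  by_cases hye : (y : Space d) + c • n ∈ (e : Set (Space d))
  · rw [Set.indicator_of_mem (show y ∈ {y : Perp n | (y : Space d) + c • n ∈ (e : Set (Space d))}
      from hye)]
    -- At a relative interior point of `e` the outward normal says that `c` is a right end point of
    -- the slice: outside `T` just after, inside just before.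
    have hloc := hout _ (hyi hye)
    refine setIntegral_deriv_eq hcomp hfin (hasDerivAt_ev_line g y n)
      ((continuous_sum_pderiv g n).comp (by fun_prop)) (fun t ht htc => hzero t ht (absurd · htc))
      (face_subset_elem he hye) ?_ ?_
    · have htend : Filter.Tendsto (fun t : ℝ => t - c) (𝓝[>] c) (𝓝[>] 0) := by
        refine tendsto_nhdsWithin_iff.2 ⟨?_, ?_⟩
        · have : Filter.Tendsto (fun t : ℝ => t - c) (𝓝 c) (𝓝 (c - c)) := by
            exact (continuous_id.sub continuous_const).tendsto c
          rw [sub_self] at this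
          exact this.mono_left nhdsWithin_le_nhds
        · filter_upwards [self_mem_nhdsWithin] with t ht using sub_pos.2 (Set.mem_Ioi.1 ht)
      filter_upwards [htend.eventually hloc] with t ht
      have h1 := ht.1
      rw [add_assoc, ← add_smul, add_sub_cancel] at h1
      exact h1
    · have htend : Filter.Tendsto (fun t : ℝ => c - t) (𝓝[<] c) (𝓝[>] 0) := by
        refine tendsto_nhdsWithin_iff.2 ⟨?_, ?_⟩
        · have : Filter.Tendsto (fun t : ℝ => c - t) (𝓝 c) (𝓝 (c - c)) := by
            exact (continuous_const.sub continuous_id).tendsto c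
          rw [sub_self] at this
          exact this.mono_left nhdsWithin_le_nhds
        · filter_upwards [self_mem_nhdsWithin] with t ht using sub_pos.2 (Set.mem_Iio.1 ht)
      filter_upwards [htend.eventually hloc] with t ht
      have h1 := ht.2
      rw [add_sub_assoc, ← sub_smul, sub_sub_cancel] at h1
      exact h1
  · rw [Set.indicator_of_notMem (show y ∉ {y : Perp n | (y : Space d) + c • n ∈ (e : Set (Space d))}
      from hye)]
    exact setIntegral_deriv_eq_zero hcomp hfin (hasDerivAt_ev_line g y n)
      ((continuous_sum_pderiv g n).comp (by fun_prop)) fun t ht => hzero t ht fun _ => hye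

theorem integrableOn_elem (T : M.elems) {F : Space d → ℝ} (hF : Continuous F) :
    IntegrableOn F (T : Set (Space d)) :=
  hF.continuousOn.integrableOn_compact (isCompact_elem T)

/-- The integral of a polynomial over an element. -/
noncomputable def elemIntegral (T : M.elems) : Poly d →ₗ[ℝ] ℝ where
  toFun p := ∫ x in (T : Set (Space d)), ev p x
  map_add' p q := by
    simp only [ev_add]
    exact integral_add (integrableOn_elem T (continuous_ev p)) (integrableOn_elem T (continuous_ev q))
  map_smul' c p := by
    simp only [ev_smul]
    exact integral_const_mul c _

theorem elemIntegral_apply (T : M.elems) (p : Poly d) :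
    elemIntegral T p = ∫ x in (T : Set (Space d)), ev p x := rfl

theorem integrable_face (e : M.faces) {F : Space d → ℝ} (hF : Continuous F) :
    IntegrableOn F (e : Set (Space d)) (μHE[d - 1] : Measure (Space d)) := by
  obtain ⟨n, c, h⟩ := (M.isFace e e.2).exists_isFaceIn
  exact h.integrableOn hF

/-- The integral of a polynomial over a face. -/
noncomputable def polyFaceIntegral (e : M.faces) : Poly d →ₗ[ℝ] ℝ where
  toFun p := ∫ x in (e : Set (Space d)), ev p x ∂(μHE[d - 1] : Measure (Space d))
  map_add' p q := by
    simp only [ev_add]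
    exact integral_add (integrable_face e (continuous_ev p)) (integrable_face e (continuous_ev q))
  map_smul' c p := by
    simp only [ev_smul]
    exact integral_const_mul c _

theorem polyFaceIntegral_apply (e : M.faces) (p : Poly d) : polyFaceIntegral e p =
    ∫ x in (e : Set (Space d)), ev p x ∂(μHE[d - 1] : Measure (Space d)) := rfl

theorem faceIntegral_ev (e : M.faces) (p : Poly d) :
    faceIntegral (e : Set (Space d)) (fun x => ev p x) = polyFaceIntegral e p := by
  obtain ⟨n, c, h⟩ := (M.isFace e e.2).exists_isFaceIn
  exact h.faceIntegral_eq (ev p)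

theorem elemIntegral_sum_pderiv (T : M.elems) (g : Poly d) (v : Space d) :
    ∫ x in (T : Set (Space d)), ∑ j, v j * ev (MvPolynomial.pderiv j g) x =
      ∑ j, v j * elemIntegral T (MvPolynomial.pderiv j g) := by
  have : ∀ x, ∑ j, v j * ev (MvPolynomial.pderiv j g) x =
      ev (∑ j, v j • MvPolynomial.pderiv j g) x := fun x => by simp
  simp only [this, ← elemIntegral_apply, map_sum, map_smul, smul_eq_mul]

/-- Partial derivatives of polynomials that vanish on the boundary have mean zero. -/
theorem elemIntegral_pderiv_eq_zero {g : Poly d}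
    (hg : ∀ e ∈ M.facesOf T, ∀ x ∈ (e : Set (Space d)), ev g x = 0) (i : Fin d) :
    elemIntegral T (MvPolynomial.pderiv i g) = 0 := by
  have h := setIntegral_directional_deriv_eq_zero (T := T) (v := EuclideanSpace.single i (1 : ℝ))
    (by simp) (g := g) fun e he _ => hg e he
  rw [elemIntegral_sum_pderiv] at h
  simpa using h

/-- The divergence theorem for polynomials that vanish on all faces but one. -/
theorem elemIntegral_pderiv (he : e ∈ M.facesOf T) {g : Poly d}
    (hg : ∀ e' ∈ M.facesOf T, e' ≠ e → ∀ x ∈ (e' : Set (Space d)), ev g x = 0) (i : Fin d) :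
    elemIntegral T (MvPolynomial.pderiv i g) =
      outwardNormal (T : Set (Space d)) e i * polyFaceIntegral e g := by
  obtain ⟨c, h⟩ := exists_isFaceIn_outwardNormal he
  have hnormal := setIntegral_normal_deriv he h hg
  set n := outwardNormal (T : Set (Space d)) e with hn
  rw [elemIntegral_sum_pderiv, ← polyFaceIntegral_apply] at hnormal
  -- For a direction tangential to `e` all transversal faces differ from `e`, and `g` vanishes on
  -- them.
  have htang : ∀ τ : Space d, inner ℝ n τ = 0 →
      ∑ j, τ j * elemIntegral T (MvPolynomial.pderiv j g) = 0 := by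
    intro τ hτ
    rcases eq_or_ne τ 0 with rfl | hτ0
    · simp
    have hu := setIntegral_directional_deriv_eq_zero (T := T) (v := ‖τ‖⁻¹ • τ)
      (norm_smul_inv_norm (𝕜 := ℝ) hτ0) (g := g) fun e' he' hne => hg e' he' fun hee => hne (by
        rw [hee, ← hn, inner_smul_right, hτ, mul_zero])
    rw [elemIntegral_sum_pderiv] at hu
    simp only [PiLp.smul_apply, smul_eq_mul, mul_assoc, ← Finset.mul_sum] at hu
    exact (mul_eq_zero.1 hu).resolve_left (inv_ne_zero (norm_ne_zero_iff.2 hτ0))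
  -- The tangential part of the `i`-th coordinate vector; its normal part contributes `n i` times
  -- the normal derivative.
  have hi := htang (EuclideanSpace.single i (1 : ℝ) - n i • n) (by
    rw [inner_sub_right, inner_smul_right, real_inner_self_eq_norm_sq, h.norm_eq,
      EuclideanSpace.inner_single_right]
    simp)
  simp only [PiLp.sub_apply, PiLp.smul_apply, smul_eq_mul, sub_mul, Finset.sum_sub_distrib,
    mul_assoc, ← Finset.mul_sum, hnormal] at hi
  have hs : ∑ j, (EuclideanSpace.single i (1 : ℝ) : Space d) j *
      elemIntegral T (MvPolynomial.pderiv j g) = elemIntegral T (MvPolynomial.pderiv i g) := by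
    simp
  rw [hs] at hi
  linarith

/-- Integration by parts against a field that vanishes on the boundary. -/
theorem elemIntegral_mul_div_of_vanishing {w : Fin d → Poly d}
    (hw : ∀ e ∈ M.facesOf T, ∀ x ∈ (e : Set (Space d)), ∀ i, ev (w i) x = 0) (p : Poly d) :
    elemIntegral T (p * ∑ i, MvPolynomial.pderiv i (w i)) =
      -elemIntegral T (∑ i, MvPolynomial.pderiv i p * w i) := by
  have h : ∀ i, elemIntegral T (MvPolynomial.pderiv i (p * w i)) = 0 := fun i =>
    elemIntegral_pderiv_eq_zero (fun e he x hx => by rw [ev_mul, hw e he x hx i, mul_zero]) i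
  rw [eq_neg_iff_add_eq_zero, ← map_add, Finset.mul_sum, ← Finset.sum_add_distrib, map_sum]
  refine Finset.sum_eq_zero fun i _ => ?_
  rw [← h i, MvPolynomial.pderiv_mul, add_comm]

/-- Integration by parts against a field that vanishes on all faces but one. -/
theorem elemIntegral_mul_div (he : e ∈ M.facesOf T) {w : Fin d → Poly d}
    (hw : ∀ e' ∈ M.facesOf T, e' ≠ e → ∀ x ∈ (e' : Set (Space d)), ∀ i, ev (w i) x = 0)
    (p : Poly d) :
    elemIntegral T (p * ∑ i, MvPolynomial.pderiv i (w i)) =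
      -elemIntegral T (∑ i, MvPolynomial.pderiv i p * w i) +
        polyFaceIntegral e (p * ∑ i, outwardNormal (T : Set (Space d)) e i • w i) := by
  have h : ∀ i, elemIntegral T (MvPolynomial.pderiv i (p * w i)) =
      outwardNormal (T : Set (Space d)) e i * polyFaceIntegral e (p * w i) := fun i =>
    elemIntegral_pderiv he (fun e' he' hne x hx => by
      rw [ev_mul, hw e' he' hne x hx i, mul_zero]) i
  rw [← sub_eq_iff_eq_add', sub_neg_eq_add, ← map_add, Finset.mul_sum, ← Finset.sum_add_distrib,
    map_sum, Finset.mul_sum, map_sum]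
  refine Finset.sum_congr rfl fun i _ => ?_
  rw [mul_smul_comm, map_smul, smul_eq_mul, ← h i, MvPolynomial.pderiv_mul, add_comm]

end PolytopalMesh

/-! ### Bubble functions and the kernels of the weak gradient and the weak strain -/

namespace PolytopalMesh

variable {d : ℕ} {Ω : Set (Space d)} {M : PolytopalMesh d Ω} {T : M.elems} {e : M.faces}
  {n : Space d} {c : ℝ} {k : ℕ}

/-- The affine polynomial `c - ⟪n, x⟫`. -/
noncomputable def affinePoly (n : Space d) (c : ℝ) : Poly d :=
  MvPolynomial.C c - ∑ i, MvPolynomial.C (n i) * MvPolynomial.X i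

theorem ev_affinePoly (n : Space d) (c : ℝ) (x : Space d) :
    ev (affinePoly n c) x = c - inner ℝ n x := by
  simp [affinePoly, PiLp.inner_apply, mul_comm]

theorem affinePoly_mem (n : Space d) (c : ℝ) : affinePoly n c ∈ polyLE d 1 := by
  refine sub_mem (C_mem_polyLE _ _) (sum_mem fun i _ => ?_)
  rw [MvPolynomial.mem_restrictTotalDegree]
  exact (MvPolynomial.totalDegree_mul _ _).trans (by simp)

theorem affinePoly_ne_zero (hn : ‖n‖ = 1) (c : ℝ) : affinePoly n c ≠ 0 := fun h0 => by
  have h1 := ev_affinePoly n c ((c + 1) • n)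
  rw [h0, ev_zero, inner_smul_right, real_inner_self_eq_norm_sq, hn] at h1
  linarith

/-- Almost no point of a face lies in the hyperplane of another face of the same element. -/
theorem ae_inner_ne (hM : M.NoCoplanarFaces) {e' : M.faces} (he : e ∈ M.facesOf T)
    (he' : e' ∈ M.facesOf T) (hne : e' ≠ e) (h : IsFaceIn e n c) :
    ∀ᵐ x ∂(μHE[d - 1] : Measure (Space d)).restrict (e' : Set (Space d)), inner ℝ n x ≠ c := by
  obtain ⟨n', c', h'⟩ := (M.isFace e' e'.2).exists_isFaceIn
  rw [ae_restrict_iff' h'.isCompact.measurableSet]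
  have hnull : (μHE[d - 1] : Measure (Space d)) {x | x ∈ (e' : Set (Space d)) ∧ inner ℝ n x = c}
      = 0 := by
    by_cases hpar : ∀ a : ℝ, n ≠ a • n'
    · exact h'.measure_inter_hyperplane hpar c
    push Not at hpar
    obtain ⟨a, ha⟩ := hpar
    have ha0 : a ≠ 0 := by
      rintro rfl
      have := h.norm_eq
      rw [ha, zero_smul, norm_zero] at this
      exact zero_ne_one this
    -- For parallel normals a single common point makes the two hyperplanes equal, which is
    -- excluded; the intersection is empty.
    refine measure_mono_null (fun x hx => ?_) measure_empty
    have hac : a * c' = c := by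
      rw [← hx.2, ha, inner_smul_left, h'.inner_eq x hx.1]
      simp
    refine hne (hM T e' he' e he ?_)
    ext z
    rw [h.mem_affineSpan_iff, h'.mem_affineSpan_iff, ha, inner_smul_left, ← hac]
    simp [ha0]
  refine measure_mono_null (fun x hx => ?_) hnull
  rw [Set.mem_compl_iff, Set.mem_ofPred_eq] at hx
  push Not at hx
  exact hx

/-- The factors of the bubble functions of an element: one nonnegative polynomial for each face,
vanishing on that face and, almost everywhere, on no other face. -/
theorem exists_bubble_factors (hM : M.NoCoplanarFaces) (k : ℕ) (T : M.elems) :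
    ∃ (ρ : M.faces → Poly d) (s : ℕ), 1 ≤ s ∧
      M.weakDegree k T = k - 1 + s * (M.facesOf T).card ∧
      ∀ e ∈ M.facesOf T, ρ e ∈ polyLE d s ∧ ρ e ≠ 0 ∧
        (∀ x ∈ (T : Set (Space d)), 0 ≤ ev (ρ e) x) ∧
        (∀ x ∈ (e : Set (Space d)), ev (ρ e) x = 0) ∧
        ∀ e' ∈ M.facesOf T, e' ≠ e →
          ∀ᵐ x ∂(μHE[d - 1] : Measure (Space d)).restrict (e' : Set (Space d)),
            ev (ρ e) x ≠ 0 := by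
  have hex : ∀ e : M.faces, ∃ c : ℝ, e ∈ M.facesOf T →
      IsFaceIn e (outwardNormal (T : Set (Space d)) e) c := fun e => by
    by_cases he : e ∈ M.facesOf T
    · obtain ⟨c, h⟩ := exists_isFaceIn_outwardNormal he
      exact ⟨c, fun _ => h⟩
    · exact ⟨0, fun h => absurd h he⟩
  choose c h using hex
  let L : M.faces → Poly d := fun e => affinePoly (outwardNormal (T : Set (Space d)) e) (c e)
  have hLe : ∀ e ∈ M.facesOf T, ∀ x ∈ (e : Set (Space d)), ev (L e) x = 0 := fun e he x hx => by
    rw [ev_affinePoly, (h e he).inner_eq x hx, sub_self]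
  have hLne : ∀ e ∈ M.facesOf T, ∀ e' ∈ M.facesOf T, e' ≠ e →
      ∀ᵐ x ∂(μHE[d - 1] : Measure (Space d)).restrict (e' : Set (Space d)), ev (L e) x ≠ 0 := by
    intro e he e' he' hne
    filter_upwards [ae_inner_ne hM he he' hne (h e he)] with x hx
    rw [ev_affinePoly, sub_ne_zero]
    exact hx.symm
  -- In a convex element the affine functions are already nonnegative. Otherwise they are squared,
  -- and the doubled degree `s = 2` is the reason for `2 N` in `weakDegree`.
  by_cases hT : Convex ℝ (T : Set (Space d))
  · refine ⟨L, 1, le_rfl, by simp [weakDegree, hT], fun e he => ⟨affinePoly_mem _ _,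
      affinePoly_ne_zero (h e he).norm_eq _, fun x hx => ?_, hLe e he, hLne e he⟩⟩
    rw [ev_affinePoly, sub_nonneg]
    exact inner_outwardNormal_le hT he (h e he) hx
  · refine ⟨fun e => L e ^ 2, 2, one_le_two, by simp [weakDegree, hT], fun e he => ⟨?_,
      pow_ne_zero 2 (affinePoly_ne_zero (h e he).norm_eq _), fun x _ => ?_, fun x hx => ?_,
      fun e' he' hne => ?_⟩⟩
    · change L e ^ 2 ∈ polyLE d 2
      rw [pow_two]
      exact mul_mem_polyLE (affinePoly_mem _ _) (affinePoly_mem _ _) le_rfl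
    · rw [ev_pow]
      exact sq_nonneg _
    · rw [ev_pow, hLe e he x hx, zero_pow two_ne_zero]
    · filter_upwards [hLne e he e' he' hne] with x hx
      rw [ev_pow]
      exact pow_ne_zero 2 hx

theorem prod_mem_polyLE {ι : Type*} {S : Finset ι} {ρ : ι → Poly d} {s : ℕ}
    (h : ∀ i ∈ S, ρ i ∈ polyLE d s) : ∏ i ∈ S, ρ i ∈ polyLE d (s * S.card) := by
  rw [MvPolynomial.mem_restrictTotalDegree]
  refine (MvPolynomial.totalDegree_finsetProd S ρ).trans ?_
  rw [mul_comm, ← smul_eq_mul]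
  exact Finset.sum_le_card_nsmul S _ s fun i hi =>
    (MvPolynomial.mem_restrictTotalDegree _ _ _).1 (h i hi)

/-- A bubble function of an element, vanishing on its boundary. -/
theorem exists_interior_bubble (hM : M.NoCoplanarFaces) (k : ℕ) (T : M.elems) :
    ∃ β : Poly d, β ≠ 0 ∧ (∀ x ∈ (T : Set (Space d)), 0 ≤ ev β x) ∧
      (∀ e ∈ M.facesOf T, ∀ x ∈ (e : Set (Space d)), ev β x = 0) ∧
      ∀ p ∈ polyLE d (k - 1), β * p ∈ polyLE d (M.weakDegree k T) := by
  obtain ⟨ρ, s, -, hdeg, hρ⟩ := exists_bubble_factors hM k T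
  refine ⟨∏ e ∈ M.facesOf T, ρ e, Finset.prod_ne_zero_iff.2 fun e he => (hρ e he).2.1,
    fun x hx => ?_, fun e he x hx => ?_, fun p hp => ?_⟩
  · rw [ev_prod]
    exact Finset.prod_nonneg fun e he => (hρ e he).2.2.1 x hx
  · rw [ev_prod]
    exact Finset.prod_eq_zero he ((hρ e he).2.2.2.1 x hx)
  · exact mul_mem_polyLE (prod_mem_polyLE fun e he => (hρ e he).1) hp (by rw [hdeg]; omega)

open Classical in
/-- A bubble function of a face of an element, vanishing on the other faces. -/
theorem exists_face_bubble (hM : M.NoCoplanarFaces) (hk : 1 ≤ k) (he : e ∈ M.facesOf T) :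
    ∃ β : Poly d, (∀ x ∈ (T : Set (Space d)), 0 ≤ ev β x) ∧
      (∀ e' ∈ M.facesOf T, e' ≠ e → ∀ x ∈ (e' : Set (Space d)), ev β x = 0) ∧
      (∀ᵐ x ∂(μHE[d - 1] : Measure (Space d)).restrict (e : Set (Space d)), ev β x ≠ 0) ∧
      ∀ p ∈ polyLE d k, β * p ∈ polyLE d (M.weakDegree k T) := by
  obtain ⟨ρ, s, hs, hdeg, hρ⟩ := exists_bubble_factors hM k T
  have hmem : ∀ e' ∈ (M.facesOf T).erase e, e' ∈ M.facesOf T := fun e' h =>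
    Finset.mem_of_mem_erase h
  refine ⟨∏ e' ∈ (M.facesOf T).erase e, ρ e', fun x hx => ?_, fun e' he' hne x hx => ?_, ?_,
    fun p hp => ?_⟩
  · rw [ev_prod]
    exact Finset.prod_nonneg fun e' he' => (hρ e' (hmem e' he')).2.2.1 x hx
  · rw [ev_prod]
    exact Finset.prod_eq_zero (Finset.mem_erase.2 ⟨hne, he'⟩) ((hρ e' he').2.2.2.1 x hx)
  · have hall : ∀ᵐ x ∂(μHE[d - 1] : Measure (Space d)).restrict (e : Set (Space d)),
        ∀ e' : M.faces, e' ∈ (M.facesOf T).erase e → ev (ρ e') x ≠ 0 := by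
      rw [ae_all_iff]
      intro e'
      by_cases h' : e' ∈ (M.facesOf T).erase e
      · filter_upwards [(hρ e' (hmem e' h')).2.2.2.2 e he (Finset.ne_of_mem_erase h').symm]
          with x hx _ using hx
      · exact Filter.Eventually.of_forall fun x h => absurd h h'
    filter_upwards [hall] with x hx
    rw [ev_prod]
    exact Finset.prod_ne_zero_iff.2 hx
  -- Omitting the factor of `e` frees the degree `s ≥ 1`, which pays for a cofactor of degree `k`
  -- instead of `k - 1`.
  · refine mul_mem_polyLE (prod_mem_polyLE fun e' he' => (hρ e' (hmem e' he')).1) hp ?_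
    have hcard := Finset.card_erase_add_one he
    rw [hdeg, ← hcard, mul_add, mul_one]
    omega

/-- The integrand vanishes almost everywhere, by continuity on the whole nonempty interior of `T`,
and so identically. -/
theorem eq_zero_of_elemIntegral_eq_zero {f : Poly d} (hf : ∀ x ∈ (T : Set (Space d)), 0 ≤ ev f x)
    (h : elemIntegral T f = 0) : f = 0 := by
  have h1 := (setIntegral_eq_zero_iff_of_nonneg_ae
    (ae_restrict_of_forall_mem (isCompact_elem T).measurableSet hf)
    (integrableOn_elem T (continuous_ev f))).1 h
  have h2 : ∀ᵐ x ∂volume.restrict (interior (T : Set (Space d))), ev f x = (0 : Space d → ℝ) x :=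
    ae_restrict_of_ae_restrict_of_subset interior_subset h1
  have h3 : Set.EqOn (ev f) 0 (interior (T : Set (Space d))) :=
    Measure.eqOn_open_of_ae_eq h2 isOpen_interior (continuous_ev f).continuousOn
      continuousOn_const
  exact eq_zero_of_ev_eq_zero_on (U := interior (T : Set (Space d)))
    (by rw [interior_interior]; exact interior_elem_nonempty T) h3

/-- A continuous function that vanishes almost everywhere on a face vanishes on it. -/
theorem eq_zero_on_face_of_ae {F : Space d → ℝ} (hF : Continuous F)
    (h : ∀ᵐ x ∂(μHE[d - 1] : Measure (Space d)).restrict (e : Set (Space d)), F x = 0) :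
    ∀ x ∈ (e : Set (Space d)), F x = 0 := by
  obtain ⟨n, c, hn⟩ := (M.isFace e e.2).exists_isFaceIn
  have hG : Continuous fun y : Perp n => F ((y : Space d) + c • n) := by fun_prop
  rw [hn.restrict_eq_map_chart, (measurableEmbedding_chart n c).ae_map_iff] at h
  have h2 : Set.EqOn (fun y : Perp n => F ((y : Space d) + c • n)) 0
      (interior {y : Perp n | (y : Space d) + c • n ∈ (e : Set (Space d))}) :=
    Measure.eqOn_open_of_ae_eq (ae_restrict_of_ae_restrict_of_subset interior_subset h)
      isOpen_interior hG.continuousOn continuousOn_const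
  have h3 : intrinsicInterior ℝ (e : Set (Space d)) ⊆ {x | F x = 0} := fun x hx => by
    obtain ⟨y, rfl⟩ := hn.exists_chart_eq (hn.inner_eq x (intrinsicInterior_subset hx))
    exact h2 (hn.chart_mem_intrinsicInterior_iff.1 hx)
  have h4 := closure_minimal h3 (isClosed_eq hF continuous_const)
  rw [hn.isFace.closure_interior] at h4
  exact h4

theorem ae_eq_zero_of_polyFaceIntegral_eq_zero {f : Poly d}
    (hf : ∀ x ∈ (e : Set (Space d)), 0 ≤ ev f x) (h : polyFaceIntegral e f = 0) :
    ∀ᵐ x ∂(μHE[d - 1] : Measure (Space d)).restrict (e : Set (Space d)), ev f x = 0 :=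
  (setIntegral_eq_zero_iff_of_nonneg_ae
    (ae_restrict_of_forall_mem (isClosed_face e).measurableSet hf)
    (integrable_face e (continuous_ev f))).1 h

theorem polyFaceIntegral_eq_zero {f : Poly d} (hf : ∀ x ∈ (e : Set (Space d)), ev f x = 0) :
    polyFaceIntegral e f = 0 := by
  rw [polyFaceIntegral_apply]
  exact setIntegral_eq_zero_of_forall_eq_zero hf

/-- The right-hand side `-(p, ∇·w)_T + ⟨b, w·n⟩_{∂T}` of the definition of the weak gradient. -/
noncomputable def weakForm (T : M.elems) (p : Poly d) (b : M.faces → Poly d) (w : Fin d → Poly d) :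
    ℝ :=
  -elemIntegral T (p * ∑ i, MvPolynomial.pderiv i (w i)) +
    ∑ e ∈ M.facesOf T,
      polyFaceIntegral e (b e * ∑ i, outwardNormal (T : Set (Space d)) e i • w i)

/-- Interior test fields do not see the face data: integrating by parts back leaves only the
gradient of `p`. -/
theorem weakForm_of_vanishing {w : Fin d → Poly d}
    (hw : ∀ e ∈ M.facesOf T, ∀ x ∈ (e : Set (Space d)), ∀ i, ev (w i) x = 0) (p : Poly d)
    (b : M.faces → Poly d) :
    weakForm T p b w = elemIntegral T (∑ i, MvPolynomial.pderiv i p * w i) := by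
  rw [weakForm, elemIntegral_mul_div_of_vanishing hw, neg_neg, add_eq_left]
  refine Finset.sum_eq_zero fun e he => polyFaceIntegral_eq_zero fun x hx => ?_
  simp [hw e he x hx]

/-- A test field living on one face isolates the mismatch between face and interior values there. -/
theorem weakForm_of_vanishing_off_face (he : e ∈ M.facesOf T) {w : Fin d → Poly d}
    (hw : ∀ e' ∈ M.facesOf T, e' ≠ e → ∀ x ∈ (e' : Set (Space d)), ∀ i, ev (w i) x = 0)
    (p : Poly d) (b : M.faces → Poly d) :
    weakForm T p b w = elemIntegral T (∑ i, MvPolynomial.pderiv i p * w i) +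
      polyFaceIntegral e ((b e - p) * ∑ i, outwardNormal (T : Set (Space d)) e i • w i) := by
  rw [weakForm, elemIntegral_mul_div he hw, Finset.sum_eq_single_of_mem e he, sub_mul, map_sub]
  · ring
  · intro e' he' hne
    refine polyFaceIntegral_eq_zero fun x hx => ?_
    simp [hw e' he' hne x hx]

theorem sum_outwardNormal_sq (he : e ∈ M.facesOf T) :
    ∑ i, outwardNormal (T : Set (Space d)) e i * outwardNormal (T : Set (Space d)) e i = 1 := by
  have h := real_inner_self_eq_norm_sq (outwardNormal (T : Set (Space d)) e)
  rw [(isOutwardNormal_outwardNormal he).1, PiLp.inner_apply] at h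
  simpa [sq] using h

/-- If the weak gradient vanishes on an element, then the interior function is constant and agrees
with the boundary function. -/
theorem weakForm_kernel (hM : M.NoCoplanarFaces) (hk : 1 ≤ k) {p : Poly d} {b : M.faces → Poly d}
    (hp : p ∈ polyLE d k) (hb : ∀ e, b e ∈ polyLE d k)
    (h : ∀ w : Fin d → Poly d, (∀ i, w i ∈ polyLE d (M.weakDegree k T)) → weakForm T p b w = 0) :
    (∀ i, MvPolynomial.pderiv i p = 0) ∧
      ∀ e ∈ M.facesOf T, ∀ x ∈ (e : Set (Space d)), ev (b e) x = ev p x := by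
  have hgrad : ∀ i, MvPolynomial.pderiv i p = 0 := by
    obtain ⟨β, hβ0, hβT, hβe, hβdeg⟩ := exists_interior_bubble hM k T
    -- The test field `β ∇p` turns the hypothesis into `∫ β |∇p|² = 0`.
    have h1 := h (fun i => β * MvPolynomial.pderiv i p) fun i => hβdeg _ (pderiv_mem_polyLE hp i)
    rw [weakForm_of_vanishing fun e he x hx i => by rw [ev_mul, hβe e he x hx, zero_mul]] at h1
    have h2 : ∑ i, MvPolynomial.pderiv i p * (β * MvPolynomial.pderiv i p) =
        β * ∑ i, MvPolynomial.pderiv i p ^ 2 := by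
      rw [Finset.mul_sum]
      exact Finset.sum_congr rfl fun i _ => by ring
    rw [h2] at h1
    have h3 := eq_zero_of_elemIntegral_eq_zero (fun x hx => by
      rw [ev_mul, ev_sum]
      refine mul_nonneg (hβT x hx) (Finset.sum_nonneg fun i _ => ?_)
      rw [ev_pow]
      exact sq_nonneg _) h1
    exact fun i => eq_zero_of_sum_sq_eq_zero ((mul_eq_zero.1 h3).resolve_left hβ0) i
      (Finset.mem_univ i)
  refine ⟨hgrad, fun e he => ?_⟩
  obtain ⟨β, hβT, hβe, hβne, hβdeg⟩ := exists_face_bubble hM hk he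
  -- The test field `β (b - p) n`: since `|n| = 1`, its flux term is `∫_e β (b - p)²`.
  have h1 := h (fun i => β * (outwardNormal (T : Set (Space d)) e i • (b e - p))) fun i =>
    hβdeg _ (Submodule.smul_mem _ _ (sub_mem (hb e) hp))
  rw [weakForm_of_vanishing_off_face he fun e' he' hne x hx i => by
    rw [ev_mul, hβe e' he' hne x hx, zero_mul]] at h1
  have h2 : (b e - p) * ∑ i, outwardNormal (T : Set (Space d)) e i •
      (β * (outwardNormal (T : Set (Space d)) e i • (b e - p))) = β * (b e - p) ^ 2 := by
    have h4 : ∀ i, outwardNormal (T : Set (Space d)) e i •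
        (β * (outwardNormal (T : Set (Space d)) e i • (b e - p))) =
        (outwardNormal (T : Set (Space d)) e i * outwardNormal (T : Set (Space d)) e i) •
          (β * (b e - p)) := fun i => by
      rw [mul_smul_comm, smul_smul]
    simp only [h4, ← Finset.sum_smul, sum_outwardNormal_sq he, one_smul]
    ring
  simp only [hgrad, zero_mul, Finset.sum_const_zero, map_zero, zero_add, h2] at h1
  have h3 := ae_eq_zero_of_polyFaceIntegral_eq_zero (fun x hx => by
    rw [ev_mul, ev_pow]
    exact mul_nonneg (hβT x (face_subset_elem he hx)) (sq_nonneg _)) h1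
  have h4 := eq_zero_on_face_of_ae (e := e) (continuous_ev (b e - p)) (by
    filter_upwards [h3, hβne] with x hx hx'
    rw [ev_mul, ev_pow] at hx
    exact pow_eq_zero_iff two_ne_zero |>.1 ((mul_eq_zero.1 hx).resolve_left hx'))
  intro x hx
  have := h4 x hx
  rwa [ev_sub, sub_eq_zero] at this

/-- A symmetric test matrix sees only the symmetric part, which is why a vanishing strain may be
tested with symmetric `φ` only. -/
theorem two_mul_sum_mul_symm {R : Type*} [CommRing R] (G φ : Fin d → Fin d → R)
    (hφ : ∀ i j, φ i j = φ j i) :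
    2 * ∑ i, ∑ j, G i j * φ i j = ∑ i, ∑ j, (G i j + G j i) * φ i j := by
  have h : ∑ i, ∑ j, G j i * φ i j = ∑ i, ∑ j, G i j * φ i j := by
    rw [Finset.sum_comm]
    exact Finset.sum_congr rfl fun i _ => Finset.sum_congr rfl fun j _ => by rw [hφ j i]
  simp only [add_mul, Finset.sum_add_distrib, h]
  ring

/-- If the weak strain vanishes on an element, then the interior field has vanishing strain and
agrees with the boundary field. -/
theorem weakForm_kernel_symm (hM : M.NoCoplanarFaces) (hk : 1 ≤ k) {p : Fin d → Poly d}
    {b : Fin d → M.faces → Poly d} (hp : ∀ i, p i ∈ polyLE d k) (hb : ∀ i e, b i e ∈ polyLE d k)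
    (h : ∀ φ : Fin d → Fin d → Poly d, (∀ i j, φ i j ∈ polyLE d (M.weakDegree k T)) →
      (∀ i j, φ i j = φ j i) → ∑ i, weakForm T (p i) (b i) (φ i) = 0) :
    (∀ i j, MvPolynomial.pderiv j (p i) + MvPolynomial.pderiv i (p j) = 0) ∧
      ∀ e ∈ M.facesOf T, ∀ x ∈ (e : Set (Space d)), ∀ i, ev (b i e) x = ev (p i) x := by
  have hstrain : ∀ i j, MvPolynomial.pderiv j (p i) + MvPolynomial.pderiv i (p j) = 0 := by
    obtain ⟨β, hβ0, hβT, hβe, hβdeg⟩ := exists_interior_bubble hM k T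
    set S : Fin d → Fin d → Poly d := fun i j =>
      MvPolynomial.pderiv j (p i) + MvPolynomial.pderiv i (p j) with hS
    have hsym : ∀ i j, β * S i j = β * S j i := fun i j => by rw [hS]; ring
    have h1 := h (fun i j => β * S i j) (fun i j => hβdeg _
      (add_mem (pderiv_mem_polyLE (hp i) j) (pderiv_mem_polyLE (hp j) i))) hsym
    have hform : ∀ i, weakForm T (p i) (b i) (fun j => β * S i j) =
        elemIntegral T (∑ j, MvPolynomial.pderiv j (p i) * (β * S i j)) := fun i =>
      weakForm_of_vanishing (fun e he x hx j => by rw [ev_mul, hβe e he x hx, zero_mul]) _ _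
    simp only [hform, ← map_sum] at h1
    have h2 : elemIntegral T (β * ∑ ij : Fin d × Fin d, S ij.1 ij.2 ^ 2) = 0 := by
      have h3 := two_mul_sum_mul_symm (fun i j => MvPolynomial.pderiv j (p i)) _ hsym
      have h4 : β * ∑ ij : Fin d × Fin d, S ij.1 ij.2 ^ 2 = (2 : ℝ) •
          ∑ i, ∑ j, MvPolynomial.pderiv j (p i) * (β * S i j) := by
        rw [MvPolynomial.smul_eq_C_mul, map_ofNat, h3, Fintype.sum_prod_type]
        simp only [Finset.mul_sum]
        exact Finset.sum_congr rfl fun i _ => Finset.sum_congr rfl fun j _ => by rw [hS]; ring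
      rw [h4, map_smul, h1, smul_zero]
    have h5 := eq_zero_of_elemIntegral_eq_zero (fun x hx => by
      rw [ev_mul, ev_sum]
      refine mul_nonneg (hβT x hx) (Finset.sum_nonneg fun i _ => ?_)
      rw [ev_pow]
      exact sq_nonneg _) h2
    exact fun i j => eq_zero_of_sum_sq_eq_zero ((mul_eq_zero.1 h5).resolve_left hβ0) (i, j)
      (Finset.mem_univ _)
  refine ⟨hstrain, fun e he => ?_⟩
  obtain ⟨β, hβT, hβe, hβne, hβdeg⟩ := exists_face_bubble hM hk he
  set n := outwardNormal (T : Set (Space d)) e with hn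
  set a : Fin d → Poly d := fun i => b i e - p i with ha
  have hamem : ∀ i, a i ∈ polyLE d k := fun i => sub_mem (hb i e) (hp i)
  set σ : Poly d := ∑ j, n j • a j with hσ
  have hσmem : σ ∈ polyLE d k := sum_mem fun j _ => Submodule.smul_mem _ _ (hamem j)
  -- The matrix `β a ⊗ n` would not be symmetric. Adding its transpose and subtracting `(a·n) β n ⊗
  -- n` makes it so while keeping `φ n = β a`.
  set φ : Fin d → Fin d → Poly d := fun i j =>
    β * (n j • a i + n i • a j - (n i * n j) • σ) with hφ
  have hsym : ∀ i j, φ i j = φ j i := fun i j => by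
    simp only [hφ, mul_comm (n i) (n j), add_comm (n j • a i)]
  have h1 := h φ (fun i j => hβdeg _ (sub_mem (add_mem (Submodule.smul_mem _ _ (hamem i))
    (Submodule.smul_mem _ _ (hamem j))) (Submodule.smul_mem _ _ hσmem))) hsym
  have hform : ∀ i, weakForm T (p i) (b i) (φ i) =
      elemIntegral T (∑ j, MvPolynomial.pderiv j (p i) * φ i j) +
        polyFaceIntegral e ((b i e - p i) * ∑ j, n j • φ i j) := fun i =>
    weakForm_of_vanishing_off_face he
      (fun e' he' hne x hx j => by rw [hφ, ev_mul, hβe e' he' hne x hx, zero_mul]) _ _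
  simp only [hform, Finset.sum_add_distrib, ← map_sum] at h1
  have h2 : ∑ i, ∑ j, MvPolynomial.pderiv j (p i) * φ i j = 0 := by
    have h3 := two_mul_sum_mul_symm (fun i j => MvPolynomial.pderiv j (p i)) _ hsym
    simp only [hstrain, zero_mul, Finset.sum_const_zero] at h3
    exact (mul_eq_zero.1 h3).resolve_left two_ne_zero
  have h3 : ∀ i, ∑ j, n j • φ i j = β * a i := fun i => by
    have hnn : ∑ j, n j * n j = 1 := sum_outwardNormal_sq he
    have h4 : ∀ j, n j • φ i j =
        (n j * n j) • (β * a i) + n i • (β * (n j • a j)) - (n j * n j) • (n i • (β * σ)) := by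
      intro j
      simp only [hφ, MvPolynomial.smul_eq_C_mul, map_mul]
      ring
    simp only [h4, Finset.sum_sub_distrib, Finset.sum_add_distrib, ← Finset.sum_smul, hnn,
      ← Finset.smul_sum, ← Finset.mul_sum, ← hσ, one_smul]
    ring
  rw [h2, map_zero, zero_add] at h1
  have h4 : ∑ i, (b i e - p i) * ∑ j, n j • φ i j = β * ∑ i, a i ^ 2 := by
    simp only [h3, Finset.mul_sum]
    exact Finset.sum_congr rfl fun i _ => by rw [ha]; ring
  rw [h4] at h1
  have h5 := ae_eq_zero_of_polyFaceIntegral_eq_zero (fun x hx => by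
    rw [ev_mul, ev_sum]
    refine mul_nonneg (hβT x (face_subset_elem he hx)) (Finset.sum_nonneg fun i _ => ?_)
    rw [ev_pow]
    exact sq_nonneg _) h1
  intro x hx i
  have h6 := eq_zero_on_face_of_ae (e := e) (continuous_ev (a i)) (by
    filter_upwards [h5, hβne] with x hx hx'
    rw [ev_mul, ev_sum] at hx
    simp only [ev_pow] at hx
    have := (Finset.sum_eq_zero_iff_of_nonneg fun i _ => sq_nonneg (ev (a i) x)).1
      ((mul_eq_zero.1 hx).resolve_left hx') i (Finset.mem_univ i)
    exact pow_eq_zero_iff two_ne_zero |>.1 this) x hx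
  rwa [ha, ev_sub, sub_eq_zero] at h6

/-- An infinitesimal rigid motion that vanishes on a part of a face of positive measure is zero. -/
theorem eq_zero_of_strain_eq_zero {w : Fin d → Poly d}
    (hw : ∀ i j, MvPolynomial.pderiv j (w i) + MvPolynomial.pderiv i (w j) = 0)
    {Z : Set (Space d)} (hZe : Z ⊆ (e : Set (Space d)))
    (hZ : 0 < (μHE[d - 1] : Measure (Space d)) Z) (h0 : ∀ x ∈ Z, ∀ i, ev (w i) x = 0) : w = 0 := by
  obtain ⟨A, b, hA, hev⟩ := exists_skew_of_strain_eq_zero hw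
  obtain ⟨n, c, h⟩ := (M.isFace e e.2).exists_isFaceIn
  -- If row `i` of `A` were not normal to the face, the `i`-th component would vanish only on a null
  -- subset of it.
  have hrow : ∀ i, ∃ α : ℝ, (WithLp.toLp 2 (A i) : Space d) = α • n := by
    intro i
    by_contra! hne
    refine hZ.ne' (measure_mono_null ?_ (h.measure_inter_hyperplane hne (-b i)))
    intro x hx
    refine ⟨hZe hx, ?_⟩
    have h1 := h0 x hx i
    rw [hev] at h1
    have h2 : inner ℝ (WithLp.toLp 2 (A i) : Space d) x = ∑ j, A i j * x j := by
      simp [PiLp.inner_apply, mul_comm]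
    rw [h2]
    linarith
  choose α hα using hrow
  have hAα : ∀ i j, A i j = α i * n j := fun i j => by
    have := congrArg (fun z : Space d => z j) (hα i)
    simpa using this
  have hnn : ∑ j, n j * n j = 1 := by
    have h1 := real_inner_self_eq_norm_sq n
    rw [h.norm_eq, PiLp.inner_apply] at h1
    simpa [sq] using h1
  -- Now `A = α nᵀ`. Applying skewness to `n` gives `α = -κ n`, and pairing this with `n` gives `κ =
  -- -κ`; so `A = 0`.
  set κ := ∑ j, α j * n j with hκ
  have hακ : ∀ i, α i = -κ * n i := fun i => by
    have h1 : ∀ j, α i * (n j * n j) = -(n i * (α j * n j)) := fun j => by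
      have := hA i j
      rw [hAα, hAα] at this
      linear_combination n j * this
    have h2 : ∑ j, α i * (n j * n j) = ∑ j, -(n i * (α j * n j)) :=
      Finset.sum_congr rfl fun j _ => h1 j
    rw [← Finset.mul_sum, hnn, Finset.sum_neg_distrib, ← Finset.mul_sum, ← hκ] at h2
    linarith
  have hκ0 : κ = 0 := by
    have h1 : κ = ∑ j, -κ * (n j * n j) := by
      rw [hκ]
      refine Finset.sum_congr rfl fun j _ => ?_
      rw [hακ j]
      ring
    rw [← Finset.mul_sum, hnn] at h1
    linarith
  have hA0 : ∀ i j, A i j = 0 := fun i j => by rw [hAα, hακ, hκ0]; ring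
  obtain ⟨x, hx⟩ := nonempty_of_measure_ne_zero hZ.ne'
  funext i
  refine eq_of_ev_eq fun y => ?_
  have h1 := h0 x hx i
  rw [hev] at h1
  rw [hev]
  simp only [hA0, zero_mul, Finset.sum_const_zero, add_zero] at h1 ⊢
  rw [h1]
  simp

end PolytopalMesh

/-- In finite dimension a positive definite bilinear form represents every linear functional. -/
theorem exists_riesz_representative {X : Type*} [AddCommGroup X] [Module ℝ X]
    [FiniteDimensional ℝ X] (B : X →ₗ[ℝ] X →ₗ[ℝ] ℝ) (hB : ∀ x, B x x = 0 → x = 0)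
    (l : X →ₗ[ℝ] ℝ) : ∃ x, ∀ y, B x y = l y := by
  have hinj : Function.Injective B := by
    rw [← LinearMap.ker_eq_bot, LinearMap.ker_eq_bot']
    exact fun x hx => hB x (by rw [hx, LinearMap.zero_apply])
  have hsurj := (LinearMap.injective_iff_surjective_of_finrank_eq_finrank
    (Subspace.dual_finrank_eq (K := ℝ) (V := X)).symm (f := (B : X →ₗ[ℝ] Module.Dual ℝ X))).1 hinj
  obtain ⟨x, hx⟩ := hsurj l
  exact ⟨x, fun y => by rw [hx]⟩

/-! ### Existence, uniqueness and linearity of the weak operators -/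

namespace PolytopalMesh

variable {d : ℕ} {Ω : Set (Space d)} {M : PolytopalMesh d Ω} {T : M.elems} {r k : ℕ}

/-- `weakForm` as a linear functional of the test field. -/
noncomputable def weakFormₗ (T : M.elems) (p : Poly d) (b : M.faces → Poly d) :
    (Fin d → Poly d) →ₗ[ℝ] ℝ where
  toFun := weakForm T p b
  map_add' w w' := by
    simp only [weakForm, Pi.add_apply, map_add, Finset.sum_add_distrib, mul_add, smul_add]
    ring
  map_smul' c w := by
    simp only [weakForm, Pi.smul_apply, Derivation.map_smul, map_smul, ← Finset.smul_sum,
      mul_smul_comm,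
      smul_comm _ c, RingHom.id_apply, smul_add, smul_neg]

theorem weakForm_add (p p' : Poly d) (b b' : M.faces → Poly d) (w : Fin d → Poly d) :
    weakForm T (p + p') (b + b') w = weakForm T p b w + weakForm T p' b' w := by
  simp only [weakForm, add_mul, map_add, Pi.add_apply, Finset.sum_add_distrib]
  ring

theorem weakForm_smul (c : ℝ) (p : Poly d) (b : M.faces → Poly d) (w : Fin d → Poly d) :
    weakForm T (c • p) (c • b) w = c * weakForm T p b w := by
  simp only [weakForm, smul_mul_assoc, map_smul, Pi.smul_apply, smul_eq_mul, ← Finset.mul_sum]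
  ring

/-- With polynomial representatives of the face data all integrals become linear functionals on
polynomials, so no integrability questions remain. -/
theorem isWeakGrad_iff {q : M.ScalarWeak} {b : M.faces → Poly d}
    (hb : ∀ e (x : e.1), q.2 e x = ev (b e) x) {g : Fin d → Poly d} :
    M.IsWeakGrad r T q g ↔ (∀ i, g i ∈ polyLE d r) ∧ ∀ w : Fin d → Poly d,
      (∀ i, w i ∈ polyLE d r) →
        elemIntegral T (∑ i, g i * w i) = weakForm T (q.1 T) b w := by
  refine and_congr_right fun _ => forall₂_congr fun w _ => ?_
  have h : ∀ e : M.faces, faceIntegral (e : Set (Space d)) (fun x =>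
      q.2 e x * ∑ i, ev (w i) x * outwardNormal (T : Set (Space d)) e i) =
      polyFaceIntegral e (b e * ∑ i, outwardNormal (T : Set (Space d)) e i • w i) := fun e => by
    rw [← faceIntegral_ev]
    congr 1
    funext x
    simp [hb, mul_comm]
  simp only [h, weakForm, elemIntegral_apply, ev_sum, ev_mul]

/-- Testing with `g - g'` gives a vanishing sum of squares. The free index type covers scalars,
vectors and matrices at once. -/
theorem eq_of_forall_elemIntegral {ι : Type*} [Fintype ι] {g g' : ι → Poly d}
    (hg : ∀ i, g i ∈ polyLE d r) (hg' : ∀ i, g' i ∈ polyLE d r)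
    (h : ∀ w : ι → Poly d, (∀ i, w i ∈ polyLE d r) →
      elemIntegral T (∑ i, g i * w i) = elemIntegral T (∑ i, g' i * w i)) : g = g' := by
  have h1 := h (g - g') fun i => sub_mem (hg i) (hg' i)
  rw [← sub_eq_zero, ← map_sub, ← Finset.sum_sub_distrib] at h1
  have h2 : ∑ i, (g i * (g - g') i - g' i * (g - g') i) = ∑ i, (g i - g' i) ^ 2 :=
    Finset.sum_congr rfl fun i _ => by rw [Pi.sub_apply]; ring
  rw [h2] at h1
  have h3 := eq_zero_of_elemIntegral_eq_zero (fun x _ => by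
    rw [ev_sum]
    refine Finset.sum_nonneg fun i _ => ?_
    rw [ev_pow]
    exact sq_nonneg _) h1
  funext i
  exact sub_eq_zero.1 (eq_zero_of_sum_sq_eq_zero h3 i (Finset.mem_univ i))

theorem exists_isWeakGrad {q : M.ScalarWeak} {b : M.faces → Poly d}
    (hb : ∀ e (x : e.1), q.2 e x = ev (b e) x) : ∃ g, M.IsWeakGrad r T q g := by
  let coeX : (Fin d → polyLE d r) →ₗ[ℝ] (Fin d → Poly d) :=
    LinearMap.pi fun i => (polyLE d r).subtype ∘ₗ LinearMap.proj i
  -- The `L²` product over `T`, definite on polynomial fields because `T` has interior points.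
  let B : (Fin d → polyLE d r) →ₗ[ℝ] (Fin d → polyLE d r) →ₗ[ℝ] ℝ := LinearMap.mk₂ ℝ
    (fun g w => elemIntegral T (∑ i, (g i : Poly d) * (w i : Poly d)))
    (fun g g' w => by simp [add_mul, Finset.sum_add_distrib])
    (fun c g w => by simp [Finset.mul_sum])
    (fun g w w' => by simp [mul_add, Finset.sum_add_distrib])
    (fun c g w => by simp [Finset.mul_sum])
  obtain ⟨g, hg⟩ := exists_riesz_representative B (fun g hg => by
    have h1 : (fun i => (g i : Poly d)) = fun _ => 0 := by
      have h2 := eq_zero_of_elemIntegral_eq_zero (T := T)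
        (f := ∑ i, (g i : Poly d) * (g i : Poly d)) (fun x _ => by
          rw [ev_sum]
          refine Finset.sum_nonneg fun i _ => ?_
          rw [ev_mul]
          exact mul_self_nonneg _) hg
      simp only [← sq] at h2
      funext i
      exact eq_zero_of_sum_sq_eq_zero h2 i (Finset.mem_univ i)
    funext i
    exact Subtype.ext (congrFun h1 i)) (weakFormₗ T (q.1 T) b ∘ₗ coeX)
  refine ⟨fun i => g i, (isWeakGrad_iff hb).2 ⟨fun i => (g i).2, fun w hw => ?_⟩⟩
  exact hg fun i => ⟨w i, hw i⟩

theorem exists_face_polys {q : M.ScalarWeak} (hq : q ∈ M.Wh k) :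
    ∃ b : M.faces → Poly d, (∀ e, b e ∈ polyLE d k) ∧ ∀ e (x : e.1), q.2 e x = ev (b e) x := by
  choose b hb hb' using fun e : M.faces => exists_of_mem_facePoly (hq.2 e trivial)
  exact ⟨b, hb, hb'⟩

theorem isWeakGrad_weakGrad {q : M.ScalarWeak} (hq : q ∈ M.Wh k) :
    M.IsWeakGrad r T q (M.weakGrad r T q) := by
  obtain ⟨b, -, hb⟩ := exists_face_polys hq
  exact Classical.epsilon_spec (exists_isWeakGrad hb)

theorem IsWeakGrad.unique {q : M.ScalarWeak} (hq : q ∈ M.Wh k) {g g' : Fin d → Poly d}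
    (h : M.IsWeakGrad r T q g) (h' : M.IsWeakGrad r T q g') : g = g' := by
  obtain ⟨b, -, hb⟩ := exists_face_polys hq
  rw [isWeakGrad_iff hb] at h h'
  exact eq_of_forall_elemIntegral h.1 h'.1 fun w hw => by rw [h.2 w hw, h'.2 w hw]

theorem weakGrad_add {q q' : M.ScalarWeak} (hq : q ∈ M.Wh k) (hq' : q' ∈ M.Wh k) :
    M.weakGrad r T (q + q') = M.weakGrad r T q + M.weakGrad r T q' := by
  obtain ⟨b, -, hb⟩ := exists_face_polys hq
  obtain ⟨b', -, hb'⟩ := exists_face_polys hq'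
  have h := (isWeakGrad_iff hb).1 (isWeakGrad_weakGrad (r := r) (T := T) hq)
  have h' := (isWeakGrad_iff hb').1 (isWeakGrad_weakGrad (r := r) (T := T) hq')
  refine (isWeakGrad_weakGrad (add_mem hq hq')).unique (add_mem hq hq')
    ((isWeakGrad_iff (b := b + b') fun e x => by simp [hb, hb']).2
      ⟨fun i => add_mem (h.1 i) (h'.1 i), fun w hw => ?_⟩)
  have h1 : (q + q').1 T = q.1 T + q'.1 T := rfl
  simp only [h1, weakForm_add, ← h.2 w hw, ← h'.2 w hw, Pi.add_apply, add_mul,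
    Finset.sum_add_distrib, map_add]

theorem weakGrad_smul (c : ℝ) {q : M.ScalarWeak} (hq : q ∈ M.Wh k) :
    M.weakGrad r T (c • q) = c • M.weakGrad r T q := by
  obtain ⟨b, -, hb⟩ := exists_face_polys hq
  have h := (isWeakGrad_iff hb).1 (isWeakGrad_weakGrad (r := r) (T := T) hq)
  refine (isWeakGrad_weakGrad (Submodule.smul_mem _ c hq)).unique (Submodule.smul_mem _ c hq)
    ((isWeakGrad_iff (b := c • b) fun e x => by simp [hb]).2
      ⟨fun i => Submodule.smul_mem _ c (h.1 i), fun w hw => ?_⟩)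
  have h1 : (c • q).1 T = c • q.1 T := rfl
  simp only [h1, weakForm_smul, ← h.2 w hw, Pi.smul_apply, smul_mul_assoc, ← Finset.smul_sum,
    map_smul, smul_eq_mul]

/-- The `i`-th component of a vector weak function. -/
def component (i : Fin d) : M.VectorWeak →ₗ[ℝ] M.ScalarWeak where
  toFun v := (fun T => v.1 T i, fun e => v.2 e i)
  map_add' _ _ := rfl
  map_smul' _ _ := rfl

theorem component_mem {v : M.VectorWeak} (hv : v ∈ M.Vh k) (i : Fin d) :
    component i v ∈ M.Wh k :=
  ⟨fun T _ => hv.1 T trivial i trivial, fun e _ => hv.2 e trivial i trivial⟩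

theorem exists_face_polys_vec {v : M.VectorWeak} (hv : v ∈ M.Vh k) :
    ∃ b : Fin d → M.faces → Poly d, (∀ i e, b i e ∈ polyLE d k) ∧
      ∀ i e (x : e.1), v.2 e i x = ev (b i e) x := by
  choose b hb hb' using fun i => exists_face_polys (component_mem hv i)
  exact ⟨b, hb, hb'⟩

theorem isWeakGradVec_iff {v : M.VectorWeak} {b : Fin d → M.faces → Poly d}
    (hb : ∀ i e (x : e.1), v.2 e i x = ev (b i e) x) {G : Fin d → Fin d → Poly d} :
    M.IsWeakGradVec r T v G ↔ (∀ i j, G i j ∈ polyLE d r) ∧ ∀ φ : Fin d → Fin d → Poly d,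
      (∀ i j, φ i j ∈ polyLE d r) →
        elemIntegral T (∑ i, ∑ j, G i j * φ i j) =
          ∑ i, weakForm T (v.1 T i) (b i) (φ i) := by
  refine and_congr_right fun _ => forall₂_congr fun φ _ => ?_
  have h : ∀ e : M.faces, faceIntegral (e : Set (Space d)) (fun x =>
      ∑ i, v.2 e i x * ∑ j, ev (φ i j) x * outwardNormal (T : Set (Space d)) e j) =
      ∑ i, polyFaceIntegral e (b i e * ∑ j, outwardNormal (T : Set (Space d)) e j • φ i j) :=
    fun e => by
      rw [← map_sum, ← faceIntegral_ev]
      congr 1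
      funext x
      simp [hb, mul_comm]
  have h' : ∫ x in (T : Set (Space d)),
      ∑ i, ev (v.1 T i) x * ev (∑ j, MvPolynomial.pderiv j (φ i j)) x =
      ∑ i, elemIntegral T (v.1 T i * ∑ j, MvPolynomial.pderiv j (φ i j)) := by
    rw [← map_sum, elemIntegral_apply]
    simp only [ev_sum, ev_mul]
  have h'' : ∫ x in (T : Set (Space d)), ∑ i, ∑ j, ev (G i j) x * ev (φ i j) x =
      elemIntegral T (∑ i, ∑ j, G i j * φ i j) := by
    rw [elemIntegral_apply]
    simp only [ev_sum, ev_mul]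
  rw [h', h'']
  simp only [h, weakForm]
  rw [Finset.sum_add_distrib, Finset.sum_neg_distrib, Finset.sum_comm (s := M.facesOf T)]

theorem isWeakGradVec_components {v : M.VectorWeak} (hv : v ∈ M.Vh k) :
    M.IsWeakGradVec r T v fun i => M.weakGrad r T (component i v) := by
  obtain ⟨b, -, hb⟩ := exists_face_polys_vec hv
  have hcomp := fun i => (isWeakGrad_iff (b := b i) (q := component i v) (hb i)).1
    (isWeakGrad_weakGrad (r := r) (T := T) (component_mem hv i))
  refine (isWeakGradVec_iff hb).2 ⟨fun i j => (hcomp i).1 j, fun φ hφ => ?_⟩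
  rw [map_sum]
  exact Finset.sum_congr rfl fun i _ => (hcomp i).2 (φ i) (hφ i)

theorem isWeakGradVec_weakGradVec {v : M.VectorWeak} (hv : v ∈ M.Vh k) :
    M.IsWeakGradVec r T v (M.weakGradVec r T v) :=
  Classical.epsilon_spec ⟨_, isWeakGradVec_components hv⟩

/-- The rows of the test matrix are independent, so the definition decouples into scalar weak
gradients. Linearity of the vector operators is inherited from the scalar one. -/
theorem weakGradVec_eq {v : M.VectorWeak} (hv : v ∈ M.Vh k) :
    M.weakGradVec r T v = fun i => M.weakGrad r T (component i v) := by
  obtain ⟨b, -, hb⟩ := exists_face_polys_vec hv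
  have h := isWeakGradVec_components (r := r) (T := T) hv
  have h' := isWeakGradVec_weakGradVec (r := r) (T := T) hv
  rw [isWeakGradVec_iff hb] at h h'
  have huniq := eq_of_forall_elemIntegral (T := T) (ι := Fin d × Fin d)
    (g := fun ij => M.weakGradVec r T v ij.1 ij.2)
    (g' := fun ij => M.weakGrad r T (component ij.1 v) ij.2)
    (fun ij => h'.1 ij.1 ij.2) (fun ij => h.1 ij.1 ij.2) fun w hw => by
      have h1 := h.2 (fun i j => w (i, j)) fun i j => hw (i, j)
      have h2 := h'.2 (fun i j => w (i, j)) fun i j => hw (i, j)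
      simp only [Fintype.sum_prod_type]
      rw [h1, h2]
  funext i j
  exact congrFun huniq (i, j)

/-- The form of the weak divergence tested with `w` is the sum over `i` of these values for the
components of the field. -/
theorem weakForm_single (p : Poly d) (b : M.faces → Poly d) (i : Fin d) (w : Poly d) :
    weakForm T p b (Pi.single i w) = -elemIntegral T (p * MvPolynomial.pderiv i w) +
      ∑ e ∈ M.facesOf T,
        polyFaceIntegral e (b e * (outwardNormal (T : Set (Space d)) e i • w)) := by
  have h1 : ∑ j, MvPolynomial.pderiv j ((Pi.single i w : Fin d → Poly d) j) =
      MvPolynomial.pderiv i w := by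
    rw [Finset.sum_eq_single i (fun j _ hj => by rw [Pi.single_eq_of_ne hj, map_zero])
      (fun h => absurd (Finset.mem_univ i) h), Pi.single_eq_same]
  have h2 : ∀ e : M.faces, ∑ j, outwardNormal (T : Set (Space d)) e j •
      (Pi.single i w : Fin d → Poly d) j = outwardNormal (T : Set (Space d)) e i • w := fun e => by
    rw [Finset.sum_eq_single i (fun j _ hj => by rw [Pi.single_eq_of_ne hj, smul_zero])
      (fun h => absurd (Finset.mem_univ i) h), Pi.single_eq_same]
  simp only [weakForm, h1, h2]

/-- The weak divergence is the trace of the weak gradient. -/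
theorem weakDiv_eq {v : M.VectorWeak} (hv : v ∈ M.Vh k) :
    M.weakDiv r T v = ∑ i, M.weakGradVec r T v i i := by
  obtain ⟨b, -, hb⟩ := exists_face_polys_vec hv
  have hcomp := fun i => (isWeakGrad_iff (b := b i) (q := component i v) (hb i)).1
    (isWeakGrad_weakGrad (r := r) (T := T) (component_mem hv i))
  have hiff : ∀ g, M.IsWeakDiv r T v g ↔ g ∈ polyLE d r ∧ ∀ w ∈ polyLE d r,
      elemIntegral T (g * w) = ∑ i, weakForm T (v.1 T i) (b i) (Pi.single i w) := by
    intro g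
    refine and_congr_right fun _ => forall₂_congr fun w _ => ?_
    have h : ∀ e : M.faces, faceIntegral (e : Set (Space d)) (fun x =>
        (∑ i, v.2 e i x * outwardNormal (T : Set (Space d)) e i) * ev w x) =
        ∑ i, polyFaceIntegral e (b i e * (outwardNormal (T : Set (Space d)) e i • w)) :=
      fun e => by
        rw [← map_sum, ← faceIntegral_ev]
        congr 1
        funext x
        simp [hb, Finset.sum_mul, mul_assoc, mul_left_comm]
    have h' : ∫ x in (T : Set (Space d)), ∑ i, ev (v.1 T i) x * ev (MvPolynomial.pderiv i w) x =
        ∑ i, elemIntegral T (v.1 T i * MvPolynomial.pderiv i w) := by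
      rw [← map_sum, elemIntegral_apply]
      simp only [ev_sum, ev_mul]
    have h'' : ∫ x in (T : Set (Space d)), ev g x * ev w x = elemIntegral T (g * w) := by
      rw [elemIntegral_apply]
      simp only [ev_mul]
    rw [h', h'']
    simp only [h, weakForm_single]
    rw [Finset.sum_add_distrib, Finset.sum_neg_distrib, Finset.sum_comm (s := M.facesOf T)]
  have hdiv : M.IsWeakDiv r T v (∑ i, M.weakGradVec r T v i i) := by
    rw [hiff, weakGradVec_eq hv]
    refine ⟨sum_mem fun i _ => (hcomp i).1 i, fun w hw => ?_⟩
    rw [Finset.sum_mul, map_sum]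
    refine Finset.sum_congr rfl fun i _ => ?_
    have h1 : weakForm T (v.1 T i) (b i) (Pi.single i w) = _ :=
      ((hcomp i).2 (Pi.single i w) fun j => by
        rcases eq_or_ne j i with rfl | hj
        · rwa [Pi.single_eq_same]
        · rw [Pi.single_eq_of_ne hj]
          exact zero_mem _).symm
    rw [h1, Finset.sum_eq_single i (fun j _ hj => by rw [Pi.single_eq_of_ne hj, mul_zero])
      (fun h => absurd (Finset.mem_univ i) h), Pi.single_eq_same]
  have hspec : M.IsWeakDiv r T v (M.weakDiv r T v) := Classical.epsilon_spec ⟨_, hdiv⟩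
  rw [hiff] at hdiv hspec
  have huniq := eq_of_forall_elemIntegral (T := T) (ι := Unit)
    (g := fun _ => M.weakDiv r T v) (g' := fun _ => ∑ i, M.weakGradVec r T v i i)
    (fun _ => hspec.1) (fun _ => hdiv.1) fun w hw => by
      simp only [Finset.univ_unique, Finset.sum_singleton]
      rw [hspec.2 _ (hw _), hdiv.2 _ (hw _)]
  exact congrFun huniq ()

theorem weakGradVec_add {v v' : M.VectorWeak} (hv : v ∈ M.Vh k) (hv' : v' ∈ M.Vh k) :
    M.weakGradVec r T (v + v') = M.weakGradVec r T v + M.weakGradVec r T v' := by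
  rw [weakGradVec_eq hv, weakGradVec_eq hv', weakGradVec_eq (add_mem hv hv')]
  funext i
  rw [map_add, weakGrad_add (component_mem hv i) (component_mem hv' i)]
  rfl

theorem weakGradVec_smul (c : ℝ) {v : M.VectorWeak} (hv : v ∈ M.Vh k) :
    M.weakGradVec r T (c • v) = c • M.weakGradVec r T v := by
  rw [weakGradVec_eq hv, weakGradVec_eq (Submodule.smul_mem _ c hv)]
  funext i
  rw [map_smul, weakGrad_smul c (component_mem hv i)]
  rfl

theorem weakStrain_add {v v' : M.VectorWeak} (hv : v ∈ M.Vh k) (hv' : v' ∈ M.Vh k)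
    (i j : Fin d) :
    M.weakStrain r T (v + v') i j = M.weakStrain r T v i j + M.weakStrain r T v' i j := by
  simp only [weakStrain, weakGradVec_add hv hv', Pi.add_apply, smul_add]
  abel

theorem weakStrain_smul (c : ℝ) {v : M.VectorWeak} (hv : v ∈ M.Vh k) (i j : Fin d) :
    M.weakStrain r T (c • v) i j = c • M.weakStrain r T v i j := by
  simp only [weakStrain, weakGradVec_smul c hv, Pi.smul_apply, ← smul_add]
  rw [smul_comm]

/-- This makes the energy a function of the strain alone, so that coercivity can be checked
pointwise. -/
theorem weakDiv_eq_trace {v : M.VectorWeak} (hv : v ∈ M.Vh k) :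
    M.weakDiv r T v = ∑ i, M.weakStrain r T v i i := by
  rw [weakDiv_eq hv]
  refine Finset.sum_congr rfl fun i _ => ?_
  rw [weakStrain, ← two_smul ℝ, smul_smul]
  norm_num

end PolytopalMesh

/-- The square root of a symmetric positive definite form is a norm. -/
theorem isNorm_sqrt_form {E : Type*} [AddCommGroup E] [Module ℝ E] (B : E → E → ℝ) {f : E → ℝ}
    (hf : ∀ x, f x = Real.sqrt (B x x)) (hsymm : ∀ x y, B y x = B x y)
    (hadd : ∀ x y z, B (x + y) z = B x z + B y z) (hsmul : ∀ x y (c : ℝ), B (c • x) y = c * B x y)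
    (hnonneg : ∀ x, 0 ≤ B x x) (hdef : ∀ x, B x x = 0 → x = 0) : IsNorm f := by
  let core : InnerProductSpace.Core ℝ E :=
    { inner := B
      conj_inner_symm := fun x y => hsymm x y
      re_inner_nonneg := hnonneg
      add_left := hadd
      smul_left := fun x y c => hsmul x y c
      definite := hdef }
  let _ : NormedAddCommGroup E := core.toNormedAddCommGroup
  let _ : InnerProductSpace ℝ E := InnerProductSpace.ofCore core.toCore
  have hnorm : ∀ x : E, f x = ‖x‖ := fun x => by
    rw [hf]
    exact (norm_eq_sqrt_real_inner x).symm
  obtain rfl : f = fun x => ‖x‖ := funext hnorm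
  exact
    { norm_nonneg := fun x => norm_nonneg x
      norm_smul := fun c x => norm_smul c x
      norm_triangle := fun x y => norm_add_le x y
      norm_eq_zero_iff := fun x => norm_eq_zero }

/-! ### Positive and null sets on faces and elements -/

namespace PolytopalMesh

variable {d : ℕ} {Ω : Set (Space d)} {M : PolytopalMesh d Ω} {T : M.elems} {e : M.faces} {k : ℕ}

theorem elemIntegral_nonneg {f : Poly d} (hf : ∀ x ∈ (T : Set (Space d)), 0 ≤ ev f x) :
    0 ≤ elemIntegral T f :=
  setIntegral_nonneg (isCompact_elem T).measurableSet hf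

/-- A property that holds almost everywhere on the part `Γ` of a face holds on a set of positive
measure. -/
theorem measure_pos_of_ae_imp {Γ : Set (Space d)} {P : Space d → Prop}
    (h : ∀ᵐ x : (e : Set (Space d)) ∂((μHE[d - 1] : Measure (Space d)).comap Subtype.val),
      (x : Space d) ∈ Γ → P x)
    (hpos : 0 < (μHE[d - 1] : Measure (Space d)) ((e : Set (Space d)) ∩ Γ)) :
    0 < (μHE[d - 1] : Measure (Space d)) {x | x ∈ (e : Set (Space d)) ∧ P x} := by
  have hm := (isClosed_face e).measurableSet
  rw [← (MeasurableEmbedding.subtype_coe hm).ae_map_iff (p := fun x : Space d => x ∈ Γ → P x),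
    map_comap_subtype_coe hm, ae_restrict_iff' hm] at h
  by_contra hzero
  -- If the good set were null, two null sets would cover the part of `Γ` on the face. Only outer
  -- measure enters, so `Γ` may be nonmeasurable.
  refine hpos.ne' (measure_mono_null (fun x hx => ?_)
    (measure_union_null h (nonpos_iff_eq_zero.1 (not_lt.1 hzero))))
  by_cases hP : P x
  · exact Or.inr ⟨hx.1, hP⟩
  · exact Or.inl fun hall => hP (hall hx.1 hx.2)

/-- The conductivity is controlled only on `Ω`, while elements may contain points of its boundary;
this makes such points negligible. -/
theorem volume_frontier_elem (T : M.elems) : volume (frontier (T : Set (Space d))) = 0 := by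
  refine measure_mono_null (t := ⋃ e : M.faces, (e : Set (Space d))) (fun x hx => ?_)
    (measure_iUnion_null fun e => ?_)
  · obtain ⟨e, -, he⟩ := exists_face_of_mem_frontier hx
    exact Set.mem_iUnion.2 ⟨e, he⟩
  · obtain ⟨n, c, h⟩ := (M.isFace e e.2).exists_isFaceIn
    have hn : n ≠ 0 := fun h0 => by
      have := h.norm_eq
      rw [h0, norm_zero] at this
      exact zero_ne_one this
    exact measure_mono_null h.inner_eq (volume_hyperplane hn c)

/-- Almost every point of an element lies in the domain. -/
theorem ae_mem_domain (hΩ : interior (closure Ω) = Ω) (T : M.elems) :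
    ∀ᵐ x ∂volume.restrict (T : Set (Space d)), x ∈ Ω := by
  rw [ae_restrict_iff' (isCompact_elem T).measurableSet]
  refine measure_mono_null (fun x hx => ?_) (volume_frontier_elem T)
  rw [Set.mem_compl_iff, Set.mem_ofPred_eq] at hx
  push Not at hx
  exact ⟨subset_closure hx.1, fun hi => hx.2 (interior_elem_subset hΩ T hi)⟩

theorem integrableOn_elem_of_domain (hΩ : interior (closure Ω) = Ω) (T : M.elems)
    {f : Space d → ℝ} (hf : IntegrableOn f Ω) : IntegrableOn f (T : Set (Space d)) := by
  have h1 : IntegrableOn f (interior (T : Set (Space d))) :=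
    hf.mono_set (interior_elem_subset hΩ T)
  refine h1.congr_set_ae ?_
  exact (interior_ae_eq_of_null_frontier (volume_frontier_elem T)).symm

/-! ### The norm on the scalar space -/

section Scalar

variable {K : Space d → Matrix (Fin d) (Fin d) ℝ}

/-- `∫_T K g · h` for polynomial fields `g` and `h`. -/
noncomputable def conductivityForm (K : Space d → Matrix (Fin d) (Fin d) ℝ) (T : M.elems)
    (g h : Fin d → Poly d) : ℝ :=
  ∫ x in (T : Set (Space d)), ∑ i, ∑ j, K x i j * ev (g j) x * ev (h i) x

theorem integrableOn_conductivityForm (hΩ : interior (closure Ω) = Ω)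
    (hK : ∀ i j, IntegrableOn (fun x => K x i j) Ω) (T : M.elems) (g h : Fin d → Poly d) :
    IntegrableOn (fun x => ∑ i, ∑ j, K x i j * ev (g j) x * ev (h i) x) (T : Set (Space d)) := by
  refine integrable_finsetSum _ fun i _ => integrable_finsetSum _ fun j _ => ?_
  simp only [mul_assoc]
  exact (integrableOn_elem_of_domain hΩ T (hK i j)).mul_continuousOn
    ((continuous_ev _).mul (continuous_ev _)).continuousOn (isCompact_elem T)

theorem conductivityForm_add (hΩ : interior (closure Ω) = Ω)
    (hK : ∀ i j, IntegrableOn (fun x => K x i j) Ω) (T : M.elems) (g g' h : Fin d → Poly d) :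
    conductivityForm K T (g + g') h = conductivityForm K T g h + conductivityForm K T g' h := by
  rw [conductivityForm, conductivityForm, conductivityForm,
    ← integral_add (integrableOn_conductivityForm hΩ hK T g h)
      (integrableOn_conductivityForm hΩ hK T g' h)]
  simp only [Pi.add_apply, ev_add, mul_add, add_mul, Finset.sum_add_distrib]

theorem conductivityForm_smul (T : M.elems) (c : ℝ) (g h : Fin d → Poly d) :
    conductivityForm K T (c • g) h = c * conductivityForm K T g h := by
  rw [conductivityForm, conductivityForm, ← integral_const_mul]
  simp only [Pi.smul_apply, ev_smul, Finset.mul_sum]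
  congr 1
  funext x
  exact Finset.sum_congr rfl fun i _ => Finset.sum_congr rfl fun j _ => by ring

theorem conductivityForm_comm (hΩ : interior (closure Ω) = Ω) (hK : ∀ x ∈ Ω, (K x).PosDef)
    (T : M.elems) (g h : Fin d → Poly d) :
    conductivityForm K T h g = conductivityForm K T g h := by
  refine integral_congr_ae ?_
  filter_upwards [ae_mem_domain hΩ T] with x hx
  rw [Finset.sum_comm]
  refine Finset.sum_congr rfl fun i _ => Finset.sum_congr rfl fun j _ => ?_
  have : K x j i = K x i j := by simpa using (hK x hx).isHermitian.apply i j
  rw [this]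
  ring

theorem quadratic_eq_dotProduct (A : Matrix (Fin d) (Fin d) ℝ) (u : Fin d → ℝ) :
    ∑ i, ∑ j, A i j * u j * u i = dotProduct (star u) (A.mulVec u) := by
  simp only [dotProduct, Matrix.mulVec, Finset.mul_sum, Pi.star_apply, star_trivial]
  exact Finset.sum_congr rfl fun i _ => Finset.sum_congr rfl fun j _ => by ring

theorem ae_nonneg_conductivityForm (hΩ : interior (closure Ω) = Ω) (hK : ∀ x ∈ Ω, (K x).PosDef)
    (T : M.elems) (g : Fin d → Poly d) :
    0 ≤ᵐ[volume.restrict (T : Set (Space d))]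
      fun x => ∑ i, ∑ j, K x i j * ev (g j) x * ev (g i) x := by
  filter_upwards [ae_mem_domain hΩ T] with x hx
  rw [quadratic_eq_dotProduct (K x) fun i => ev (g i) x]
  exact (hK x hx).posSemidef.dotProduct_mulVec_nonneg _

theorem conductivityForm_self_nonneg (hΩ : interior (closure Ω) = Ω)
    (hK : ∀ x ∈ Ω, (K x).PosDef) (T : M.elems) (g : Fin d → Poly d) :
    0 ≤ conductivityForm K T g g :=
  integral_nonneg_of_ae (ae_nonneg_conductivityForm hΩ hK T g)

theorem eq_zero_of_conductivityForm_self (hΩ : interior (closure Ω) = Ω)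
    (hK_int : ∀ i j, IntegrableOn (fun x => K x i j) Ω) (hK : ∀ x ∈ Ω, (K x).PosDef)
    {T : M.elems} {g : Fin d → Poly d} (h : conductivityForm K T g g = 0) : g = 0 := by
  have h1 := (setIntegral_eq_zero_iff_of_nonneg_ae (ae_nonneg_conductivityForm hΩ hK T g)
    (integrableOn_conductivityForm hΩ hK_int T g g)).1 h
  -- Pointwise positive definiteness, with no uniform lower bound on `K`, gives `g = 0` almost
  -- everywhere on `T`.
  have h2 : elemIntegral T (∑ i, g i ^ 2) = 0 := by
    refine integral_eq_zero_of_ae ?_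
    filter_upwards [h1, ae_mem_domain hΩ T] with x hx hxΩ
    rw [quadratic_eq_dotProduct (K x) fun i => ev (g i) x] at hx
    have hzero : (fun i => ev (g i) x) = 0 := by
      by_contra hne
      exact ((hK x hxΩ).dotProduct_mulVec_pos hne).ne' hx
    simp [fun i => congrFun hzero i]
  have h3 := eq_zero_of_elemIntegral_eq_zero (fun x _ => by
    rw [ev_sum]
    refine Finset.sum_nonneg fun i _ => ?_
    rw [ev_pow]
    exact sq_nonneg _) h2
  funext i
  exact eq_zero_of_sum_sq_eq_zero h3 i (Finset.mem_univ i)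

/-- A weak function with vanishing weak gradients and vanishing boundary values on a part of the
boundary of positive measure is zero. -/
theorem eq_zero_of_weakGrad_eq_zero (hopen : IsOpen Ω) (hconn : IsConnected Ω)
    (hΩ : interior (closure Ω) = Ω) {Γ : Set (Space d)} (hΓ : Γ ⊆ frontier Ω)
    (hpos : 0 < (μHE[d - 1] : Measure (Space d)) Γ) (hM : M.NoCoplanarFaces) (hk : 1 ≤ k)
    {q : M.ScalarWeak} (hq : q ∈ M.WhZero k Γ)
    (h : ∀ T, M.weakGrad (M.weakDegree k T) T q = 0) : q = 0 := by
  obtain ⟨hqW, hqΓ⟩ := hq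
  obtain ⟨b, hb, hqb⟩ := exists_face_polys hqW
  have hker : ∀ T, (∀ i, MvPolynomial.pderiv i (q.1 T) = 0) ∧
      ∀ e ∈ M.facesOf T, ∀ x ∈ (e : Set (Space d)), ev (b e) x = ev (q.1 T) x := fun T =>
    weakForm_kernel hM hk (hqW.1 T trivial) hb fun w hw => by
      have h1 := (isWeakGrad_iff hqb).1
        (isWeakGrad_weakGrad (r := M.weakDegree k T) (T := T) hqW)
      rw [← h1.2 w hw, h T]
      simp
  have hconst : ∀ T, ∀ x, ev (q.1 T) x = ev (q.1 T) 0 := fun T x => by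
    conv_lhs => rw [eq_C_of_pderiv_eq_zero (hker T).1, ev_C]
  have hzero : ∀ T, q.1 T = 0 := by
    refine forall_elem_of_face_chain hopen hconn hΩ ?_ fun T T' e he he' hT => ?_
    -- The interior functions are constant, so one boundary point with value zero settles an
    -- element; likewise one common point carries zero to a neighbour.
    · obtain ⟨e, hepos⟩ := exists_face_measure_inter_pos (M := M) hopen hΩ hΓ hpos
      obtain ⟨T, he⟩ := exists_elem_of_face e
      obtain ⟨x, hxe, hx⟩ := nonempty_of_measure_ne_zero (measure_pos_of_ae_imp
        (P := fun x => ev (b e) x = 0)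
        (by filter_upwards [hqΓ e] with x hx hxΓ; rw [← hqb, hx hxΓ]) hepos).ne'
      refine ⟨T, eq_of_ev_eq fun y => ?_⟩
      rw [hconst T y, ← hconst T x, ← (hker T).2 e he x hxe, hx, ev_zero]
    · obtain ⟨x, hx⟩ := (M.isFace e e.2).nonempty
      refine eq_of_ev_eq fun y => ?_
      rw [hconst T' y, ← hconst T' x, ← (hker T').2 e he' x hx, (hker T).2 e he x hx, hT, ev_zero, ev_zero]
  refine Prod.ext (funext hzero) (funext fun e => funext fun x => ?_)
  obtain ⟨T, he⟩ := exists_elem_of_face e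
  rw [hqb e x, (hker T).2 e he x x.2, hzero T]
  simp

theorem isNorm_normWh (hopen : IsOpen Ω) (hconn : IsConnected Ω) (hΩ : interior (closure Ω) = Ω)
    {Γ : Set (Space d)} (hΓ : Γ ⊆ frontier Ω) (hpos : 0 < (μHE[d - 1] : Measure (Space d)) Γ)
    (hM : M.NoCoplanarFaces) (hk : 1 ≤ k) (hK_int : ∀ i j, IntegrableOn (fun x => K x i j) Ω)
    (hK : ∀ x ∈ Ω, (K x).PosDef) : IsNorm fun q : M.WhZero k Γ => M.normWh k K q := by
  refine isNorm_sqrt_form (fun q q' : M.WhZero k Γ => ∑ T : M.elems,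
    conductivityForm K T (M.weakGrad (M.weakDegree k T) T q) (M.weakGrad (M.weakDegree k T) T q'))
    (fun q => rfl) (fun q q' => ?_) (fun q q' q'' => ?_) (fun q q' c => ?_) (fun q => ?_)
    fun q hq => ?_
  · exact Finset.sum_congr rfl fun T _ => conductivityForm_comm hΩ hK T _ _
  · rw [← Finset.sum_add_distrib]
    refine Finset.sum_congr rfl fun T _ => ?_
    rw [Submodule.coe_add, weakGrad_add q.2.1 q'.2.1, conductivityForm_add hΩ hK_int]
  · rw [Finset.mul_sum]
    refine Finset.sum_congr rfl fun T _ => ?_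
    rw [Submodule.coe_smul, weakGrad_smul c q.2.1, conductivityForm_smul]
  · exact Finset.sum_nonneg fun T _ => conductivityForm_self_nonneg hΩ hK T _
  · have h := (Finset.sum_eq_zero_iff_of_nonneg fun T _ =>
      conductivityForm_self_nonneg hΩ hK T _).1 hq
    exact Subtype.ext (eq_zero_of_weakGrad_eq_zero hopen hconn hΩ hΓ hpos hM hk q.2 fun T =>
      eq_zero_of_conductivityForm_self hΩ hK_int hK (h T (Finset.mem_univ T)))

end Scalar

/-! ### The norm on the vector space -/

section Vector

variable {mu lam : ℝ}

/-- The elastic energy density is coercive. -/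
theorem exists_coercivity_const (hmu : 0 < mu) (hlam : 0 < 2 * mu + d * lam) :
    ∃ κ > 0, ∀ E : Fin d → Fin d → ℝ,
      κ * ∑ i, ∑ j, E i j ^ 2 ≤ 2 * mu * ∑ i, ∑ j, E i j ^ 2 + lam * (∑ i, E i i) ^ 2 := by
  have hS : ∀ E : Fin d → Fin d → ℝ, 0 ≤ ∑ i, ∑ j, E i j ^ 2 := fun E =>
    Finset.sum_nonneg fun i _ => Finset.sum_nonneg fun j _ => sq_nonneg _
  have htr : ∀ E : Fin d → Fin d → ℝ, (∑ i, E i i) ^ 2 ≤ d * ∑ i, ∑ j, E i j ^ 2 := fun E => by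
    have h1 := sq_sum_le_card_mul_sum_sq (s := (Finset.univ : Finset (Fin d)))
      (f := fun i => E i i)
    rw [Finset.card_univ, Fintype.card_fin] at h1
    refine h1.trans (mul_le_mul_of_nonneg_left ?_ (Nat.cast_nonneg d))
    exact Finset.sum_le_sum fun i _ => Finset.single_le_sum
      (f := fun j => E i j ^ 2) (fun j _ => sq_nonneg _) (Finset.mem_univ i)
  -- For `lam ≥ 0` the trace term is dropped. For `lam ≤ 0` the trace inequality bounds it below by
  -- `d * lam` times the sum of squares, and the constant is positive by `hlam`.
  rcases le_total 0 lam with hl | hl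
  · refine ⟨2 * mu, by positivity, fun E => ?_⟩
    have := mul_nonneg hl (sq_nonneg (∑ i, E i i))
    linarith
  · refine ⟨2 * mu + d * lam, hlam, fun E => ?_⟩
    have := mul_le_mul_of_nonpos_left (htr E) hl
    linarith

/-- The elastic energy of two polynomial strain fields on an element. -/
noncomputable def elasticForm (mu lam : ℝ) (T : M.elems) (E E' : Fin d → Fin d → Poly d) : ℝ :=
  2 * mu * elemIntegral T (∑ i, ∑ j, E i j * E' i j) +
    lam * elemIntegral T ((∑ i, E i i) * ∑ i, E' i i)

theorem elasticForm_comm (T : M.elems) (E E' : Fin d → Fin d → Poly d) :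
    elasticForm mu lam T E' E = elasticForm mu lam T E E' := by
  simp only [elasticForm, mul_comm]

theorem elasticForm_add (T : M.elems) (E E' E'' : Fin d → Fin d → Poly d) :
    elasticForm mu lam T (E + E') E'' = elasticForm mu lam T E E'' + elasticForm mu lam T E' E'' := by
  simp only [elasticForm, Pi.add_apply, add_mul, Finset.sum_add_distrib, map_add]
  ring

theorem elasticForm_smul (T : M.elems) (c : ℝ) (E E' : Fin d → Fin d → Poly d) :
    elasticForm mu lam T (c • E) E' = c * elasticForm mu lam T E E' := by
  simp only [elasticForm, Pi.smul_apply, smul_mul_assoc, ← Finset.smul_sum, map_smul, smul_eq_mul]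
  ring

theorem elasticForm_self_ge {κ : ℝ}
    (hκ : ∀ E : Fin d → Fin d → ℝ,
      κ * ∑ i, ∑ j, E i j ^ 2 ≤ 2 * mu * ∑ i, ∑ j, E i j ^ 2 + lam * (∑ i, E i i) ^ 2)
    (T : M.elems) (E : Fin d → Fin d → Poly d) :
    κ * elemIntegral T (∑ i, ∑ j, E i j ^ 2) ≤ elasticForm mu lam T E E := by
  have h := elemIntegral_nonneg (T := T) (f := (2 * mu) • (∑ i, ∑ j, E i j * E i j) +
    lam • ((∑ i, E i i) * ∑ i, E i i) - κ • ∑ i, ∑ j, E i j ^ 2) fun x _ => by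
      have := hκ fun i j => ev (E i j) x
      simp only [ev_sub, ev_add, ev_smul, ev_sum, ev_pow, ← sq, sub_nonneg]
      exact this
  rw [map_sub, map_add, map_smul, map_smul, map_smul, sub_nonneg] at h
  exact h

theorem elemIntegral_sum_sq_nonneg (T : M.elems) (E : Fin d → Fin d → Poly d) :
    0 ≤ elemIntegral T (∑ i, ∑ j, E i j ^ 2) :=
  elemIntegral_nonneg fun x _ => by
    simp only [ev_sum, ev_pow]
    exact Finset.sum_nonneg fun i _ => Finset.sum_nonneg fun j _ => sq_nonneg _

theorem eq_zero_of_elemIntegral_sum_sq {E : Fin d → Fin d → Poly d}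
    (h : elemIntegral T (∑ i, ∑ j, E i j ^ 2) = 0) (i j : Fin d) : E i j = 0 := by
  have h1 := eq_zero_of_elemIntegral_eq_zero (fun x _ => by
    simp only [ev_sum, ev_pow]
    exact Finset.sum_nonneg fun i _ => Finset.sum_nonneg fun j _ => sq_nonneg _) h
  rw [← Fintype.sum_prod_type' (f := fun i j => E i j ^ 2)] at h1
  exact eq_zero_of_sum_sq_eq_zero (p := fun ij : Fin d × Fin d => E ij.1 ij.2) h1 (i, j)
    (Finset.mem_univ _)

theorem normVh_eq {v : M.VectorWeak} (hv : v ∈ M.Vh k) : M.normVh k mu lam v =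
    Real.sqrt (∑ T : M.elems, elasticForm mu lam T (M.weakStrain (M.weakDegree k T) T v)
      (M.weakStrain (M.weakDegree k T) T v)) := by
  simp only [normVh, elasticForm, elemIntegral_apply, weakDiv_eq_trace hv, ev_sum, ev_pow, ← sq]

/-- A vector weak function with vanishing weak strain and vanishing boundary values on a part of
the boundary of positive measure is zero. -/
theorem eq_zero_of_weakStrain_eq_zero (hopen : IsOpen Ω) (hconn : IsConnected Ω)
    (hΩ : interior (closure Ω) = Ω) {Γ : Set (Space d)} (hΓ : Γ ⊆ frontier Ω)
    (hpos : 0 < (μHE[d - 1] : Measure (Space d)) Γ) (hM : M.NoCoplanarFaces) (hk : 1 ≤ k)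
    {v : M.VectorWeak} (hv : v ∈ M.VhZero k Γ)
    (h : ∀ T i j, M.weakStrain (M.weakDegree k T) T v i j = 0) : v = 0 := by
  obtain ⟨hvV, hvΓ⟩ := hv
  obtain ⟨b, hb, hvb⟩ := exists_face_polys_vec hvV
  have hker : ∀ T,
      (∀ i j, MvPolynomial.pderiv j (v.1 T i) + MvPolynomial.pderiv i (v.1 T j) = 0) ∧
        ∀ e ∈ M.facesOf T, ∀ x ∈ (e : Set (Space d)), ∀ i, ev (b i e) x = ev (v.1 T i) x :=
    fun T => weakForm_kernel_symm hM hk (fun i => hvV.1 T trivial i trivial) hb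
      fun φ hφ hsym => by
        rw [← ((isWeakGradVec_iff hvb).1 (isWeakGradVec_weakGradVec hvV)).2 φ hφ]
        have h1 := two_mul_sum_mul_symm (M.weakGradVec (M.weakDegree k T) T v) φ hsym
        have h2 : ∀ i j, M.weakGradVec (M.weakDegree k T) T v i j +
            M.weakGradVec (M.weakDegree k T) T v j i = 0 := fun i j =>
          (smul_eq_zero.1 (h T i j)).resolve_left (by norm_num)
        simp only [h2, zero_mul, Finset.sum_const_zero] at h1
        rw [(mul_eq_zero.1 h1).resolve_left two_ne_zero, map_zero]
  have hzero : ∀ T, v.1 T = 0 := by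
    refine forall_elem_of_face_chain hopen hconn hΩ ?_ fun T T' e he he' hT => ?_
    · obtain ⟨e, hepos⟩ := exists_face_measure_inter_pos (M := M) hopen hΩ hΓ hpos
      obtain ⟨T, he⟩ := exists_elem_of_face e
      have hZ := measure_pos_of_ae_imp (P := fun x => ∀ i, ev (b i e) x = 0)
        (by filter_upwards [hvΓ e] with x hx hxΓ i; rw [← hvb, hx hxΓ]) hepos
      exact ⟨T, eq_zero_of_strain_eq_zero (hker T).1 (fun x hx => hx.1) hZ fun x hx i => by
        rw [← (hker T).2 e he x hx.1 i, hx.2 i]⟩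
    -- One common point need not determine a rigid motion; here the whole shared face, of positive
    -- surface measure, is used.
    · obtain ⟨n, c, hn⟩ := (M.isFace e e.2).exists_isFaceIn
      exact eq_zero_of_strain_eq_zero (hker T').1 subset_rfl hn.measure_pos fun x hx i => by
        rw [← (hker T').2 e he' x hx i, (hker T).2 e he x hx i, hT]
        simp
  refine Prod.ext (funext hzero) (funext fun e => funext fun i => funext fun x => ?_)
  obtain ⟨T, he⟩ := exists_elem_of_face e
  rw [hvb i e x, (hker T).2 e he x x.2 i, hzero T]
  simp

theorem isNorm_normVh (hopen : IsOpen Ω) (hconn : IsConnected Ω) (hΩ : interior (closure Ω) = Ω)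
    {Γ : Set (Space d)} (hΓ : Γ ⊆ frontier Ω) (hpos : 0 < (μHE[d - 1] : Measure (Space d)) Γ)
    (hM : M.NoCoplanarFaces) (hk : 1 ≤ k) (hmu : 0 < mu) (hlam : 0 < 2 * mu + d * lam) :
    IsNorm fun v : M.VhZero k Γ => M.normVh k mu lam v := by
  obtain ⟨κ, hκ0, hκ⟩ := exists_coercivity_const hmu hlam
  have hnonneg : ∀ (T : M.elems) (E : Fin d → Fin d → Poly d), 0 ≤ elasticForm mu lam T E E :=
    fun T E => (mul_nonneg hκ0.le (elemIntegral_sum_sq_nonneg T E)).trans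
      (elasticForm_self_ge hκ T E)
  refine isNorm_sqrt_form (fun v v' : M.VhZero k Γ => ∑ T : M.elems,
    elasticForm mu lam T (M.weakStrain (M.weakDegree k T) T v)
      (M.weakStrain (M.weakDegree k T) T v'))
    (fun v => normVh_eq v.2.1) (fun v v' => ?_) (fun v v' v'' => ?_) (fun v v' c => ?_)
    (fun v => ?_) fun v hv => ?_
  · exact Finset.sum_congr rfl fun T _ => elasticForm_comm T _ _
  · rw [← Finset.sum_add_distrib]
    refine Finset.sum_congr rfl fun T _ => ?_
    rw [← elasticForm_add]
    congr 1
    funext i j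
    exact weakStrain_add v.2.1 v'.2.1 i j
  · rw [Finset.mul_sum]
    refine Finset.sum_congr rfl fun T _ => ?_
    rw [← elasticForm_smul]
    congr 1
    funext i j
    exact weakStrain_smul c v.2.1 i j
  · exact Finset.sum_nonneg fun T _ => hnonneg T _
  · have h := (Finset.sum_eq_zero_iff_of_nonneg fun T _ => hnonneg T _).1 hv
    refine Subtype.ext (eq_zero_of_weakStrain_eq_zero hopen hconn hΩ hΓ hpos hM hk v.2
      fun T => eq_zero_of_elemIntegral_sum_sq (T := T) ?_)
    refine le_antisymm ?_ (elemIntegral_sum_sq_nonneg T _)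
    have h1 := elasticForm_self_ge hκ T (M.weakStrain (M.weakDegree k T) T v)
    rw [h T (Finset.mem_univ T)] at h1
    exact nonpos_of_mul_nonpos_right h1 hκ0

end Vector

end PolytopalMesh

end WG

theorem mainTheorem8 {d : ℕ} (hd : 1 ≤ d)
    {Ω : Set (WG.Space d)} (hΩ_open : IsOpen Ω) (hΩ_conn : IsConnected Ω)
    (hΩ_reg : interior (closure Ω) = Ω)
    {Γc Γt : Set (WG.Space d)} (hΓ_disj : Disjoint Γc Γt) (hΓ_union : Γc ∪ Γt = frontier Ω)
    (hΓc : 0 < (μHE[d - 1] : MeasureTheory.Measure (WG.Space d)) Γc)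
    (hΓt : 0 < (μHE[d - 1] : MeasureTheory.Measure (WG.Space d)) Γt)
    (M : WG.PolytopalMesh d Ω) (hM : M.NoCoplanarFaces)
    (k : ℕ) (hk : 1 ≤ k)
    (mu lam : ℝ) (hmu : 0 < mu) (hlam : 0 < 2 * mu + d * lam)
    (K : WG.Space d → Matrix (Fin d) (Fin d) ℝ)
    (hK_int : ∀ i j, MeasureTheory.IntegrableOn (fun x => K x i j) Ω)
    (hK_pos : ∀ x ∈ Ω, (K x).PosDef) :
    WG.IsNorm (fun v : M.VhZero k Γc => M.normVh k mu lam v) ∧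
      WG.IsNorm (fun q : M.WhZero k Γt => M.normWh k K q) := by
  have hc : Γc ⊆ frontier Ω := hΓ_union ▸ Set.subset_union_left
  have ht : Γt ⊆ frontier Ω := hΓ_union ▸ Set.subset_union_right
  exact ⟨WG.PolytopalMesh.isNorm_normVh hΩ_open hΩ_conn hΩ_reg hc hΓc hM hk hmu hlam,
    WG.PolytopalMesh.isNorm_normWh hΩ_open hΩ_conn hΩ_reg ht hΓt hM hk hK_int hK_pos⟩
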